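/- \textbf{Setting.} A Resolution refutation of a CNF formula is a sequence of clauses (sets of literals) ending in the empty clause, each of which is a clause of the formula, a weakening of an earlier clause, or the resolvent of two earlier clauses. Let $n,m,s,t\in\mathbb N$ and $\mathrm{Lit}_n=\{x_1,\dots,x_n,\neg x_1,\dots,\neg x_n\}$. \emph{The formula $\mathrm{Sat}(\varphi,\alpha)$.} A CNF formula $\varphi$ with $n$ variables and $m$ clauses is given by variables $\mathrm{alit}^A_\ell$ (the literal $\ell$ is in the clause $A\in[m]$), and an assignment by variables $\alpha_i$. With further variables $\mathrm{sat}^A_\ell$, the clauses of $\mathrm{Sat}(\varphi,\alpha)$ are $\neg\mathrm{sat}^A_\ell\lor\mathrm{alit}^A_\ell$, $\ \neg\mathrm{sat}^A_{x_i}\lor\alpha_i$, $\ \neg\mathrm{sat}^A_{\neg x_i}\lor\neg\alpha_i$ and $\bigvee_{\ell}\mathrm{sat}^A_\ell$. \emph{The formula $\mathrm{Ref}_s(\psi)$.} For a CNF formula $\psi$ it says that $\psi$ has a refutation consisting of $s$ blocks. For $B,B'\in[s]$ with $B'<B$, a clause $A$ of $\psi$, a variable $x$ of $\psi$ and a literal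 $\ell$ over the variables of $\psi$, it has variables $\mathrm{en}^B$, $\mathrm{der}^B$, $\mathrm{weak}^B_A$, $\mathrm{lit}^B_\ell$, $\mathrm{res}^B_x$, $\mathrm{lp}^B_{B'}$, $\mathrm{rp}^B_{B'}$ and the clauses (1) $\mathrm{en}^B\land\mathrm{res}^B_x\land\mathrm{lp}^B_{B'}\land\mathrm{lit}^{B'}_\ell\to\mathrm{lit}^B_\ell$ for $\ell\ne x$; (2) the same with $\mathrm{rp}$ for $\mathrm{lp}$, for $\ell\neq\neg x$; (3) $\mathrm{en}^B\land\mathrm{weak}^B_A\land[\ell\in A]\to\mathrm{lit}^B_\ell$; (4) $\mathrm{en}^B\land\mathrm{der}^B\to\bigvee_x\mathrm{res}^B_x$; (5), (6) $\mathrm{en}^B\land\mathrm{der}^B\to\bigvee_{B'<B}\mathrm{lp}^B_{B'}$, and the same with $\mathrm{rp}$; (7) $\mathrm{en}^B\land\neg\mathrm{der}^B\to\bigvee_A\mathrm{weak}^B_A$; (8), (9) $\mathrm{en}^B\land\mathrm{lp}^B_{B'}\to\mathrm{en}^{B'}$, and the same with $\mathrm{rp}$; (10) $\neg\mathrm{lit}^s_\ell$;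 (11) $\mathrm{en}^s$. For $\psi=\varphi$ the expression $[\ell\in A]$ is the variable $\mathrm{alit}^A_\ell$. For $\psi=\mathrm{Ref}_s(\varphi)$ the clause (3) of $\mathrm{Ref}_s(\varphi)$ for $(B,A,\ell)$ is regarded as the clause $\neg\mathrm{en}^B\lor\neg\mathrm{weak}^B_A\lor\mathrm{lit}^B_\ell$, which belongs to $\mathrm{Ref}_s(\varphi)$ if and only if $\mathrm{alit}^A_\ell=1$. Accordingly $\mathrm{Ref}_t(\mathrm{Ref}_s(\varphi),\pi)$, where $\pi$ denotes its variables other than the $\mathrm{alit}^A_\ell$, also has the clauses $\mathrm{en}^{\mathcal B}\land\mathrm{weak}^{\mathcal B}_{(3,B,A,\ell)}\to\mathrm{alit}^A_\ell$, which say that only clauses that are present are weakened. \emph{Pseudo-negation.} For $\psi=C_1\land\dots\land C_M$, the formula $\mathrm{pneg}\,\psi$ has new variables $\mu_1,\dots,\mu_M$ and the clauses $\bigvee_i\mu_i$ and $\neg\mu_i\lor\neg\ell$, for $i\in[M]$ and $\ell\in C_i$. \emph{The construction $P(\varphi,\alpha,s)$.} Let $T(B)=\bigvee_{\alpha(\ell)=1}\mathrm{lit}^B_\ell$,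 let $\ell_j$ be the literal on $x_j$ that is true under $\alpha$, and let $p^B_{C,i}$ be $\mathrm{lp}^B_C$ if $\alpha(x_i)=0$ and $\mathrm{rp}^B_C$ if $\alpha(x_i)=1$. For $B=1,\dots,s$ one derives $\neg\mathrm{en}^B\lor T(B)$ from the same clauses for $C<B$ as follows. The clauses $\neg\mathrm{en}^B\lor\neg\mathrm{weak}^B_A\lor T(B)$ are weakenings of the clauses (3) with $\ell\in A$ and $\alpha(\ell)=1$ (of all of them at once); cutting them one by one with (7) gives $\neg\mathrm{en}^B\lor\mathrm{der}^B\lor T(B)$ (just the clause (7) if $m=0$). For $C<B$ and $i\in[n]$, cutting $\neg\mathrm{en}^C\lor T(C)$ over $\mathrm{lit}^C_{\ell_j}$, $j=1,\dots,n$, with the clauses (1) (if $\alpha(x_i)=0$) or (2) (if $\alpha(x_i)=1$) for $B,C,x_i,\ell_j$, and then with (8) or (9), gives $\neg\mathrm{en}^B\lor\neg\mathrm{res}^B_{x_i}\lor\neg p^B_{C,i}\lor T(B)$. For each $i$, cutting the weakening $\neg\mathrm{en}^B\lor\neg\mathrm{der}^B\lor\neg\mathrm{res}^B_{x_i}\lor\bigvee_{C<B}p^B_{C,i}\lor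 T(B)$ of (5) or (6) with these clauses for all $C<B$ gives $\neg\mathrm{en}^B\lor\neg\mathrm{der}^B\lor\neg\mathrm{res}^B_{x_i}\lor T(B)$. Cutting (4) with these for all $i$ gives $\neg\mathrm{en}^B\lor\neg\mathrm{der}^B\lor T(B)$ (just the clause (4) if $n=0$), and a cut over $\mathrm{der}^B$ gives $\neg\mathrm{en}^B\lor T(B)$. Finally $\neg\mathrm{en}^s\lor T(s)$ is cut with (11) and with (10) for $\ell_1,\dots,\ell_n$. Let $\tau=\tau(n,m,s)$ be the number of lines, counting the clauses of $\mathrm{Ref}_s(\varphi)$ that are used in cuts. For $t\ge\tau$ the empty clause is put into block $t$, the other lines in order into the blocks $1,\dots,\tau-1$, and in all other blocks all variables are $0$. In this way each variable $z$ of $\pi$ becomes a constant, a literal, or a conjunction of two literals over the variables $\alpha_i$ and $\mathrm{alit}^A_\ell$; this is the circuit $P$. The formula $\pi=P(\varphi,\alpha,s)$ consists of the clauses (at most three for each $z$) that express these equivalences. \textbf{Theorem.} \begin{enumerate} \item $\tau=\Theta(s(m+sn^2))$: there are constants $c,C>0$ such that $\tau(n,m,s)\le C\,s(m+sn^2)$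 whenever $s\ge1$ and $n+m\ge1$, and $s(m+sn^2)\le c\,\tau(n,m,s)$ whenever $s\ge2$. \item $P$ is a circuit of fan-in 2, depth at most 2 and size polynomial in $n+m+s+t$. \item If $s\ge1$, $t\ge\tau$, $\varphi$ is a CNF formula with $n$ variables and $m$ clauses, and $\alpha$ satisfies $\varphi$, then $\pi=P(\varphi,\alpha,s)$ is a refutation of $\mathrm{Ref}_s(\varphi)$ with exactly $\tau$ enabled blocks, in the sense that it satisfies every clause of $\mathrm{Ref}_t(\mathrm{Ref}_s(\varphi),\pi)$. \item There are a polynomial $p$ and a single algorithm (a random access machine with addition and subtraction at unit cost) which, for all $n,m,s,t$ with $s\ge1$ and $t\ge\tau(n,m,s)$, on input $(n,m,s,t)$ outputs within $p(n+m+s+t)$ steps a Resolution refutation of size at most $p(n+m+s+t)$ of \[\mathrm{Sat}(\varphi,\alpha)\ \land\ \mathrm{pneg}\,\mathrm{Ref}_t(\mathrm{Ref}_s(\varphi),\pi)\ \land\ \pi=P(\varphi,\alpha,s),\] where the variables of $\varphi$, $\alpha$ and $\pi$ are all free. \end{enumerate} -/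

import Mathlib

/-! ### Clauses, CNF formulas and Resolution -/

/-- A literal over the set `V` of propositional variables. -/
inductive Lit (V : Type) where
  | pos (v : V)
  | neg (v : V)
  deriving DecidableEq, Fintype

/-- The underlying variable of a literal. -/
def Lit.var {V : Type} : Lit V → V
  | .pos v => v
  | .neg v => v

/-- The complementary literal. -/
def Lit.compl {V : Type} : Lit V → Lit V
  | .pos v => .neg v
  | .neg v => .pos v

/-- Renaming of variables. -/
def Lit.map {V W : Type} (f : V → W) : Lit V → Lit W
  | .pos v => .pos (f v)
  | .neg v => .neg (f v)

/-- The truth value of a literal under an assignment. -/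
def Lit.eval {V : Type} (ρ : V → Bool) : Lit V → Bool
  | .pos v => ρ v
  | .neg v => !(ρ v)

/-- Clauses are finite sets of literals. -/
abbrev Clause (V : Type) : Type := Finset (Lit V)

/-- A clause is satisfied by an assignment if one of its literals is. -/
def Clause.Sat {V : Type} (C : Clause V) (ρ : V → Bool) : Prop := ∃ l ∈ C, l.eval ρ = true

/-- Renaming of the variables of a clause. -/
def Clause.rename {V W : Type} [DecidableEq W] (f : V → W) (C : Clause V) : Clause W :=
  C.image (Lit.map f)

/-- `D` follows in one Resolution step over the clauses `F` and the earlier clauses `prev`: it is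
a clause of `F`, a weakening of an earlier clause, or the resolvent of two earlier clauses. -/
def ResStep {V : Type} [DecidableEq V] (F : Set (Clause V)) (prev : List (Clause V))
    (D : Clause V) : Prop :=
  D ∈ F ∨ (∃ C ∈ prev, C ⊆ D) ∨
    ∃ C ∈ prev, ∃ C' ∈ prev, ∃ x : V, Lit.pos x ∈ C ∧ Lit.neg x ∈ C' ∧
      D = C.erase (Lit.pos x) ∪ C'.erase (Lit.neg x)

/-- A Resolution refutation of `F`: a sequence of clauses ending in the empty clause, each of
which follows in one step. -/
def IsRefutation {V : Type} [DecidableEq V] (F : Set (Clause V)) (Q : List (Clause V)) : Prop :=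
  (∀ (k : ℕ) (h : k < Q.length), ResStep F (Q.take k) Q[k]) ∧ Q.getLast? = some ∅

/-- The pseudo-negation of the CNF formula with clauses `f i`, `i : I`. The new variable `inr i`
says that the clause `f i` is falsified. -/
def pneg {V I : Type} [DecidableEq V] [DecidableEq I] [Fintype I] (f : I → Clause V) :
    Set (Clause (V ⊕ I)) :=
  {Finset.univ.image (fun i => Lit.pos (Sum.inr i))} ∪
    {D | ∃ i, ∃ l ∈ f i, D = {Lit.neg (Sum.inr i), (l.map Sum.inl).compl}}

/-! ### The formula `Sat(φ, α)` -/

/-- The variables of `Sat(φ, α)` for a CNF formula `φ` with `n` variables and `m` clauses: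
`alpha i` is the value of `x_i`, `alit A l` says that the literal `l` is in the clause `A` of `φ`,
and `sat A l` says that the clause `A` is satisfied because `l` is true. -/
inductive SVar (n m : ℕ) where
  | alpha (i : Fin n)
  | alit (A : Fin m) (l : Lit (Fin n))
  | sat (A : Fin m) (l : Lit (Fin n))
  deriving DecidableEq, Fintype

/-- The clauses of `Sat(φ, α)`. -/
def satCNF (n m : ℕ) : Set (Clause (SVar n m)) :=
  {D | ∃ A l, D = {.neg (.sat A l), .pos (.alit A l)}} ∪
  {D | ∃ A i, D = {.neg (.sat A (.pos i)), .pos (.alpha i)}} ∪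
  {D | ∃ A i, D = {.neg (.sat A (.neg i)), .neg (.alpha i)}} ∪
  {D | ∃ A, D = Finset.univ.image (fun l => Lit.pos (SVar.sat A l))}

/-! ### The formulas `Ref`

`Ref_s(ψ)` is defined for a CNF formula `ψ` that may depend on parameter variables `P`; this covers
both a formula `φ` given by its `alit` variables and the formula `Ref_s(φ)` for such a `φ`. -/

/-- A condition on the parameters: false, true, or the value of a parameter. -/
inductive Cond (P : Type) where
  | no
  | yes
  | var (p : P)

/-- A CNF formula over the variables `V` with clauses labelled by `I`, depending on parameters `P`.
The literal `l` is in the clause `A` iff `mem A l` holds, and the clause `A` belongs to the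
formula iff all literals in `guard A` are true. -/
structure PCNF (V I P : Type) where
  mem : I → Lit V → Cond P
  guard : I → Finset (Lit P)

/-- The formula `φ` with `n` variables and `m` clauses given by the variables `alit`. -/
def phi (n m : ℕ) : PCNF (Fin n) (Fin m) (SVar n m) where
  mem A l := .var (.alit A l)
  guard _ := ∅

/-- A CNF formula over variables `V` and parameters `P`, seen as a formula over `V` only. Once the
parameters are fixed, the clauses with a true literal over `P` disappear, and the literals over
`P` are removed from the other ones. -/
def PCNF.ofCNF {V I P : Type} [DecidableEq V] [DecidableEq P] [Fintype P]
    (f : I → Clause (V ⊕ P)) : PCNF V I P where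
  mem A l := if l.map Sum.inl ∈ f A then .yes else .no
  guard A := Finset.univ.filter (fun g => g.compl.map Sum.inr ∈ f A)

/-- The variables describing a Resolution refutation with `s` blocks of a formula with variables
`V` and clauses `I`; the blocks that come before `B` are the elements of `Fin B`. The block `B`
is enabled (`en`); is obtained by a Resolution step (`der`); by weakening of the clause `A`
(`weak`); contains `l` (`lit`); is obtained by resolving over `x` (`res`), on the left (`lp`) or
on the right (`rp`) from the block `C`. -/
inductive RVar (V I : Type) (s : ℕ) where
  | en (B : Fin s)
  | der (B : Fin s)
  | weak (B : Fin s) (A : I)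
  | lit (B : Fin s) (l : Lit V)
  | res (B : Fin s) (x : V)
  | lp (B : Fin s) (C : Fin B)
  | rp (B : Fin s) (C : Fin B)
  deriving DecidableEq, Fintype

/-- Labels for the clauses of `Ref_s(ψ)`. -/
inductive RAx (V I P : Type) (s : ℕ) where
  | left (B : Fin s) (C : Fin B) (x : V) (l : Lit V)
  | right (B : Fin s) (C : Fin B) (x : V) (l : Lit V)
  | weak (B : Fin s) (A : I) (l : Lit V)
  | mustRes (B : Fin s)
  | mustLeft (B : Fin s)
  | mustRight (B : Fin s)
  | mustWeak (B : Fin s)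
  | enLeft (B : Fin s) (C : Fin B)
  | enRight (B : Fin s) (C : Fin B)
  | rootEmpty (B : Fin s) (l : Lit V)
  | rootEn (B : Fin s)
  | guard (B : Fin s) (A : I) (g : Lit P)
  deriving DecidableEq, Fintype

/-- A block before `B`, as a block. -/
def earlier {s : ℕ} (B : Fin s) (C : Fin B) : Fin s := ⟨C, C.2.trans B.2⟩

section RefFormula

variable {V I P : Type} [DecidableEq V] [DecidableEq I] [DecidableEq P]

/-- The labels that do label a clause of `Ref_s(ψ)`. The last block is the root. -/
def refOk (ψ : PCNF V I P) (s : ℕ) : RAx V I P s → Bool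
  | .left _ _ x l => decide (l ≠ .pos x)
  | .right _ _ x l => decide (l ≠ .neg x)
  | .weak _ A l => match ψ.mem A l with
    | .no => false
    | _ => true
  | .rootEmpty B _ => decide (B.val + 1 = s)
  | .rootEn B => decide (B.val + 1 = s)
  | .guard _ A g => decide (g ∈ ψ.guard A)
  | _ => true

/-- The clause of `Ref_s(ψ)` with a given label. The clauses `guard` say that a block can be
a weakening only of a clause that belongs to `ψ`; there are none for `ψ = φ`. -/
def refClause [Fintype V] [Fintype I] (ψ : PCNF V I P) (s : ℕ) :
    RAx V I P s → Clause (RVar V I s ⊕ P)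
  | .left B C x l => {.neg (.inl (.en B)), .neg (.inl (.res B x)), .neg (.inl (.lp B C)),
      .neg (.inl (.lit (earlier B C) l)), .pos (.inl (.lit B l))}
  | .right B C x l => {.neg (.inl (.en B)), .neg (.inl (.res B x)), .neg (.inl (.rp B C)),
      .neg (.inl (.lit (earlier B C) l)), .pos (.inl (.lit B l))}
  | .weak B A l => {.neg (.inl (.en B)), .neg (.inl (.weak B A)), .pos (.inl (.lit B l))} ∪
      match ψ.mem A l with
      | .var p => {.neg (.inr p)}
      | _ => ∅
  | .mustRes B => {.neg (.inl (.en B)), .neg (.inl (.der B))} ∪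
      Finset.univ.image (fun x => .pos (.inl (.res B x)))
  | .mustLeft B => {.neg (.inl (.en B)), .neg (.inl (.der B))} ∪
      Finset.univ.image (fun C => .pos (.inl (.lp B C)))
  | .mustRight B => {.neg (.inl (.en B)), .neg (.inl (.der B))} ∪
      Finset.univ.image (fun C => .pos (.inl (.rp B C)))
  | .mustWeak B => {.neg (.inl (.en B)), .pos (.inl (.der B))} ∪
      Finset.univ.image (fun A => .pos (.inl (.weak B A)))
  | .enLeft B C => {.neg (.inl (.en B)), .neg (.inl (.lp B C)), .pos (.inl (.en (earlier B C)))}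
  | .enRight B C => {.neg (.inl (.en B)), .neg (.inl (.rp B C)), .pos (.inl (.en (earlier B C)))}
  | .rootEmpty B l => {.neg (.inl (.lit B l))}
  | .rootEn B => {.pos (.inl (.en B))}
  | .guard B A g => {.neg (.inl (.en B)), .neg (.inl (.weak B A)), g.map .inr}

/-- The type of (labels of) clauses of `Ref_s(ψ)`. -/
abbrev RefIdx (ψ : PCNF V I P) (s : ℕ) : Type := {a : RAx V I P s // refOk ψ s a = true}

/-- The CNF formula `Ref_s(ψ)`. -/
def refCNF [Fintype V] [Fintype I] (ψ : PCNF V I P) (s : ℕ) :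
    RefIdx ψ s → Clause (RVar V I s ⊕ P) :=
  fun a => refClause ψ s a.1

end RefFormula

/-- The variables of `Ref_s(φ)`, other than those of `φ`. -/
abbrev InVar (n m s : ℕ) : Type := RVar (Fin n) (Fin m) s

/-- The clauses of `Ref_s(φ)`. -/
abbrev InIdx (n m s : ℕ) : Type := RefIdx (phi n m) s

/-- `Ref_s(φ)` as a formula depending on the parameters `φ`. -/
def refPhi (n m s : ℕ) : PCNF (InVar n m s) (InIdx n m s) (SVar n m) :=
  .ofCNF (refCNF (phi n m) s)

/-- The variables `π` of `Ref_t(Ref_s(φ), π)`. -/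
abbrev OutVar (n m s t : ℕ) : Type := RVar (InVar n m s) (InIdx n m s) t

/-- The clauses of `Ref_t(Ref_s(φ), π)`. -/
abbrev OutIdx (n m s t : ℕ) : Type := RefIdx (refPhi n m s) t

instance instDecidableEqOutVar (n m s t : ℕ) : DecidableEq (OutVar n m s t) := inferInstance

instance instDecidableEqOutIdx (n m s t : ℕ) : DecidableEq (OutIdx n m s t) := inferInstance

/-- The formula `Ref_t(Ref_s(φ), π)`, whose variables are `π` and the variables of `φ`. -/
def refRef (n m s t : ℕ) : OutIdx n m s t → Clause (OutVar n m s t ⊕ SVar n m) :=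
  refCNF (refPhi n m s) t

/-! ### Circuits -/

/-- Boolean circuits of fan-in 2 over the inputs `X`. -/
inductive Circuit (X : Type) where
  | const (b : Bool)
  | input (x : X)
  | not (c : Circuit X)
  | and (c d : Circuit X)
  | or (c d : Circuit X)

/-- The depth of a circuit. -/
def Circuit.depth {X : Type} : Circuit X → ℕ
  | .const _ => 0
  | .input _ => 0
  | .not c => c.depth + 1
  | .and c d => max c.depth d.depth + 1
  | .or c d => max c.depth d.depth + 1

/-- The number of nodes of a circuit. -/
def Circuit.size {X : Type} : Circuit X → ℕ
  | .const _ => 1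
  | .input _ => 1
  | .not c => c.size + 1
  | .and c d => c.size + d.size + 1
  | .or c d => c.size + d.size + 1

/-- The value computed by a circuit. -/
def Circuit.eval {X : Type} (ρ : X → Bool) : Circuit X → Bool
  | .const b => b
  | .input x => ρ x
  | .not c => !(c.eval ρ)
  | .and c d => c.eval ρ && d.eval ρ
  | .or c d => c.eval ρ || d.eval ρ

/-- The kinds of functions that occur as outputs in the construction: a constant, a literal, or
the conjunction of two literals. -/
inductive Gate (X : Type) where
  | const (b : Bool)
  | lit (l : Lit X)
  | and (l l' : Lit X)

/-- A literal as a circuit. -/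
def Lit.toCircuit {X : Type} : Lit X → Circuit X
  | .pos x => .input x
  | .neg x => .not (.input x)

/-- The circuit computing the output `g`. -/
def Gate.toCircuit {X : Type} : Gate X → Circuit X
  | .const b => .const b
  | .lit l => l.toCircuit
  | .and l l' => .and l.toCircuit l'.toCircuit

/-- The clauses expressing `z ↔ g`, for a variable `z` in `Y`. -/
def Gate.clauses {X Y : Type} [DecidableEq X] [DecidableEq Y] (z : Y) :
    Gate X → Set (Clause (Y ⊕ X))
  | .const true => {{.pos (.inl z)}}
  | .const false => {{.neg (.inl z)}}
  | .lit l => {{.neg (.inl z), l.map .inr}, {.pos (.inl z), (l.map .inr).compl}}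
  | .and l l' => {{.neg (.inl z), l.map .inr}, {.neg (.inl z), l'.map .inr},
      {.pos (.inl z), (l.map .inr).compl, (l'.map .inr).compl}}

/-- `g` if the condition `p` holds, and the constant 0 otherwise. -/
def Gate.when {X : Type} (p : Prop) [Decidable p] (g : Gate X) : Gate X :=
  if p then g else .const false

/-! ### The upper bound construction

`T(B)` denotes the set of literals `lit B l` such that `l` is true under `α`, and `pt(B, C, i)`
denotes the variable `lp B C` if `α(x_i) = 0` and the variable `rp B C` if `α(x_i) = 1`. We write
`l_j` for the literal on `x_j` that is true under `α`. Blocks, clauses and variables are numbered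
from 0. -/

/-- The lines of the refutation of `Ref_s(φ)`:
* `l1 B k`: `¬en B ∨ ¬weak B k ∨ T(B)`, a weakening of any of the clauses
  `en B ∧ weak B k → lit B l` where `l` is in the clause `k` of `φ` and is true;
* `l2 B 0`: the clause `en B ∧ ¬der B → ⋁_k weak B k`;
* `l2 B (k+1)`: `¬en B ∨ der B ∨ ⋁_{k' > k} weak B k' ∨ T(B)`, from `l2 B k` and `l1 B k`;
* `mear B C i j`: the clause `en B ∧ res B i ∧ pt(B, C, i) ∧ lit C l_j → lit B l_j`;
* `r1 B C i j`: `¬en B ∨ ¬en C ∨ ¬res B i ∨ ¬pt(B, C, i)`, together with the literals of `T(C)`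
  on the variables after `x_j` and those of `T(B)` on the other ones, from `r1 B C i (j-1)`
  (`tr C` if `j = 0`) and `mear B C i j`;
* `mel B C i`: the clause `en B ∧ pt(B, C, i) → en C`;
* `r2 B C i`: `¬en B ∨ ¬res B i ∨ ¬pt(B, C, i) ∨ T(B)`, from `mel B C i` and `r1 B C i (n-1)`;
* `r3 B i 0`: `¬en B ∨ ¬der B ∨ ¬res B i ∨ ⋁_C pt(B, C, i) ∨ T(B)`, a weakening of the clause
  `en B ∧ der B → ⋁_C pt(B, C, i)`;
* `r3 B i (c+1)`: `¬en B ∨ ¬der B ∨ ¬res B i ∨ ⋁_{C > c} pt(B, C, i) ∨ T(B)`, from `r3 B i c` and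
  `r2 B c i`;
* `r4 B 0`: the clause `en B ∧ der B → ⋁_i res B i`;
* `r4 B (i+1)`: `¬en B ∨ ¬der B ∨ ⋁_{i' > i} res B i' ∨ T(B)`, from `r4 B i` and `r3 B i B`;
* `tr B`: `¬en B ∨ T(B)`, from `l2 B m` and `r4 B n`;
* `rootEn`: the clause `en (s-1)`;
* `re j`: the clause `¬lit (s-1) l_j`;
* `fin j`: the literals of `T(s-1)` on the variables from `x_j` on, from `rootEn` and `tr (s-1)` if
  `j = 0`, and from `fin (j-1)` and `re (j-1)` otherwise. -/
inductive Line (n : ℕ) where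
  | l1 (B k : ℕ)
  | l2 (B k : ℕ)
  | mear (B C : ℕ) (i j : Fin n)
  | r1 (B C : ℕ) (i j : Fin n)
  | mel (B C : ℕ) (i : Fin n)
  | r2 (B C : ℕ) (i : Fin n)
  | r3 (B : ℕ) (i : Fin n) (c : ℕ)
  | r4 (B i : ℕ)
  | tr (B : ℕ)
  | rootEn
  | re (j : Fin n)
  | fin (j : ℕ)

/-- The lines for the block `B`, in order. -/
def blockLines (n m B : ℕ) : List (Line n) :=
  (List.range m).map (fun k => .l1 B k) ++
  (List.range (m + 1)).map (fun k => .l2 B k) ++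
  (List.finRange n).flatMap (fun i =>
    (List.range B).flatMap (fun C =>
      (List.finRange n).flatMap (fun j => [.mear B C i j, .r1 B C i j]) ++
        [.mel B C i, .r2 B C i]) ++
    (List.range (B + 1)).map (fun c => .r3 B i c)) ++
  (List.range (n + 1)).map (fun i => .r4 B i) ++ [.tr B]

/-- All lines in order, except for the last one, `fin n`, which is the empty clause. -/
def initLines (n m s : ℕ) : List (Line n) :=
  (List.range s).flatMap (fun B => blockLines n m B) ++ [.rootEn] ++
    (List.finRange n).map (fun j => .re j) ++ (List.range n).map (fun j => .fin j)

/-- The number `τ` of clauses of the refutation. -/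
def tau (n m s : ℕ) : ℕ := (initLines n m s).length + 1

/-- The line put into the block `b` of a refutation with `t ≥ τ` blocks: the empty clause is in the
last block, the other lines are in the first blocks, and the remaining blocks are disabled. -/
def lineAt (n m s t b : ℕ) : Option (Line n) :=
  if b + 1 = t then some (.fin n) else (initLines n m s)[b]?

section Construction

variable {n m s : ℕ}

/-- The literal expressing that `l` is true under `α`. -/
def trueLit (l : Lit (Fin n)) : Lit (SVar n m) :=
  match l with
  | .pos i => .pos (.alpha i)
  | .neg i => .neg (.alpha i)

/-- `α(x_i) = 1`. -/
def isOne (i : Fin n) : Lit (SVar n m) := .pos (.alpha i)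

/-- `α(x_i) = 0`. -/
def isZero (i : Fin n) : Lit (SVar n m) := .neg (.alpha i)

/-- Was the line obtained by a Resolution step? -/
def Line.derived : Line n → Bool
  | .l2 _ (_ + 1) => true
  | .r1 _ _ _ _ => true
  | .r2 _ _ _ => true
  | .r3 _ _ (_ + 1) => true
  | .r4 _ (_ + 1) => true
  | .tr _ => true
  | .fin _ => true
  | _ => false

/-- When is the literal `z` in the line? -/
def Line.lit : Line n → Lit (InVar n m s) → Gate (SVar n m)
  | .l1 B k, z => match z with
    | .neg (.en B') => .const (B'.val = B)
    | .neg (.weak B' k') => .const (B'.val = B ∧ k'.val = k)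
    | .pos (.lit B' l) => .when (B'.val = B) (.lit (trueLit l))
    | _ => .const false
  | .l2 B k, z => match z with
    | .neg (.en B') => .const (B'.val = B)
    | .pos (.der B') => .const (B'.val = B)
    | .pos (.weak B' k') => .const (B'.val = B ∧ k ≤ k'.val)
    | .pos (.lit B' l) => .when (B'.val = B ∧ 0 < k) (.lit (trueLit l))
    | _ => .const false
  | .mear B C i j, z => match z with
    | .neg (.en B') => .const (B'.val = B)
    | .neg (.res B' i') => .const (B'.val = B ∧ i' = i)
    | .neg (.lp B' C') => .when (B'.val = B ∧ C'.val = C) (.lit (isZero i))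
    | .neg (.rp B' C') => .when (B'.val = B ∧ C'.val = C) (.lit (isOne i))
    | .neg (.lit C' l) => .when (C'.val = C ∧ l.var = j) (.lit (trueLit l))
    | .pos (.lit B' l) => .when (B'.val = B ∧ l.var = j) (.lit (trueLit l))
    | _ => .const false
  | .r1 B C i j, z => match z with
    | .neg (.en B') => .const (B'.val = B ∨ B'.val = C)
    | .neg (.res B' i') => .const (B'.val = B ∧ i' = i)
    | .neg (.lp B' C') => .when (B'.val = B ∧ C'.val = C) (.lit (isZero i))
    | .neg (.rp B' C') => .when (B'.val = B ∧ C'.val = C) (.lit (isOne i))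
    | .pos (.lit B' l) =>
        .when ((B'.val = C ∧ j < l.var) ∨ (B'.val = B ∧ l.var ≤ j)) (.lit (trueLit l))
    | _ => .const false
  | .mel B C i, z => match z with
    | .neg (.en B') => .const (B'.val = B)
    | .neg (.lp B' C') => .when (B'.val = B ∧ C'.val = C) (.lit (isZero i))
    | .neg (.rp B' C') => .when (B'.val = B ∧ C'.val = C) (.lit (isOne i))
    | .pos (.en C') => .const (C'.val = C)
    | _ => .const false
  | .r2 B C i, z => match z with
    | .neg (.en B') => .const (B'.val = B)
    | .neg (.res B' i') => .const (B'.val = B ∧ i' = i)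
    | .neg (.lp B' C') => .when (B'.val = B ∧ C'.val = C) (.lit (isZero i))
    | .neg (.rp B' C') => .when (B'.val = B ∧ C'.val = C) (.lit (isOne i))
    | .pos (.lit B' l) => .when (B'.val = B) (.lit (trueLit l))
    | _ => .const false
  | .r3 B i c, z => match z with
    | .neg (.en B') => .const (B'.val = B)
    | .neg (.der B') => .const (B'.val = B)
    | .neg (.res B' i') => .const (B'.val = B ∧ i' = i)
    | .pos (.lp B' C') => .when (B'.val = B ∧ c ≤ C'.val) (.lit (isZero i))
    | .pos (.rp B' C') => .when (B'.val = B ∧ c ≤ C'.val) (.lit (isOne i))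
    | .pos (.lit B' l) => .when (B'.val = B) (.lit (trueLit l))
    | _ => .const false
  | .r4 B i, z => match z with
    | .neg (.en B') => .const (B'.val = B)
    | .neg (.der B') => .const (B'.val = B)
    | .pos (.res B' i') => .const (B'.val = B ∧ i ≤ i'.val)
    | .pos (.lit B' l) => .when (B'.val = B ∧ 0 < i) (.lit (trueLit l))
    | _ => .const false
  | .tr B, z => match z with
    | .neg (.en B') => .const (B'.val = B)
    | .pos (.lit B' l) => .when (B'.val = B) (.lit (trueLit l))
    | _ => .const false
  | .rootEn, z => match z with
    | .pos (.en B') => .const (B'.val + 1 = s)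
    | _ => .const false
  | .re j, z => match z with
    | .neg (.lit B' l) => .when (B'.val + 1 = s ∧ l.var = j) (.lit (trueLit l))
    | _ => .const false
  | .fin j, z => match z with
    | .pos (.lit B' l) => .when (B'.val + 1 = s ∧ j ≤ l.var.val) (.lit (trueLit l))
    | _ => .const false

/-- When is the line obtained by resolving over the variable `v`? -/
def Line.res : Line n → InVar n m s → Gate (SVar n m)
  | .l2 B (k + 1), .weak B' k' => .const (B'.val = B ∧ k'.val = k)
  | .r1 _ C _ j, .lit C' l => .when (C'.val = C ∧ l.var = j) (.lit (trueLit l))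
  | .r2 _ C _, .en C' => .const (C'.val = C)
  | .r3 B i (c + 1), .lp B' C' => .when (B'.val = B ∧ C'.val = c) (.lit (isZero i))
  | .r3 B i (c + 1), .rp B' C' => .when (B'.val = B ∧ C'.val = c) (.lit (isOne i))
  | .r4 B (i + 1), .res B' i' => .const (B'.val = B ∧ i'.val = i)
  | .tr B, .der B' => .const (B'.val = B)
  | .fin 0, .en B' => .const (B'.val + 1 = s)
  | .fin (j + 1), .lit B' l => .when (B'.val + 1 = s ∧ l.var.val = j) (.lit (trueLit l))
  | _, _ => .const false

/-- When is the line obtained by weakening of the clause with label `a`? -/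
def Line.weak : Line n → RAx (Fin n) (Fin m) (SVar n m) s → Gate (SVar n m)
  | .l1 B k, .weak B' k' l =>
      .when (B'.val = B ∧ k'.val = k) (.and (.pos (.alit k' l)) (trueLit l))
  | .l2 B 0, .mustWeak B' => .const (B'.val = B)
  | .mear B C i j, .left B' C' i' l =>
      .when (B'.val = B ∧ C'.val = C ∧ i' = i ∧ l.var = j) (.and (isZero i) (trueLit l))
  | .mear B C i j, .right B' C' i' l =>
      .when (B'.val = B ∧ C'.val = C ∧ i' = i ∧ l.var = j) (.and (isOne i) (trueLit l))
  | .mel B C i, .enLeft B' C' => .when (B'.val = B ∧ C'.val = C) (.lit (isZero i))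
  | .mel B C i, .enRight B' C' => .when (B'.val = B ∧ C'.val = C) (.lit (isOne i))
  | .r3 B i 0, .mustLeft B' => .when (B'.val = B) (.lit (isZero i))
  | .r3 B i 0, .mustRight B' => .when (B'.val = B) (.lit (isOne i))
  | .r4 B 0, .mustRes B' => .const (B'.val = B)
  | .rootEn, .rootEn B' => .const (B'.val + 1 = s)
  | .re j, .rootEmpty B' l => .when (B'.val + 1 = s ∧ l.var = j) (.lit (trueLit l))
  | _, _ => .const false

/-- `L.leftFrom m K`: the line `K` is the premise of the line `L` that contains the resolved
variable positively. -/
def Line.leftFrom (m : ℕ) : Line n → Line n → Bool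
  | .l2 B (k + 1), .l2 B' k' => B' = B ∧ k' = k
  | .r1 B C i j, .r1 B' C' i' j' => B' = B ∧ C' = C ∧ i' = i ∧ j'.val + 1 = j.val
  | .r1 _ C _ j, .tr C' => C' = C ∧ j.val = 0
  | .r2 B C i, .mel B' C' i' => B' = B ∧ C' = C ∧ i' = i
  | .r3 B i (c + 1), .r3 B' i' c' => B' = B ∧ i' = i ∧ c' = c
  | .r4 B (i + 1), .r4 B' i' => B' = B ∧ i' = i
  | .tr B, .l2 B' k => B' = B ∧ k = m
  | .fin 0, .rootEn => true
  | .fin (j + 1), .fin j' => j' = j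
  | _, _ => false

/-- `L.rightFrom s K`: the line `K` is the premise of the line `L` that contains the resolved
variable negatively. -/
def Line.rightFrom (s : ℕ) : Line n → Line n → Bool
  | .l2 B (k + 1), .l1 B' k' => B' = B ∧ k' = k
  | .r1 B C i j, .mear B' C' i' j' => B' = B ∧ C' = C ∧ i' = i ∧ j' = j
  | .r2 B C i, .r1 B' C' i' j => B' = B ∧ C' = C ∧ i' = i ∧ j.val + 1 = n
  | .r3 B i (c + 1), .r2 B' C' i' => B' = B ∧ C' = c ∧ i' = i
  | .r4 B (i + 1), .r3 B' i' c => B' = B ∧ i'.val = i ∧ c = B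
  | .tr B, .r4 B' i => B' = B ∧ i = n
  | .fin 0, .tr B => B + 1 = s
  | .fin (j + 1), .re j' => j'.val = j
  | _, _ => false

/-- The circuit `P(φ, α, s)`, which computes each of the variables `π` from `φ` and `α`. -/
def pudlak (n m s t : ℕ) : OutVar n m s t → Gate (SVar n m)
  | .en b => .const (lineAt n m s t b).isSome
  | .der b => match lineAt n m s t b with
    | some L => .const L.derived
    | none => .const false
  | .weak b a => match lineAt n m s t b with
    | some L => L.weak a.1
    | none => .const false
  | .lit b z => match lineAt n m s t b with
    | some L => L.lit z
    | none => .const false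
  | .res b v => match lineAt n m s t b with
    | some L => L.res v
    | none => .const false
  | .lp b c => match lineAt n m s t b, lineAt n m s t c with
    | some L, some K => .const (L.leftFrom m K)
    | _, _ => .const false
  | .rp b c => match lineAt n m s t b, lineAt n m s t c with
    | some L, some K => .const (L.rightFrom s K)
    | _, _ => .const false

end Construction

/-- The clauses expressing `π = P(φ, α, s)`. -/
def pudlakCNF (n m s t : ℕ) : Set (Clause (OutVar n m s t ⊕ SVar n m)) :=
  ⋃ z, (pudlak n m s t z).clauses z

/-- The variables of the formula below: those of `π`, `φ` and `α`, and those of the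
pseudo-negation. -/
abbrev MainVar (n m s t : ℕ) : Type := (OutVar n m s t ⊕ SVar n m) ⊕ OutIdx n m s t

/-- The formula `Sat(φ, α) ∧ pneg Ref_t(Ref_s(φ), π) ∧ π = P(φ, α, s)`. -/
def mainCNF (n m s t : ℕ) : Set (Clause (MainVar n m s t)) :=
  Clause.rename (fun x => .inl (.inr x)) '' satCNF n m ∪
    pneg (refRef n m s t) ∪
    Clause.rename .inl '' pudlakCNF n m s t

/-! ### Formulas and assignments as inputs of the circuit -/

/-- The values of the variables of `Sat(φ, α)` given by a CNF formula `φ` and an assignment `α`. -/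
def describe {n m : ℕ} (φ : Fin m → Clause (Fin n)) (α : Fin n → Bool) : SVar n m → Bool
  | .alpha i => α i
  | .alit A l => decide (l ∈ φ A)
  | .sat A l => decide (l ∈ φ A) && l.eval α

/-- The values of the variables of `Ref_t(Ref_s(φ), π)` for `π = P(φ, α, s)`. -/
def pudlakOutput {n m : ℕ} (s t : ℕ) (φ : Fin m → Clause (Fin n)) (α : Fin n → Bool) :
    OutVar n m s t ⊕ SVar n m → Bool
  | .inl z => (pudlak n m s t z).toCircuit.eval (describe φ α)
  | .inr x => describe φ α x

/-! ### Refutations as sequences of numbers -/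

/-- Codes of literals, given codes of the variables. -/
def Lit.code {V : Type} (e : V → List ℕ) : Lit V → List ℕ
  | .pos v => 1 :: e v
  | .neg v => 2 :: e v

/-- Codes of the variables of `Sat(φ, α)`. -/
def SVar.code {n m : ℕ} : SVar n m → List ℕ
  | .alpha i => [0, i]
  | .alit A l => 1 :: A :: l.code (fun i => [i.val])
  | .sat A l => 2 :: A :: l.code (fun i => [i.val])

/-- Codes of the variables of `Ref_s(ψ)`. -/
def RVar.code {V I : Type} {s : ℕ} (e : V → List ℕ) (f : I → List ℕ) : RVar V I s → List ℕ
  | .en B => [0, B]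
  | .der B => [1, B]
  | .weak B A => 2 :: B :: f A
  | .lit B l => 3 :: B :: l.code e
  | .res B x => 4 :: B :: e x
  | .lp B C => [5, B, C]
  | .rp B C => [6, B, C]

/-- Codes of the labels of clauses of `Ref_s(ψ)`. -/
def RAx.code {V I P : Type} {s : ℕ} (e : V → List ℕ) (f : I → List ℕ) (g : P → List ℕ) :
    RAx V I P s → List ℕ
  | .left B C x l => 0 :: B :: C :: (e x ++ l.code e)
  | .right B C x l => 1 :: B :: C :: (e x ++ l.code e)
  | .weak B A l => 2 :: B :: (f A ++ l.code e)
  | .mustRes B => [3, B]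
  | .mustLeft B => [4, B]
  | .mustRight B => [5, B]
  | .mustWeak B => [6, B]
  | .enLeft B C => [7, B, C]
  | .enRight B C => [8, B, C]
  | .rootEmpty B l => 9 :: B :: l.code e
  | .rootEn B => [10, B]
  | .guard B A p => 11 :: B :: (f A ++ p.code g)

/-- Codes of the variables of the main formula. -/
def mainCode {n m s t : ℕ} : MainVar n m s t → List ℕ :=
  let inVar : InVar n m s → List ℕ := RVar.code (fun i => [i.val]) (fun A => [A.val])
  let inIdx : InIdx n m s → List ℕ :=
    fun a => a.1.code (fun i => [i.val]) (fun A => [A.val]) SVar.code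
  fun v => match v with
    | .inl (.inl z) => 0 :: z.code inVar inIdx
    | .inl (.inr x) => 1 :: x.code
    | .inr c => 2 :: c.1.code inVar inIdx SVar.code

/-- A sequence of clauses, written as lists of literals, as a list of numbers: each clause is
written literal by literal and closed by `0`. -/
def codeClauses {V : Type} (e : V → List ℕ) (Q : List (List (Lit V))) : List ℕ :=
  Q.flatMap (fun C => C.flatMap (Lit.code e) ++ [0])

/-- The size of a sequence of clauses: the number of clauses plus the number of literals. -/
def clausesSize {V : Type} (Q : List (List (Lit V))) : ℕ := (Q.map (fun C => C.length + 1)).sum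

/-! ### Random access machines -/

/-- Programs of random access machines with registers `0, 1, 2, …` holding natural numbers, and
with an output tape. -/
inductive Prog where
  /-- Register `x` gets the value `c`. -/
  | const (x c : ℕ)
  /-- Register `x` gets the sum of registers `y` and `z`. -/
  | add (x y z : ℕ)
  /-- Register `x` gets the truncated difference of registers `y` and `z`. -/
  | sub (x y z : ℕ)
  /-- Register `x` gets the content of the register whose number is in `y`. -/
  | load (x y : ℕ)
  /-- The register whose number is in `x` gets the content of `y`. -/
  | store (x y : ℕ)
  /-- The content of register `x` is appended to the output. -/
  | print (x : ℕ)
  | seq (p q : Prog)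
  /-- Run `p` if register `x` is nonzero, and `q` otherwise. -/
  | ite (x : ℕ) (p q : Prog)
  /-- Run `p` as long as register `x` is nonzero. -/
  | loop (x : ℕ) (p : Prog)

/-- The configuration of a machine: the contents of the registers and the output so far. -/
structure Config where
  mem : ℕ → ℕ
  out : List ℕ

/-- Assignment to a register. -/
def Config.set (σ : Config) (x v : ℕ) : Config := ⟨Function.update σ.mem x v, σ.out⟩

/-- `Run p σ σ' k`: started in `σ`, the program `p` halts in `σ'` after `k` steps. -/
inductive Run : Prog → Config → Config → ℕ → Prop where
  | const (σ : Config) (x c : ℕ) : Run (.const x c) σ (σ.set x c) 1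
  | add (σ : Config) (x y z : ℕ) : Run (.add x y z) σ (σ.set x (σ.mem y + σ.mem z)) 1
  | sub (σ : Config) (x y z : ℕ) : Run (.sub x y z) σ (σ.set x (σ.mem y - σ.mem z)) 1
  | load (σ : Config) (x y : ℕ) : Run (.load x y) σ (σ.set x (σ.mem (σ.mem y))) 1
  | store (σ : Config) (x y : ℕ) : Run (.store x y) σ (σ.set (σ.mem x) (σ.mem y)) 1
  | print (σ : Config) (x : ℕ) : Run (.print x) σ ⟨σ.mem, σ.out ++ [σ.mem x]⟩ 1
  | seq {p q : Prog} {σ σ' σ'' : Config} {k l : ℕ} :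
      Run p σ σ' k → Run q σ' σ'' l → Run (.seq p q) σ σ'' (k + l)
  | ite_true {p q : Prog} {x : ℕ} {σ σ' : Config} {k : ℕ} :
      σ.mem x ≠ 0 → Run p σ σ' k → Run (.ite x p q) σ σ' (k + 1)
  | ite_false {p q : Prog} {x : ℕ} {σ σ' : Config} {k : ℕ} :
      σ.mem x = 0 → Run q σ σ' k → Run (.ite x p q) σ σ' (k + 1)
  | loop_done {p : Prog} {x : ℕ} {σ : Config} : σ.mem x = 0 → Run (.loop x p) σ σ 1
  | loop_step {p : Prog} {x : ℕ} {σ σ' σ'' : Config} {k l : ℕ} :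
      σ.mem x ≠ 0 → Run p σ σ' k → Run (.loop x p) σ' σ'' l → Run (.loop x p) σ σ'' (k + l + 1)

/-- On the inputs `n, m, s, t`, in registers `0, 1, 2, 3`, the program outputs `w` after `k` steps. -/
def Prog.Computes (p : Prog) (n m s t : ℕ) (w : List ℕ) (k : ℕ) : Prop :=
  ∃ σ : Config, Run p ⟨fun x => [n, m, s, t].getD x 0, []⟩ σ k ∧ σ.out = w

/-!
The size `τ` is computed exactly (`two_mul_tau`) from the number of lines for each block
(`length_blockLines`), and both bounds for it follow (`tau_le`, `le_tau`). Every gate is a constant,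
a literal or a conjunction of two literals, hence has depth at most 2 and size at most 5, and the
number of gates is the number of variables of `Ref_t(Ref_s(φ), π)`, which is polynomial
(`exists_size_pudlak_le`).

For the correctness of the construction one checks, for each kind of line, that under any
assignment to the variables of `φ` and `α` the line contains all literals of its premises that are
not resolved (`Line.lit_of_leftFrom`, `Line.lit_of_rightFrom`) and all literals of the axiom it is
a weakening of (`Line.lit_of_weak`), that the literals guarding this axiom are true
(`Line.guard_of_weak`), and that the premises of a line come before it (`lineAt_premises`). Read
off clause by clause, this gives a true literal in every clause of `Ref_t(Ref_s(φ), π)`, whether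
or not `α` satisfies `φ`, with one exception: the clauses saying that a line `l1 B A` is a
weakening of some axiom. Their true literals come from literals of the clause `A` of `φ` that are
true under `α` (`exists_satClause_lit`). With a satisfying `α` all clauses are satisfied
(`sat_refRef`), and exactly the `τ` blocks that hold a line are enabled (`card_lineAt`).

The Resolution refutation follows the same case distinction. With `μ_c` the variable of the
pseudo-negation for the clause `c`, it derives `¬μ_c` for every `c` and resolves these clauses
with `⋁_c μ_c`. For a clause `c` that is not exceptional there are at most three variables of `φ`
and `α` whose values determine a literal of `c` that is true (`exists_true_lit`,
`length_branchVars`). This is clear if `c` has a bounded number of literals whose gates are not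
constant, and for the other clauses, `mustRes` and `mustWeak`, the variable resolved over or the
weakened axiom is determined by at most two values of `α`. Branching over these values gives a
tree-like derivation of `¬μ_c` of constant depth (`derives_branchLines`). For an exceptional
clause, about the clause `A` of `φ`, `¬μ_c ∨ ¬sat^A_ℓ` is derived for each literal `ℓ`, and then
`⋁_ℓ sat^A_ℓ` is used (`derives_satLines`). Together this is `isRefutation_mainRefutation`.

It remains to see that one program prints this refutation in polynomial time. As the time bound is
polynomial in the values of `n`, `m`, `s` and `t`, it suffices to work with functions `ℕ → ℕ`
computable in time polynomial in the value of the argument (`PolyTime`). They are closed under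
composition, pairing, case distinctions and iterations with polynomially bounded values. Encoding
variables, clauses and lines by numbers, one gets a calculus of polynomial-time functions on these
objects (`PolyMap`) and of lists whose length and entries are computable in polynomial time
(`PolyList`), whose rules are instances, so that instance search proves that a composite
expression is of such a form. The list of numbers that codes the refutation is built from such
lists by concatenation (`polyList_mainRefutation`), and a list of this kind is printed entry by
entry by a program running in polynomial time (`PolyList.exists_prog`).
-/

/-! ### Timed execution of random access programs -/

theorem Polynomial.monotone_eval_nat (P : Polynomial ℕ) : Monotone (fun x => P.eval x) := by
  induction P using Polynomial.induction_on' with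
  | add p q hp hq => simpa using hp.add hq
  | monomial n a =>
    intro x y h
    simp only [Polynomial.eval_monomial]
    gcongr

/-- Started in `σ`, the program `c` halts within `T` steps in a configuration satisfying `Q`. -/
def Exec (c : Prog) (σ : Config) (T : ℕ) (Q : Config → Prop) : Prop :=
  ∃ σ' k, Run c σ σ' k ∧ k ≤ T ∧ Q σ'

namespace Exec

theorem mono {c σ T T' Q Q'} (h : Exec c σ T Q) (hT : T ≤ T') (hQ : ∀ σ', Q σ' → Q' σ') :
    Exec c σ T' Q' := by
  obtain ⟨σ', k, h1, h2, h3⟩ := h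
  exact ⟨σ', k, h1, h2.trans hT, hQ _ h3⟩

theorem const {σ : Config} {x c : ℕ} {Q} (h : Q (σ.set x c)) : Exec (.const x c) σ 1 Q :=
  ⟨_, _, .const .., le_rfl, h⟩

theorem add {σ : Config} {x y z : ℕ} {Q} (h : Q (σ.set x (σ.mem y + σ.mem z))) :
    Exec (.add x y z) σ 1 Q :=
  ⟨_, _, .add .., le_rfl, h⟩

theorem sub {σ : Config} {x y z : ℕ} {Q} (h : Q (σ.set x (σ.mem y - σ.mem z))) :
    Exec (.sub x y z) σ 1 Q :=
  ⟨_, _, .sub .., le_rfl, h⟩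

theorem print {σ : Config} {x : ℕ} {Q : Config → Prop} (h : Q ⟨σ.mem, σ.out ++ [σ.mem x]⟩) :
    Exec (.print x) σ 1 Q :=
  ⟨_, _, .print .., le_rfl, h⟩

theorem seq {p q σ T₁ T₂} {Q : Config → Prop} (h : Exec p σ T₁ (fun σ' => Exec q σ' T₂ Q)) :
    Exec (.seq p q) σ (T₁ + T₂) Q := by
  obtain ⟨σ₁, k, h1, h2, σ₂, l, h3, h4, h5⟩ := h
  exact ⟨σ₂, k + l, .seq h1 h3, by omega, h5⟩

theorem ite {p q x} {σ : Config} {T Q} (h1 : σ.mem x ≠ 0 → Exec p σ T Q)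
    (h2 : σ.mem x = 0 → Exec q σ T Q) : Exec (.ite x p q) σ (T + 1) Q := by
  by_cases h : σ.mem x = 0
  · obtain ⟨σ', k, a, b, c⟩ := h2 h
    exact ⟨σ', k + 1, .ite_false h a, by omega, c⟩
  · obtain ⟨σ', k, a, b, c⟩ := h1 h
    exact ⟨σ', k + 1, .ite_true h a, by omega, c⟩

/-- A loop whose invariant `I` counts the remaining iterations. -/
theorem loop {p x T} (I : ℕ → Config → Prop)
    (hs : ∀ k σ, I (k + 1) σ → σ.mem x ≠ 0 ∧ Exec p σ T (I k))
    (h0 : ∀ σ, I 0 σ → σ.mem x = 0) (k : ℕ) (σ : Config) (h : I k σ) :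
    Exec (.loop x p) σ (k * (T + 1) + 1) (I 0) := by
  induction k generalizing σ with
  | zero => exact ⟨σ, 1, .loop_done (h0 σ h), by omega, h⟩
  | succ k ih =>
    obtain ⟨hx, σ₁, a, r1, ha, i1⟩ := hs k σ h
    obtain ⟨σ₂, b, r2, hb, i2⟩ := ih σ₁ i1
    exact ⟨σ₂, a + b + 1, .loop_step hx r1 r2, by
      have : (k + 1) * (T + 1) = k * (T + 1) + (T + 1) := by ring
      omega, i2⟩

end Exec

/-- The two configurations agree on the output and on the registers below `d`. -/
def Config.Agree (d : ℕ) (σ σ' : Config) : Prop :=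
  (∀ r < d, σ'.mem r = σ.mem r) ∧ σ'.out = σ.out

theorem Config.Agree.refl (d : ℕ) (σ : Config) : σ.Agree d σ := ⟨fun _ _ => rfl, rfl⟩

theorem Config.Agree.trans {d e : ℕ} {σ σ' σ'' : Config} (h : σ.Agree d σ') (h' : σ'.Agree e σ'')
    (hd : d ≤ e) : σ.Agree d σ'' :=
  ⟨fun r hr => (h'.1 r (by omega)).trans (h.1 r hr), h'.2.trans h.2⟩

theorem Config.set_agree {d : ℕ} {σ σ' : Config} {x v : ℕ} (h : σ.Agree d σ') (hx : d ≤ x) :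
    σ.Agree d (σ'.set x v) :=
  ⟨fun r hr => by simp [Config.set, Function.update, show r ≠ x by omega, h.1 r hr], h.2⟩

@[simp] theorem Config.set_mem_self (σ : Config) (x v : ℕ) : (σ.set x v).mem x = v := by
  simp [Config.set]

theorem Config.set_mem (σ : Config) (x v y : ℕ) :
    (σ.set x v).mem y = if y = x then v else σ.mem y := by
  simp [Config.set, Function.update_apply]

@[simp] theorem Config.set_out (σ : Config) (x v : ℕ) : (σ.set x v).out = σ.out := rfl

/-- Registers `d + 1` and `d + 2` hold `a` and `b`; `Nat.pair a b` is put into register `d`. The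
loop adds up the square that occurs in it. -/
def pairProg (d : ℕ) : Prog :=
  .seq (.const (d + 3) 0) <| .seq (.sub (d + 4) (d + 2) (d + 1)) <|
  .seq (.ite (d + 4)
    (.seq (.add (d + 5) (d + 2) (d + 3)) (.add (d + 6) (d + 1) (d + 3)))
    (.seq (.add (d + 5) (d + 1) (d + 3)) (.add (d + 6) (d + 1) (d + 2)))) <|
  .seq (.const (d + 7) 1) <| .seq (.add (d + 4) (d + 5) (d + 3)) <|
  .seq (.loop (d + 4) (.seq (.add (d + 6) (d + 6) (d + 5)) (.sub (d + 4) (d + 4) (d + 7)))) <|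
  .add d (d + 6) (d + 3)

theorem pairProg_exec (d : ℕ) (σ : Config) :
    Exec (pairProg d) σ (3 * (σ.mem (d + 1) + σ.mem (d + 2)) + 20) (fun σ' =>
      σ.Agree d σ' ∧ σ'.mem d = Nat.pair (σ.mem (d + 1)) (σ.mem (d + 2))) := by
  set a := σ.mem (d + 1) with ha
  set b := σ.mem (d + 2) with hb
  have key : ∀ v w : ℕ, v ≤ a + b → v * v + w = Nat.pair a b → ∀ σ₁ : Config, σ.Agree d σ₁ →
      σ₁.mem (d + 3) = 0 → σ₁.mem (d + 5) = v → σ₁.mem (d + 6) = w →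
      Exec (.seq (.const (d + 7) 1) <| .seq (.add (d + 4) (d + 5) (d + 3)) <|
        .seq (.loop (d + 4)
          (.seq (.add (d + 6) (d + 6) (d + 5)) (.sub (d + 4) (d + 4) (d + 7)))) <|
        .add d (d + 6) (d + 3)) σ₁ (1 + (1 + ((v * (1 + 1 + 1) + 1) + 1)))
        (fun σ' => σ.Agree d σ' ∧ σ'.mem d = Nat.pair a b) := by
    intro v w _ hvw σ₁ hA h3 h5 h6
    refine .seq (.const (.seq (.add (.seq ?_))))
    refine (Exec.loop (fun k τ => σ.Agree d τ ∧ τ.mem (d + 3) = 0 ∧ τ.mem (d + 5) = v ∧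
      τ.mem (d + 7) = 1 ∧ τ.mem (d + 4) = k ∧ τ.mem (d + 6) + k * v = v * v + w)
      ?_ (fun τ h => h.2.2.2.2.1) v _ ?_).mono le_rfl ?_
    · rintro k τ ⟨i1, i2, i3, i4, i5, i6⟩
      refine ⟨by omega, .seq (.add (.sub ⟨?_, ?_⟩))⟩
      · exact Config.set_agree (Config.set_agree i1 (by omega)) (by omega)
      · simp [Config.set_mem, i2, i3, i4, i5]
        rw [← i6]; ring
    · refine ⟨Config.set_agree (Config.set_agree hA (by omega)) (by omega), ?_⟩
      simp [Config.set_mem, h3, h5, h6]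
      ring
    · rintro τ ⟨i1, i2, i3, i4, i5, i6⟩
      refine .add ⟨Config.set_agree i1 le_rfl, ?_⟩
      simp [i2, ← hvw, ← i6]
  unfold pairProg
  refine (Exec.seq (.const (.seq (.sub (.seq
    (Exec.ite (T := 2) (fun h => ?_) (fun h => ?_)))))) (T₁ := 1)
    (T₂ := 1 + (3 + (1 + (1 + (((a + b) * (1 + 1 + 1) + 1) + 1)))))).mono (by omega) (fun _ h => h)
  · have hlt : a < b := by
      simp [Config.set_mem, ← ha, ← hb] at h; omega
    refine .seq (.add (.add ((key b a (by omega) (by simp [Nat.pair, hlt]) _ ?_ ?_ ?_ ?_).mono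
      (by omega) (fun _ h => h))))
    · refine Config.set_agree (Config.set_agree (Config.set_agree (Config.set_agree
        (Config.Agree.refl d σ) ?_) ?_) ?_) ?_ <;> omega
    all_goals simp [Config.set_mem, ← ha, ← hb]
  · have hlt : ¬ a < b := by
      simp [Config.set_mem, ← ha, ← hb] at h; omega
    refine .seq (.add (.add ((key a (a + b) (by omega) (by simp [Nat.pair, hlt]; ring) _
      ?_ ?_ ?_ ?_).mono (by omega) (fun _ h => h))))
    · refine Config.set_agree (Config.set_agree (Config.set_agree (Config.set_agree
        (Config.Agree.refl d σ) ?_) ?_) ?_) ?_ <;> omega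
    all_goals simp [Config.set_mem, ← ha, ← hb]

/-- Register `d` holds `x`; the square root of `x` is put into register `d + 1`, and the remainder
into register `d + 2`. -/
def sqrtProg (d : ℕ) : Prog :=
  .seq (.const (d + 1) 0) <| .seq (.add (d + 2) d (d + 1)) <|
  .seq (.const (d + 3) 1) <| .seq (.const (d + 4) 0) <| .seq (.add (d + 5) (d + 2) (d + 4)) <|
  .loop (d + 5) <| .seq (.sub (d + 2) (d + 2) (d + 4)) <| .seq (.sub (d + 2) (d + 2) (d + 3)) <|
  .seq (.add (d + 1) (d + 1) (d + 3)) <| .seq (.add (d + 4) (d + 1) (d + 1)) <|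
  .sub (d + 5) (d + 2) (d + 4)

theorem sqrtProg_exec (d : ℕ) (σ : Config) :
    Exec (sqrtProg d) σ (6 * σ.mem d + 6) (fun σ' => σ.Agree d σ' ∧
      σ'.mem (d + 1) = (σ.mem d).sqrt ∧
      σ'.mem (d + 2) = σ.mem d - (σ.mem d).sqrt * (σ.mem d).sqrt) := by
  set x := σ.mem d with hx
  have h1 := Nat.sqrt_le x
  have h2 := Nat.sqrt_le_add x
  have h3 := Nat.sqrt_le_self x
  set q := x.sqrt with hq
  unfold sqrtProg
  refine (Exec.seq (.const (.seq (.add (.seq (.const (.seq (.const (.seq (.add ?_)))))))))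
    (T₁ := 1) (T₂ := 1 + (1 + (1 + (1 + (q * ((1 + (1 + (1 + (1 + 1)))) + 1) + 1)))))).mono
    (by omega) (fun _ h => h)
  refine (Exec.loop (fun k τ => σ.Agree d τ ∧ τ.mem (d + 3) = 1 ∧ τ.mem (d + 1) + k = q ∧
      τ.mem (d + 4) = 2 * τ.mem (d + 1) ∧ τ.mem (d + 2) + τ.mem (d + 1) * τ.mem (d + 1) = x ∧
      τ.mem (d + 5) = τ.mem (d + 2) - τ.mem (d + 4)) ?_ ?_ q _ ?_).mono le_rfl ?_
  · rintro k τ ⟨i1, i2, i3, i4, i5, i6⟩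
    have hle : 2 * τ.mem (d + 1) + 1 ≤ τ.mem (d + 2) := by
      rw [← i3] at h1
      nlinarith
    refine ⟨by omega, .seq (.sub (.seq (.sub (.seq (.add (.seq (.add (.sub ⟨?_, ?_⟩))))))))⟩
    · refine Config.set_agree (Config.set_agree (Config.set_agree (Config.set_agree
        (Config.set_agree i1 ?_) ?_) ?_) ?_) ?_ <;> omega
    · simp [Config.set_mem, i2]
      refine ⟨by omega, by omega, ?_⟩
      rw [← i5, i4]
      have : τ.mem (d + 2) = (τ.mem (d + 2) - 2 * τ.mem (d + 1) - 1) + (2 * τ.mem (d + 1) + 1) := by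
        omega
      generalize τ.mem (d + 2) - 2 * τ.mem (d + 1) - 1 = y at *
      rw [this]; ring
  · rintro τ ⟨i1, i2, i3, i4, i5, i6⟩
    have : τ.mem (d + 1) = q := by omega
    rw [this] at i4 i5
    omega
  · refine ⟨?_, ?_⟩
    · refine Config.set_agree (Config.set_agree (Config.set_agree (Config.set_agree
        (Config.set_agree (Config.Agree.refl d σ) ?_) ?_) ?_) ?_) ?_ <;> omega
    · simp [Config.set_mem, ← hx]
  · rintro τ ⟨i1, i2, i3, i4, i5, i6⟩
    have : τ.mem (d + 1) = q := by omega
    rw [this] at i5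
    exact ⟨i1, this, by omega⟩

/-! ### Functions computable in polynomial time from unary numbers -/

/-- The program `c` replaces the content `x` of register `d` by `f x` within `P x` steps, and
changes neither the lower registers nor the output. -/
def Realizes (c : Prog) (d : ℕ) (f : ℕ → ℕ) (P : Polynomial ℕ) : Prop :=
  ∀ σ : Config, Exec c σ (P.eval (σ.mem d))
    (fun σ' => σ.Agree d σ' ∧ σ'.mem d = f (σ.mem d))

/-- `f` is bounded by a polynomial and computable in a number of steps that is polynomial in the
value of the argument. The program may be placed on the registers from any `d` on. -/
def PolyTime (f : ℕ → ℕ) : Prop :=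
  (∃ P : Polynomial ℕ, ∀ x, f x ≤ P.eval x) ∧
    ∃ P : Polynomial ℕ, ∀ d, ∃ c, Realizes c d f P

namespace PolyTime

theorem eval_le {P : Polynomial ℕ} {x y : ℕ} (h : x ≤ y) : P.eval x ≤ P.eval y :=
  P.monotone_eval_nat h

theorem pair_le (a b : ℕ) : Nat.pair a b ≤ (a + b + 1) ^ 2 := by
  refine (Nat.pair_lt_max_add_one_sq a b).le.trans ?_
  have : max a b ≤ a + b := by omega
  gcongr

theorem id' : PolyTime (fun x => x) :=
  ⟨⟨Polynomial.X, by simp⟩, 1, fun d => ⟨.const (d + 1) 0, fun σ =>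
    (Exec.const ⟨Config.set_agree (Config.Agree.refl ..) (by omega),
      by simp [Config.set_mem]⟩).mono (by simp) (fun _ h => h)⟩⟩

theorem const (k : ℕ) : PolyTime (fun _ => k) :=
  ⟨⟨Polynomial.C k, by simp⟩, 1, fun d => ⟨.const d k, fun σ =>
    (Exec.const ⟨Config.set_agree (Config.Agree.refl ..) le_rfl, by simp⟩).mono (by simp)
      (fun _ h => h)⟩⟩

theorem comp {f g : ℕ → ℕ} (hf : PolyTime f) (hg : PolyTime g) : PolyTime (fun x => f (g x)) := by
  obtain ⟨⟨Bf, hBf⟩, Pf, hPf⟩ := hf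
  obtain ⟨⟨Bg, hBg⟩, Pg, hPg⟩ := hg
  refine ⟨⟨Bf.comp Bg, fun x => ?_⟩, Pg + Pf.comp Bg, fun d => ?_⟩
  · rw [Polynomial.eval_comp]
    exact (hBf _).trans (eval_le (hBg x))
  · obtain ⟨cf, hcf⟩ := hPf d
    obtain ⟨cg, hcg⟩ := hPg d
    refine ⟨.seq cg cf, fun σ => ?_⟩
    rw [Polynomial.eval_add, Polynomial.eval_comp]
    refine .seq ((hcg σ).mono le_rfl fun σ₁ ⟨h1, h2⟩ => (hcf σ₁).mono ?_ fun σ₂ ⟨h3, h4⟩ => ?_)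
    · rw [h2]; exact eval_le (hBg _)
    · exact ⟨h1.trans h3 le_rfl, by rw [h4, h2]⟩

/-- A binary operation on the values of two functions. -/
theorem binary {f g : ℕ → ℕ} {op : ℕ → ℕ → ℕ} (hf : PolyTime f) (hg : PolyTime g)
    (B : Polynomial ℕ) (hB : ∀ a b, op a b ≤ B.eval (a + b))
    (h : ∀ d, ∃ c, ∀ σ : Config, Exec c σ (B.eval (σ.mem (d + 1) + σ.mem (d + 2)))
      (fun σ' => σ.Agree d σ' ∧ σ'.mem d = op (σ.mem (d + 1)) (σ.mem (d + 2)))) :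
    PolyTime (fun x => op (f x) (g x)) := by
  obtain ⟨⟨Bf, hBf⟩, Pf, hPf⟩ := hf
  obtain ⟨⟨Bg, hBg⟩, Pg, hPg⟩ := hg
  have hs : ∀ x, f x + g x ≤ (Bf + Bg).eval x := fun x => by
    rw [Polynomial.eval_add]; exact add_le_add (hBf x) (hBg x)
  refine ⟨⟨B.comp (Bf + Bg), fun x => ?_⟩, 4 + Pf + Pg + B.comp (Bf + Bg), fun d => ?_⟩
  · rw [Polynomial.eval_comp]
    exact (hB _ _).trans (eval_le (hs x))
  · obtain ⟨cf, hcf⟩ := hPf (d + 1)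
    obtain ⟨cg, hcg⟩ := hPg (d + 2)
    obtain ⟨co, hco⟩ := h d
    refine ⟨.seq (.const (d + 2) 0) (.seq (.add (d + 1) d (d + 2)) (.seq cf
      (.seq (.const (d + 3) 0) (.seq (.add (d + 2) d (d + 3)) (.seq cg co))))), fun σ => ?_⟩
    refine (Exec.seq (.const (.seq (.add (.seq ((hcf _).mono le_rfl fun σ₁ ⟨h1, h2⟩ =>
      .seq (.const (.seq (.add (.seq ((hcg _).mono (T' := Pg.eval (σ.mem d)) ?right
        fun σ₂ ⟨h3, h4⟩ =>
        (hco _).mono (T' := B.eval (f (σ.mem d) + g (σ.mem d))) ?op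
          fun σ₃ ⟨h5, h6⟩ => ?post)))))))))) (T₁ := 1)
        (T₂ := 1 + (_ + (1 + (1 + (_ + B.eval (f (σ.mem d) + g (σ.mem d)))))))).mono ?time
        (fun _ h => h)
    case right =>
      have e1 := h1.1 d (by omega)
      simp [Config.set_mem] at e1
      simp [Config.set_mem, e1]
    case op =>
      have e1 := h1.1 d (by omega)
      have e2 := h3.1 (d + 1) (by omega)
      simp [Config.set_mem] at h2 h4 e1 e2
      rw [h4, e2, h2, e1]
    case post =>
      have e1 := h1.1 d (by omega)
      have e2 := h3.1 (d + 1) (by omega)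
      simp [Config.set_mem] at h2 h4 e1 e2
      refine ⟨Config.Agree.trans (e := d) ?_ h5 le_rfl, by rw [h6, h4, e2, h2, e1]⟩
      refine Config.Agree.trans ?_ h3 (show d ≤ d + 2 by omega)
      refine Config.set_agree (Config.set_agree (Config.Agree.trans ?_ h1
        (show d ≤ d + 1 by omega)) ?_) ?_
      · exact Config.set_agree (Config.set_agree (Config.Agree.refl ..) (by omega)) (by omega)
      all_goals omega
    case time =>
      simp only [Config.set_mem_self, Polynomial.eval_add, Polynomial.eval_comp]
      have h := eval_le (P := B) (hs (σ.mem d))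
      rw [Polynomial.eval_add] at h
      have : (4 : Polynomial ℕ).eval (σ.mem d) = 4 := by simp
      simp [Config.set_mem]
      omega

theorem add {f g : ℕ → ℕ} (hf : PolyTime f) (hg : PolyTime g) :
    PolyTime (fun x => f x + g x) :=
  binary (op := fun a b => a + b) hf hg (Polynomial.X + 1) (by simp) fun d =>
    ⟨.add d (d + 1) (d + 2), fun σ => (Exec.add ⟨Config.set_agree (Config.Agree.refl ..) le_rfl,
      by simp⟩).mono (by simp) (fun _ h => h)⟩

theorem sub {f g : ℕ → ℕ} (hf : PolyTime f) (hg : PolyTime g) :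
    PolyTime (fun x => f x - g x) :=
  binary (op := fun a b => a - b) hf hg (Polynomial.X + 1) (by intros; simp; omega) fun d =>
    ⟨.sub d (d + 1) (d + 2), fun σ => (Exec.sub ⟨Config.set_agree (Config.Agree.refl ..) le_rfl,
      by simp⟩).mono (by simp) (fun _ h => h)⟩

theorem pair {f g : ℕ → ℕ} (hf : PolyTime f) (hg : PolyTime g) :
    PolyTime (fun x => Nat.pair (f x) (g x)) :=
  binary hf hg ((Polynomial.X + 1) ^ 2 + 3 * Polynomial.X + 20)
    (fun a b => (pair_le a b).trans (by simp; omega)) fun d =>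
    ⟨pairProg d, fun σ => (pairProg_exec d σ).mono (by simp) (fun _ h => h)⟩

theorem left : PolyTime (fun x => x.unpair.1) := by
  refine ⟨⟨Polynomial.X, fun x => by simpa using Nat.unpair_left_le x⟩,
    6 * Polynomial.X + 20, fun d => ⟨.seq (sqrtProg d) (.seq (.const (d + 4) 0)
      (.seq (.sub (d + 3) (d + 1) (d + 2)) (.ite (d + 3) (.add d (d + 2) (d + 4))
        (.add d (d + 1) (d + 4))))), fun σ => ?_⟩⟩
  refine (Exec.seq ((sqrtProg_exec d σ).mono le_rfl fun τ ⟨h1, h2, h3⟩ =>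
    .seq (.const (.seq (.sub (.ite (T := 1) (fun h => .add ⟨?_, ?_⟩)
      (fun h => .add ⟨?_, ?_⟩))))))).mono (by simp) (fun _ h => h)
  all_goals first
    | exact Config.set_agree (Config.set_agree (Config.set_agree h1 (by omega)) (by omega)) le_rfl
    | skip
  all_goals
    simp [Config.set_mem, h2, h3] at h ⊢
    simp only [Nat.unpair]
    split_ifs <;> simp <;> omega

theorem right : PolyTime (fun x => x.unpair.2) := by
  refine ⟨⟨Polynomial.X, fun x => by simpa using Nat.unpair_right_le x⟩,
    6 * Polynomial.X + 20, fun d => ⟨.seq (sqrtProg d) (.seq (.const (d + 4) 0)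
      (.seq (.sub (d + 3) (d + 1) (d + 2)) (.ite (d + 3) (.add d (d + 1) (d + 4))
        (.sub d (d + 2) (d + 1))))), fun σ => ?_⟩⟩
  refine (Exec.seq ((sqrtProg_exec d σ).mono le_rfl fun τ ⟨h1, h2, h3⟩ =>
    .seq (.const (.seq (.sub (.ite (T := 1) (fun h => .add ⟨?_, ?_⟩)
      (fun h => .sub ⟨?_, ?_⟩))))))).mono (by simp) (fun _ h => h)
  all_goals first
    | exact Config.set_agree (Config.set_agree (Config.set_agree h1 (by omega)) (by omega)) le_rfl
    | skip
  all_goals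
    simp [Config.set_mem, h2, h3] at h ⊢
    simp only [Nat.unpair]
    split_ifs <;> simp <;> omega

/-- Case distinction by whether a function vanishes. -/
theorem ite {c f g : ℕ → ℕ} (hc : PolyTime c) (hf : PolyTime f) (hg : PolyTime g) :
    PolyTime (fun x => if c x ≠ 0 then f x else g x) := by
  obtain ⟨_, Pc, hPc⟩ := hc
  obtain ⟨⟨Bf, hBf⟩, Pf, hPf⟩ := hf
  obtain ⟨⟨Bg, hBg⟩, Pg, hPg⟩ := hg
  refine ⟨⟨Bf + Bg, fun x => ?_⟩, 3 + Pc + (Pf + Pg), fun d => ?_⟩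
  · have := hBf x
    have := hBg x
    simp only [Polynomial.eval_add]
    split_ifs <;> omega
  · obtain ⟨cc, hcc⟩ := hPc (d + 1)
    obtain ⟨cf, hcf⟩ := hPf d
    obtain ⟨cg, hcg⟩ := hPg d
    refine ⟨.seq (.const (d + 2) 0) (.seq (.add (d + 1) d (d + 2)) (.seq cc (.ite (d + 1) cf cg))),
      fun σ => ?_⟩
    refine (Exec.seq (.const (.seq (.add (.seq ((hcc _).mono le_rfl fun τ ⟨h1, h2⟩ =>
      .ite (T := (Pf + Pg).eval (σ.mem d)) (fun h => (hcf τ).mono ?_ ?_)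
        (fun h => (hcg τ).mono ?_ ?_))))))).mono (T' := (3 + Pc + (Pf + Pg)).eval (σ.mem d))
        ?_ (fun _ h => h)
    · have : (3 : Polynomial ℕ).eval (σ.mem d) = 3 := by simp
      simp [Config.set_mem]
      omega
    all_goals
      have e1 := h1.1 d (by omega)
      simp [Config.set_mem] at h2 e1
      rw [h2] at h
    · rw [e1, Polynomial.eval_add]; omega
    · rintro σ' ⟨h3, h4⟩
      refine ⟨Config.Agree.trans ?_ h3 le_rfl, by rw [h4, e1]; exact (if_pos h).symm⟩
      refine Config.Agree.trans ?_ h1 (show d ≤ d + 1 by omega)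
      exact Config.set_agree (Config.set_agree (Config.Agree.refl ..) (by omega)) (by omega)
    · rw [e1, Polynomial.eval_add]; omega
    · rintro σ' ⟨h3, h4⟩
      refine ⟨Config.Agree.trans ?_ h3 le_rfl,
        by rw [h4, e1]; exact (if_neg (by simpa using h)).symm⟩
      refine Config.Agree.trans ?_ h1 (show d ≤ d + 1 by omega)
      exact Config.set_agree (Config.set_agree (Config.Agree.refl ..) (by omega)) (by omega)

/-- Iteration along a counter, with intermediate values that are polynomially bounded. The step
function gets the argument, the index and the current value. -/
theorem iterate {cnt ini stp : ℕ → ℕ} (hc : PolyTime cnt) (hi : PolyTime ini) (hs : PolyTime stp)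
    (F : ℕ → ℕ → ℕ) (F0 : ∀ x, F x 0 = ini x)
    (FS : ∀ x i, i < cnt x → F x (i + 1) = stp (Nat.pair x (Nat.pair i (F x i))))
    (hB : ∃ B : Polynomial ℕ, ∀ x i, i ≤ cnt x → F x i ≤ B.eval x) :
    PolyTime (fun x => F x (cnt x)) := by
  obtain ⟨B, hB⟩ := hB
  obtain ⟨⟨Bc, hBc⟩, Pc, hPc⟩ := hc
  obtain ⟨_, Pi, hPi⟩ := hi
  obtain ⟨_, Ps, hPs⟩ := hs
  -- bounds for the packed index and value, and for the argument of the step function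
  set S : Polynomial ℕ := (Bc + B + 1) ^ 2 with hS
  set S' : Polynomial ℕ := (Polynomial.X + S + 1) ^ 2 with hS'
  set T : Polynomial ℕ := (3 * (Bc + B) + 20) + ((3 * (Polynomial.X + S) + 20) + Ps.comp S') + 11
    with hT
  refine ⟨⟨B, fun x => hB x _ le_rfl⟩, 20 + Pc + Pi + Bc * (T + 1), fun d => ?_⟩
  obtain ⟨cc, hcc⟩ := hPc (d + 1)
  obtain ⟨ci, hci⟩ := hPi (d + 2)
  obtain ⟨cs, hcs⟩ := hPs (d + 5)
  -- registers: `d` argument, `d+1` remaining steps, `d+2` value, `d+3` index, `d+4` one,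
  -- `d+5` argument of the step function, `d+6`, `d+7`, `d+8` operands of the pairings
  refine ⟨.seq (.const (d + 2) 0) <| .seq (.add (d + 1) d (d + 2)) <| .seq cc <|
    .seq (.const (d + 3) 0) <| .seq (.add (d + 2) d (d + 3)) <| .seq ci <|
    .seq (.const (d + 3) 0) <| .seq (.const (d + 4) 1) <|
    .seq (.loop (d + 1) (.seq (.const (d + 6) 0) <| .seq (.add (d + 8) (d + 3) (d + 6)) <|
      .seq (.add (d + 9) (d + 2) (d + 6)) <| .seq (pairProg (d + 7)) <|
      .seq (.const (d + 8) 0) <| .seq (.add (d + 6) d (d + 8)) <|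
      .seq (pairProg (d + 5)) <| .seq cs <| .seq (.const (d + 6) 0) <|
      .seq (.add (d + 2) (d + 5) (d + 6)) <| .seq (.add (d + 3) (d + 3) (d + 4)) <|
      .sub (d + 1) (d + 1) (d + 4))) <|
    .seq (.const (d + 3) 0) <| .add d (d + 2) (d + 3), fun σ => ?_⟩
  set x := σ.mem d with hx
  have hTx : T.eval x = (3 * (Bc.eval x + B.eval x) + 20) + ((3 * (x + S.eval x) + 20) +
      Ps.eval (S'.eval x)) + 11 := by
    simp [hT, Polynomial.eval_comp]
  refine (Exec.seq (.const (.seq (.add (.seq ((hcc _).mono le_rfl fun σ₁ ⟨h1, h2⟩ =>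
    .seq (.const (.seq (.add (.seq ((hci _).mono (T' := Pi.eval x) ?init fun σ₂ ⟨h3, h4⟩ =>
    .seq (.const (.seq (.const (.seq ?main))))))))))))))
    (T₁ := 1) (T₂ := 1 + (_ + (1 + (1 + (_ + (1 + (1 +
      ((cnt x * (T.eval x + 1) + 1) + (1 + 1)))))))))).mono ?time (fun _ h => h)
  case init =>
    have e1 := h1.1 d (by omega)
    simp [Config.set_mem, ← hx] at e1
    simp [Config.set_mem, e1]
  case time =>
    have hb := hBc x
    have : cnt x * (T.eval x + 1) ≤ Bc.eval x * (T.eval x + 1) := by gcongr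
    simp [Config.set_mem, ← hx]
    omega
  have e1 := h1.1 d (by omega)
  have e2 := h3.1 d (by omega)
  have e3 := h3.1 (d + 1) (by omega)
  simp [Config.set_mem, ← hx] at e1 e2 e3 h2 h4
  rw [e1] at e2 h4
  refine (Exec.loop (fun k τ => σ.Agree d τ ∧ τ.mem d = x ∧ τ.mem (d + 4) = 1 ∧
    τ.mem (d + 1) = k ∧ τ.mem (d + 3) + k = cnt x ∧ τ.mem (d + 2) = F x (τ.mem (d + 3)))
    ?_ (fun τ h => h.2.2.2.1) (cnt x) _ ?_).mono le_rfl ?_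
  · rintro k τ ⟨i1, i2, i3, i4, i5, i6⟩
    refine ⟨by omega, ?_⟩
    set i := τ.mem (d + 3) with hi
    have hb1 : i ≤ Bc.eval x := (by omega : i ≤ cnt x).trans (hBc x)
    have hb2 : F x i ≤ B.eval x := hB x i (by omega)
    have hp : Nat.pair i (F x i) ≤ S.eval x := by
      refine (pair_le _ _).trans ?_
      simp only [hS, Polynomial.eval_pow, Polynomial.eval_add, Polynomial.eval_one]
      gcongr
    have hp' : Nat.pair x (Nat.pair i (F x i)) ≤ S'.eval x := by
      refine (pair_le _ _).trans ?_
      simp only [hS', Polynomial.eval_pow, Polynomial.eval_add, Polynomial.eval_one,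
        Polynomial.eval_X]
      gcongr
    refine (Exec.seq (.const (.seq (.add (.seq (.add (.seq
      ((pairProg_exec (d + 7) _).mono (T' := 3 * (i + F x i) + 20) ?pair1 fun τ₁ ⟨j1, j2⟩ =>
      .seq (.const (.seq (.add (.seq ((pairProg_exec (d + 5) _).mono
        (T' := 3 * (x + Nat.pair i (F x i)) + 20) ?pair2 fun τ₂ ⟨j3, j4⟩ =>
      .seq ((hcs _).mono (T' := Ps.eval (Nat.pair x (Nat.pair i (F x i)))) ?step fun τ₃ ⟨j5, j6⟩ =>
      .seq (.const (.seq (.add (.seq (.add (.sub ?post)))))))))))))))))))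
      (T₁ := 1) (T₂ := 1 + (1 + ((3 * (i + F x i) + 20) + (1 + (1 +
        ((3 * (x + Nat.pair i (F x i)) + 20) +
          (Ps.eval (Nat.pair x (Nat.pair i (F x i))) + (1 + (1 + (1 + 1))))))))))).mono
        ?time (fun _ h => h)
    case pair1 => simp [Config.set_mem, ← hi, i6]
    case pair2 =>
      have k1 := j1.1 d (by omega)
      simp [Config.set_mem, ← hi, i6, i2] at k1 j2
      simp [Config.set_mem, k1, j2]
    case step =>
      have k1 := j1.1 d (by omega)
      simp [Config.set_mem, ← hi, i6, i2] at k1 j2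
      simp [Config.set_mem, k1, j2] at j4
      rw [j4]
    case post =>
      have a0 := j1.1 d (by omega)
      have a1 := j1.1 (d + 1) (by omega)
      have a3 := j1.1 (d + 3) (by omega)
      have a4 := j1.1 (d + 4) (by omega)
      simp [Config.set_mem, ← hi, i6, i2, i3, i4] at a0 a1 a3 a4 j2
      have b0 := j3.1 d (by omega)
      have b1 := j3.1 (d + 1) (by omega)
      have b3 := j3.1 (d + 3) (by omega)
      have b4 := j3.1 (d + 4) (by omega)
      simp [Config.set_mem, a0, a1, a3, a4, j2] at b0 b1 b3 b4 j4
      have c0 := j5.1 d (by omega)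
      have c1 := j5.1 (d + 1) (by omega)
      have c3 := j5.1 (d + 3) (by omega)
      have c4 := j5.1 (d + 4) (by omega)
      rw [j4] at j6
      refine ⟨?_, ?_⟩
      · refine Config.set_agree (Config.set_agree (Config.set_agree (Config.set_agree
          (Config.Agree.trans ?_ j5 (show d ≤ d + 5 by omega)) ?_) ?_) ?_) ?_ <;> try omega
        refine Config.Agree.trans ?_ j3 (show d ≤ d + 5 by omega)
        refine Config.set_agree (Config.set_agree (Config.Agree.trans ?_ j1
          (show d ≤ d + 7 by omega)) ?_) ?_ <;> try omega
        refine Config.set_agree (Config.set_agree (Config.set_agree i1 ?_) ?_) ?_ <;> omega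
      · simp [Config.set_mem, c0, c1, c3, c4, b0, b1, b3, b4, j6]
        exact ⟨by omega, (FS x i (by omega)).symm⟩
    case time =>
      have q1 := eval_le (P := Ps) hp'
      rw [hTx]
      omega
  · refine ⟨?_, ?_⟩
    · refine Config.set_agree (Config.set_agree (Config.Agree.trans ?_ h3
        (show d ≤ d + 2 by omega)) ?_) ?_ <;> try omega
      refine Config.set_agree (Config.set_agree (Config.Agree.trans ?_ h1
        (show d ≤ d + 1 by omega)) ?_) ?_ <;> try omega
      exact Config.set_agree (Config.set_agree (Config.Agree.refl ..) (by omega)) (by omega)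
    · simp [Config.set_mem, e2, e3, h2, h4, F0]
  · rintro τ ⟨i1, i2, i3, i4, i5, i6⟩
    refine .seq (.const (.add ⟨Config.set_agree (Config.set_agree i1 (by omega)) le_rfl, ?_⟩))
    simp [Config.set_mem, i6]
    congr 1

theorem mul {f g : ℕ → ℕ} (hf : PolyTime f) (hg : PolyTime g) :
    PolyTime (fun x => f x * g x) := by
  have h := iterate (cnt := f) (ini := fun _ => 0)
    (stp := fun y => y.unpair.2.unpair.2 + g y.unpair.1) hf (const 0)
    (add (right.comp right) (hg.comp left)) (fun x i => i * g x) (by simp)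
    (by intro x i _; simp; ring) ?_
  · exact h
  · obtain ⟨⟨Bf, hBf⟩, _⟩ := hf
    obtain ⟨⟨Bg, hBg⟩, _⟩ := hg
    refine ⟨Bf * Bg, fun x i hi => ?_⟩
    rw [Polynomial.eval_mul]
    exact Nat.mul_le_mul (hi.trans (hBf x)) (hBg x)

/-- Sums with polynomially many summands. -/
theorem sum {cnt f : ℕ → ℕ} (hc : PolyTime cnt) (hf : PolyTime f) :
    PolyTime (fun x => ∑ i ∈ Finset.range (cnt x), f (Nat.pair x i)) := by
  have h := iterate (cnt := cnt) (ini := fun _ => 0)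
    (stp := fun y => y.unpair.2.unpair.2 + f (Nat.pair y.unpair.1 y.unpair.2.unpair.1)) hc
    (const 0) (add (right.comp right) (hf.comp (pair left (left.comp right))))
    (fun x i => ∑ j ∈ Finset.range i, f (Nat.pair x j)) (by simp)
    (by intro x i _; simp [Finset.sum_range_succ]) ?_
  · exact h
  · obtain ⟨⟨Bc, hBc⟩, _⟩ := hc
    obtain ⟨⟨Bf, hBf⟩, _⟩ := hf
    refine ⟨Bc * Bf.comp ((Polynomial.X + Bc + 1) ^ 2), fun x i hi => ?_⟩
    have : ∀ j ∈ Finset.range i,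
        f (Nat.pair x j) ≤ (Bf.comp ((Polynomial.X + Bc + 1) ^ 2)).eval x := by
      intro j hj
      rw [Polynomial.eval_comp]
      refine (hBf _).trans (eval_le ((pair_le _ _).trans ?_))
      have : j ≤ Bc.eval x := by
        have := hBc x
        have := Finset.mem_range.1 hj
        omega
      simp only [Polynomial.eval_pow, Polynomial.eval_add, Polynomial.eval_X, Polynomial.eval_one]
      gcongr
    refine (Finset.sum_le_card_nsmul _ _ _ this).trans ?_
    rw [Finset.card_range, smul_eq_mul, Polynomial.eval_mul]
    exact Nat.mul_le_mul_right _ (hi.trans (hBc x))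

end PolyTime

/-! ### Polynomial-time functions between encoded types -/

/-- An injective encoding by natural numbers. Numbers are encoded by themselves, pairs by
`Nat.pair`, and the other objects by pairs of the number of a constructor and its arguments, so
that the codes of the objects considered are bounded by a polynomial in their parameters. The
encodings need not be surjective, and functions are specified on codes only. -/
class Enc (α : Type) where
  enc : α → ℕ
  inj : Function.Injective enc

open Enc (enc)

instance : Enc ℕ := ⟨fun x => x, fun _ _ h => h⟩

instance {n : ℕ} : Enc (Fin n) := ⟨fun x => x.val, Fin.val_injective⟩

instance {α β : Type} [Enc α] [Enc β] : Enc (α × β) :=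
  ⟨fun x => Nat.pair (enc x.1) (enc x.2), fun ⟨a, b⟩ ⟨c, d⟩ h => by
    simp only [Nat.pair_eq_pair] at h
    rw [Enc.inj h.1, Enc.inj h.2]⟩

instance {α : Type} {β : α → Type} [Enc α] [∀ a, Enc (β a)] : Enc (Σ a, β a) :=
  ⟨fun x => Nat.pair (enc x.1) (enc x.2), fun ⟨a, b⟩ ⟨c, d⟩ h => by
    simp only [Nat.pair_eq_pair] at h
    obtain rfl := Enc.inj h.1
    rw [Enc.inj h.2]⟩

instance {α β : Type} [Enc α] [Enc β] : Enc (α ⊕ β) :=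
  ⟨fun x => match x with
    | .inl a => Nat.pair 0 (enc a)
    | .inr b => Nat.pair 1 (enc b), fun x y h => by
    rcases x with x | x <;> rcases y with y | y <;> simp [Nat.pair_eq_pair] at h <;>
      rw [Enc.inj h]⟩

instance {α : Type} [Enc α] : Enc (Option α) :=
  ⟨fun x => match x with
    | none => Nat.pair 0 0
    | some b => Nat.pair 1 (enc b), fun x y h => by
    rcases x with _ | x <;> rcases y with _ | y <;> simp [Nat.pair_eq_pair] at h <;>
      simp [Enc.inj.eq_iff] at h ⊢; exact h⟩

instance {α : Type} {p : α → Prop} [Enc α] : Enc {a // p a} :=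
  ⟨fun x => enc x.1, fun _ _ h => Subtype.ext (Enc.inj h)⟩

instance : Enc Unit := ⟨fun _ => 0, fun _ _ _ => rfl⟩

instance : Enc Bool := ⟨fun b => b.toNat, by decide⟩

/-- The function `f` on encoded objects is given by a function of codes that is computable in
polynomial time. -/
class PolyMap {α : Type} {β : α → Type} [Enc α] (f : ∀ a, β a) [∀ a, Enc (β a)] : Prop where
  out : ∃ g, PolyTime g ∧ ∀ a, g (enc a) = enc (f a)

open Classical in
/-- The predicate `p` on encoded objects is decidable in polynomial time. -/
class PolyPred {α : Type} [Enc α] (p : α → Prop) : Prop where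
  out : PolyMap (fun a => if p a then 1 else 0)

section PolyMap

variable {α : Type} [Enc α] {β : α → Type} [∀ a, Enc (β a)]

theorem PolyMap.comp {γ : Type} [Enc γ] {δ : γ → Type} [∀ c, Enc (δ c)] {f : ∀ c, δ c}
    (hf : PolyMap f) (r : α → γ) (hr : PolyMap r) : PolyMap (fun a => f (r a)) := by
  obtain ⟨F, hF, eF⟩ := hf.out
  obtain ⟨G, hG, eG⟩ := hr.out
  exact ⟨_, hF.comp hG, fun a => by rw [eG, eF]⟩

/-- Only the codes of the values matter. -/
theorem PolyMap.of_enc {f : ∀ a, β a} {β' : α → Type} [∀ a, Enc (β' a)] {f' : ∀ a, β' a}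
    (hf : PolyMap f) (h : ∀ a, enc (f' a) = enc (f a)) : PolyMap f' := by
  obtain ⟨F, hF, eF⟩ := hf.out
  exact ⟨F, hF, fun a => by rw [eF, h]⟩

instance PolyMap.enc {f : ∀ a, β a} [hf : PolyMap f] : PolyMap (fun a => enc (f a)) :=
  hf.of_enc fun _ => rfl

/-- Pairs in a dependent sum have the same codes as pairs in a product. -/
theorem PolyMap.sigma {γ : Type} [Enc γ] {δ : γ → Type} [∀ c, Enc (δ c)] {r : α → Σ c, δ c}
    (h : PolyMap (fun a => ((r a).1, (r a).2))) : PolyMap r :=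
  h.of_enc fun _ => rfl

instance PolyMap.prodMk {γ : α → Type} [∀ a, Enc (γ a)] {f : ∀ a, β a} {g : ∀ a, γ a}
    [hf : PolyMap f] [hg : PolyMap g] : PolyMap (fun a => (f a, g a)) := by
  obtain ⟨F, hF, eF⟩ := hf.out
  obtain ⟨G, hG, eG⟩ := hg.out
  exact ⟨_, hF.pair hG, fun a => by rw [eF, eG]; rfl⟩

instance PolyMap.id' : PolyMap (fun a : α => a) := ⟨_, PolyTime.id', fun _ => rfl⟩

instance PolyMap.const {γ : Type} [Enc γ] (c : γ) : PolyMap (fun _ : α => c) :=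
  ⟨_, PolyTime.const _, fun _ => rfl⟩

instance PolyMap.fst {γ : α → Type} [∀ a, Enc (γ a)] {f : ∀ a, β a × γ a} [hf : PolyMap f] :
    PolyMap (fun a => (f a).1) := by
  obtain ⟨F, hF, eF⟩ := hf.out
  exact ⟨_, PolyTime.left.comp hF, fun a => by rw [eF]; simp [Enc.enc]⟩

instance PolyMap.snd {γ : α → Type} [∀ a, Enc (γ a)] {f : ∀ a, β a × γ a} [hf : PolyMap f] :
    PolyMap (fun a => (f a).2) := by
  obtain ⟨F, hF, eF⟩ := hf.out
  exact ⟨_, PolyTime.right.comp hF, fun a => by rw [eF]; simp [Enc.enc]⟩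

instance PolyMap.sigmaFst {γ : ∀ a, β a → Type} [∀ a b, Enc (γ a b)] {f : ∀ a, Σ b, γ a b}
    [hf : PolyMap f] : PolyMap (fun a => (f a).1) := by
  obtain ⟨F, hF, eF⟩ := hf.out
  exact ⟨_, PolyTime.left.comp hF, fun a => by rw [eF]; simp [Enc.enc]⟩

/-- Two families of encodings agree. The unifier cannot find the family `γ a b` of encodings
from its values at `b = (f a).1`; with this class it only has to check the equation. -/
class SameEnc {α : Type} {β : α → Type} (i j : ∀ a, Enc (β a)) : Prop where
  eq : i = j

instance SameEnc.refl {α : Type} {β : α → Type} (i : ∀ a, Enc (β a)) : SameEnc i i := ⟨rfl⟩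

set_option synthInstance.checkSynthOrder false in
instance PolyMap.sigmaSnd {γ : ∀ a, β a → Type} {f : ∀ a, Σ b, γ a b}
    {iδ : ∀ a, Enc (γ a (f a).1)} [iγ : ∀ a b, Enc (γ a b)]
    [hi : SameEnc iδ (fun a => iγ a (f a).1)] [hf : PolyMap f] :
    @PolyMap α (fun a => γ a (f a).1) _ (fun a => (f a).2) iδ := by
  obtain rfl := hi.eq
  obtain ⟨F, hF, eF⟩ := hf.out
  exact ⟨_, PolyTime.right.comp hF, fun a => by rw [eF]; simp [Enc.enc]⟩

instance PolyMap.finVal {n : α → ℕ} {f : ∀ a, Fin (n a)} [hf : PolyMap f] :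
    PolyMap (fun a => (f a).val) := hf.of_enc fun _ => rfl

instance PolyMap.finMk {n : α → ℕ} {f : α → ℕ} {h : ∀ a, f a < n a} [hf : PolyMap f] :
    PolyMap (fun a => (⟨f a, h a⟩ : Fin (n a))) := hf.of_enc fun _ => rfl

instance PolyMap.subVal {p : ∀ a, β a → Prop} {f : ∀ a, {b : β a // p a b}} [hf : PolyMap f] :
    PolyMap (fun a => (f a).val) := hf.of_enc fun _ => rfl

instance PolyMap.subMk {p : ∀ a, β a → Prop} {f : ∀ a, β a} {h : ∀ a, p a (f a)}
    [hf : PolyMap f] : PolyMap (fun a => (⟨f a, h a⟩ : {b : β a // p a b})) :=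
  hf.of_enc fun _ => rfl

instance PolyMap.add {f g : α → ℕ} [hf : PolyMap f] [hg : PolyMap g] :
    PolyMap (fun a => f a + g a) := by
  obtain ⟨F, hF, eF⟩ := hf.out
  obtain ⟨G, hG, eG⟩ := hg.out
  exact ⟨_, hF.add hG, fun a => by rw [eF, eG]; rfl⟩

instance PolyMap.sub {f g : α → ℕ} [hf : PolyMap f] [hg : PolyMap g] :
    PolyMap (fun a => f a - g a) := by
  obtain ⟨F, hF, eF⟩ := hf.out
  obtain ⟨G, hG, eG⟩ := hg.out
  exact ⟨_, hF.sub hG, fun a => by rw [eF, eG]; rfl⟩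

instance PolyMap.mul {f g : α → ℕ} [hf : PolyMap f] [hg : PolyMap g] :
    PolyMap (fun a => f a * g a) := by
  obtain ⟨F, hF, eF⟩ := hf.out
  obtain ⟨G, hG, eG⟩ := hg.out
  exact ⟨_, hF.mul hG, fun a => by rw [eF, eG]; rfl⟩

theorem PolyMap.sum {f : α × ℕ → ℕ} {c : α → ℕ} (hf : PolyMap f) (hc : PolyMap c) :
    PolyMap (fun a => ∑ i ∈ Finset.range (c a), f (a, i)) := by
  obtain ⟨F, hF, eF⟩ := hf.out
  obtain ⟨G, hG, eG⟩ := hc.out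
  refine ⟨_, hG.sum hF, fun a => ?_⟩
  rw [eG]
  exact Finset.sum_congr rfl fun i _ => eF (a, i)

instance PolyMap.someMk {f : ∀ a, β a} [hf : PolyMap f] : PolyMap (fun a => some (f a)) := by
  obtain ⟨F, hF, eF⟩ := hf.out
  exact ⟨_, (PolyTime.const 1).pair hF, fun a => by rw [eF]; rfl⟩

instance PolyMap.noneMk : PolyMap (fun a => (none : Option (β a))) :=
  ⟨_, PolyTime.const _, fun _ => rfl⟩

instance PolyMap.inlMk {γ : α → Type} [∀ a, Enc (γ a)] {f : ∀ a, β a} [hf : PolyMap f] :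
    PolyMap (fun a => (Sum.inl (f a) : β a ⊕ γ a)) := by
  obtain ⟨F, hF, eF⟩ := hf.out
  exact ⟨_, (PolyTime.const 0).pair hF, fun a => by rw [eF]; rfl⟩

instance PolyMap.inrMk {γ : α → Type} [∀ a, Enc (γ a)] {f : ∀ a, β a} [hf : PolyMap f] :
    PolyMap (fun a => (Sum.inr (f a) : γ a ⊕ β a)) := by
  obtain ⟨F, hF, eF⟩ := hf.out
  exact ⟨_, (PolyTime.const 1).pair hF, fun a => by rw [eF]; rfl⟩

theorem PolyPred.of_ne_zero {p : α → Prop} {f : α → ℕ} (hf : PolyMap f)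
    (h : ∀ a, p a ↔ f a ≠ 0) : PolyPred p := by
  obtain ⟨F, hF, eF⟩ := hf.out
  refine ⟨⟨_, hF.ite (PolyTime.const 1) (PolyTime.const 0), fun a => ?_⟩⟩
  simp only [h a, eF]
  rfl

theorem PolyPred.of_iff {p q : α → Prop} (hp : PolyPred p) (h : ∀ a, q a ↔ p a) : PolyPred q := by
  rw [show q = p from funext fun a => propext (h a)]
  exact hp

theorem PolyPred.comp {γ : Type} [Enc γ] {p : γ → Prop} (hp : PolyPred p) (r : α → γ)
    (hr : PolyMap r) : PolyPred (fun a => p (r a)) :=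
  ⟨hp.out.comp r hr⟩

instance PolyMap.ite {p : α → Prop} {h : ∀ a, Decidable (p a)} {f g : ∀ a, β a}
    [hp : PolyPred p] [hf : PolyMap f] [hg : PolyMap g] :
    PolyMap (fun a => if p a then f a else g a) := by
  obtain ⟨P, hP, eP⟩ := hp.out.out
  obtain ⟨F, hF, eF⟩ := hf.out
  obtain ⟨G, hG, eG⟩ := hg.out
  refine ⟨_, hP.ite hF hG, fun a => ?_⟩
  rw [eP, eF, eG]
  by_cases h : p a <;> simp [h, Enc.enc]

instance PolyPred.and {p q : α → Prop} [hp : PolyPred p] [hq : PolyPred q] :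
    PolyPred (fun a => p a ∧ q a) := by
  classical
  have := hp.out
  have := hq.out
  exact .of_ne_zero (f := fun a => (if p a then 1 else 0) * (if q a then 1 else 0)) inferInstance
    (by simp [and_comm])

instance PolyPred.or {p q : α → Prop} [hp : PolyPred p] [hq : PolyPred q] :
    PolyPred (fun a => p a ∨ q a) := by
  classical
  have := hp.out
  have := hq.out
  exact .of_ne_zero (f := fun a => (if p a then 1 else 0) + (if q a then 1 else 0)) inferInstance
    (by intro a; by_cases p a <;> by_cases q a <;> simp [*])

instance PolyPred.not {p : α → Prop} [hp : PolyPred p] : PolyPred (fun a => ¬ p a) := by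
  classical
  have := hp.out
  have h : PolyMap (fun a => 1 - (if p a then 1 else 0)) := inferInstance
  exact .of_ne_zero h (by intro a; by_cases p a <;> simp [*])

instance PolyPred.le {f g : α → ℕ} [hf : PolyMap f] [hg : PolyMap g] :
    PolyPred (fun a => f a ≤ g a) :=
  have h : PolyMap (fun a => g a + 1 - f a) := inferInstance
  .of_ne_zero h (by intro a; omega)

instance PolyPred.lt {f g : α → ℕ} [hf : PolyMap f] [hg : PolyMap g] :
    PolyPred (fun a => f a < g a) :=
  have h : PolyMap (fun a => g a - f a) := inferInstance
  .of_ne_zero h (by intro a; omega)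

instance PolyPred.eq {f g : ∀ a, β a} [hf : PolyMap f] [hg : PolyMap g] :
    PolyPred (fun a => f a = g a) := by
  have h : PolyPred (fun a => Enc.enc (f a) ≤ Enc.enc (g a) ∧ Enc.enc (g a) ≤ Enc.enc (f a)) :=
    inferInstance
  exact h.of_iff fun a => by rw [← le_antisymm_iff, Enc.inj.eq_iff]

instance PolyPred.const (c : Prop) : PolyPred (fun _ : α => c) := ⟨inferInstance⟩

instance PolyPred.finLe {n : α → ℕ} {f g : ∀ a, Fin (n a)} [hf : PolyMap f] [hg : PolyMap g] :
    PolyPred (fun a => f a ≤ g a) :=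
  (inferInstance : PolyPred (fun a => (f a).val ≤ (g a).val))

instance PolyPred.finLt {n : α → ℕ} {f g : ∀ a, Fin (n a)} [hf : PolyMap f] [hg : PolyMap g] :
    PolyPred (fun a => f a < g a) :=
  (inferInstance : PolyPred (fun a => (f a).val < (g a).val))

instance PolyMap.decide {p : α → Prop} {h : ∀ a, Decidable (p a)} [hp : PolyPred p] :
    PolyMap (fun a => decide (p a)) := by
  classical
  have := hp.out
  refine this.of_enc fun a => ?_
  by_cases h : p a <;> simp [h, Enc.enc]

/-- Case distinction on an optional object. The second case is a function of a dependent pair, as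
everywhere below. -/
theorem PolyMap.optionElim {γ : α → Type} [∀ a, Enc (γ a)] {o : ∀ a, Option (γ a)}
    {f : ∀ a, β a} {g : ∀ a, γ a → β a} (ho : PolyMap o) (hf : PolyMap f)
    (hg : PolyMap (fun q : Σ a, γ a => g q.1 q.2)) :
    PolyMap (fun a => (o a).elim (f a) (g a)) := by
  obtain ⟨O, hO, eO⟩ := ho.out
  obtain ⟨F, hF, eF⟩ := hf.out
  obtain ⟨G, hG, eG⟩ := hg.out
  refine ⟨_, (PolyTime.left.comp hO).ite
    (hG.comp (PolyTime.id'.pair (PolyTime.right.comp hO))) hF, fun a => ?_⟩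
  rw [eO, eF]
  cases h : o a with
  | none => simp [Enc.enc]
  | some x =>
    have := eG ⟨a, x⟩
    simp only [Enc.enc] at this ⊢
    simpa using this

theorem PolyMap.reassoc {A : α → Type} [∀ a, Enc (A a)] :
    PolyMap (fun q : Σ p : α × ℕ, A p.1 => (⟨q.1.1, q.2⟩ : Σ a, A a)) :=
  have h : PolyMap (fun q : Σ p : α × ℕ, A p.1 => (q.1.1, q.2)) := inferInstance
  h.of_enc fun _ => rfl

instance PolyPred.isSome {o : ∀ a, Option (β a)} [ho : PolyMap o] :
    PolyPred (fun a => (o a).isSome = true) := by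
  have h : PolyPred (fun a => ¬ o a = none) := inferInstance
  exact h.of_iff fun a => by cases o a <;> simp

instance PolyMap.isSome {o : ∀ a, Option (β a)} [ho : PolyMap o] :
    PolyMap (fun a => (o a).isSome) := by
  have h : PolyMap (fun a => Decidable.decide ((o a).isSome = true)) := inferInstance
  simpa using h

end PolyMap

/-! ### Lists with entries computable in polynomial time -/

/-- The length and the entries of the lists are computable in polynomial time. -/
class PolyList {α : Type} {T : α → Type} [Enc α] (l : ∀ a, List (T a)) [∀ a, Enc (T a)] : Prop where
  out : PolyMap (fun q : α × ℕ => ((l q.1).length, (l q.1)[q.2]?))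

section PolyList

variable {α : Type} [Enc α] {T : α → Type} [∀ a, Enc (T a)]

theorem PolyList.length (l : ∀ a, List (T a)) [h : PolyList l] :
    PolyMap (fun a => (l a).length) :=
  have h1 : PolyMap (fun q : α × ℕ => (l q.1).length) := PolyMap.fst (hf := h.out)
  h1.comp (fun a => (a, 0)) inferInstance

theorem PolyList.getElem? (l : ∀ a, List (T a)) [h : PolyList l] :
    PolyMap (fun q : α × ℕ => (l q.1)[q.2]?) := PolyMap.snd (hf := h.out)

theorem PolyList.mk' {l : ∀ a, List (T a)} (h1 : PolyMap (fun a => (l a).length))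
    (h2 : PolyMap (fun q : α × ℕ => (l q.1)[q.2]?)) : PolyList l := by
  have := h1.comp (fun q : α × ℕ => q.1) inferInstance
  exact ⟨inferInstance⟩

theorem PolyList.comp {γ : Type} [Enc γ] {S : γ → Type} [∀ c, Enc (S c)] {l : ∀ c, List (S c)}
    (hl : PolyList l) (r : α → γ) (hr : PolyMap r) : PolyList (fun a => l (r a)) :=
  have := hr.comp (fun q : α × ℕ => q.1) inferInstance
  ⟨hl.out.comp (fun q : α × ℕ => (r q.1, q.2)) inferInstance⟩

/-- Only the codes of the entries matter. -/
theorem PolyList.of_enc {l : ∀ a, List (T a)} (hl : PolyList l) {T' : α → Type}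
    [∀ a, Enc (T' a)] {l' : ∀ a, List (T' a)}
    (h : ∀ a, (l' a).map enc = (l a).map enc) : PolyList l' := by
  have hlen : ∀ a, (l' a).length = (l a).length := fun a => by
    simpa using congrArg List.length (h a)
  refine .mk' ?_ ?_
  · simp only [hlen]
    exact PolyList.length l
  · refine (PolyList.getElem? l).of_enc fun q => ?_
    have := congrArg (fun l => l[q.2]?) (h q.1)
    simp only [List.getElem?_map] at this
    cases h1 : (l' q.1)[q.2]? <;> cases h2 : (l q.1)[q.2]? <;> rw [h1, h2] at this
    · rfl
    · simp at this
    · simp at this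
    · exact congrArg (Nat.pair 1) (Option.some.inj this)

instance PolyList.nil : PolyList (fun a => ([] : List (T a))) :=
  ⟨by simp only [List.length_nil, List.getElem?_nil]; infer_instance⟩

instance PolyList.cons {x : ∀ a, T a} {l : ∀ a, List (T a)} [hx : PolyMap x] [hl : PolyList l] :
    PolyList (fun a => x a :: l a) := by
  have h1 := PolyList.length l
  have h0 : PolyMap (fun q : α × ℕ => (q.1, (q.2 - 1 : ℕ))) := inferInstance
  have h2 := (PolyList.getElem? l).comp (fun q : α × ℕ => (q.1, (q.2 - 1 : ℕ))) h0
  have h3 := hx.comp (fun q : α × ℕ => q.1) inferInstance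
  refine .mk' (by simp only [List.length_cons]; infer_instance) ?_
  have h : PolyMap (fun q : α × ℕ => if q.2 = 0 then some (x q.1) else (l q.1)[q.2 - 1]?) :=
    inferInstance
  exact h.of_enc fun q => by rw [List.getElem?_cons]

instance PolyList.append {l l' : ∀ a, List (T a)} [hl : PolyList l] [hl' : PolyList l'] :
    PolyList (fun a => l a ++ l' a) := by
  have h1 := PolyList.length l
  have h1' := PolyList.length l'
  have h0 := h1.comp (fun q : α × ℕ => q.1) inferInstance
  have h2 := PolyList.getElem? l
  have h2' := (PolyList.getElem? l').comp (fun q : α × ℕ => (q.1, q.2 - (l q.1).length))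
    inferInstance
  refine .mk' (by simp only [List.length_append]; infer_instance) ?_
  have h : PolyMap (fun q : α × ℕ => if q.2 < (l q.1).length then (l q.1)[q.2]? else
    (l' q.1)[q.2 - (l q.1).length]?) := inferInstance
  exact h.of_enc fun q => by rw [List.getElem?_append]

theorem PolyList.cond {p : α → Prop} {h : ∀ a, Decidable (p a)} {l l' : ∀ a, List (T a)}
    (hp : PolyPred p) (hl : PolyList l) (hl' : PolyList l') :
    PolyList (fun a => if p a then l a else l' a) := by
  have hp' := hp.comp (fun q : α × ℕ => q.1) inferInstance
  have h1 := hl.out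
  have h2 := hl'.out
  have h : PolyMap (fun q : α × ℕ => if p q.1 then ((l q.1).length, (l q.1)[q.2]?) else
    ((l' q.1).length, (l' q.1)[q.2]?)) := inferInstance
  refine ⟨h.of_enc fun q => ?_⟩
  split_ifs <;> rfl

instance PolyList.ite {p : α → Prop} {h : ∀ a, Decidable (p a)} {l l' : ∀ a, List (T a)}
    [hp : PolyPred p] [hl : PolyList l] [hl' : PolyList l'] :
    PolyList (fun a => if p a then l a else l' a) := .cond hp hl hl'

instance PolyList.range {f : α → ℕ} [hf : PolyMap f] : PolyList (fun a => List.range (f a)) := by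
  have h0 := hf.comp (fun q : α × ℕ => q.1) inferInstance
  refine .mk' (by simpa using hf) ?_
  have h : PolyMap (fun q : α × ℕ => if q.2 < f q.1 then some q.2 else none) := inferInstance
  exact h.of_enc fun q => by
    split_ifs with hq
    · rw [List.getElem?_range hq]
    · rw [List.getElem?_eq_none (by simpa using hq)]

instance PolyList.finRange {f : α → ℕ} [hf : PolyMap f] :
    PolyList (fun a => List.finRange (f a)) :=
  PolyList.of_enc (l := fun a => List.range (f a)) inferInstance fun a => by
    rw [← List.map_coe_finRange_eq_range, List.map_map]
    rfl

instance PolyList.map {S : α → Type} [∀ a, Enc (S a)] {f : ∀ a, T a → S a} {l : ∀ a, List (T a)}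
    [hl : PolyList l] [hf : PolyMap (fun q : Σ a, T a => f q.1 q.2)] :
    PolyList (fun a => (l a).map (f a)) := by
  refine .mk' (by simpa using PolyList.length l) ?_
  have h := PolyMap.optionElim (α := α × ℕ) (γ := fun q => T q.1) (β := fun q => Option (S q.1))
    (o := fun q => (l q.1)[q.2]?) (f := fun _ => none) (g := fun q x => some (f q.1 x))
    (PolyList.getElem? l) inferInstance
    (by
      have := hf.comp (fun q : Σ p : α × ℕ, T p.1 => (⟨q.1.1, q.2⟩ : Σ a, T a))
        .reassoc
      infer_instance)
  exact h.of_enc fun q => by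
    rw [List.getElem?_map]
    cases (l q.1)[q.2]? <;> rfl

/-- The entry `i` of the concatenation of the lists `f x` is found in the list number `j`, where
`j` is the number of lists that end at or before the position `i`. -/
theorem List.getElem?_flatMap_sum {A B : Type} (f : A → List B) (l : List A) (i : ℕ) :
    let S : ℕ → ℕ := fun k => ∑ i ∈ Finset.range k, (l[i]?).elim 0 (fun x => (f x).length)
    let j := ∑ k ∈ Finset.range l.length, if S (k + 1) ≤ i then 1 else 0
    (l.flatMap f)[i]? = (l[j]?).elim none (fun x => (f x)[i - S j]?) := by
  induction l generalizing i with
  | nil => simp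
  | cons x l ih =>
    intro S j
    have hS : ∀ k, S (k + 1) = (f x).length +
        ∑ i ∈ Finset.range k, (l[i]?).elim 0 (fun x => (f x).length) := by
      intro k
      simp only [S, Finset.sum_range_succ', List.getElem?_cons_succ, List.getElem?_cons_zero,
        Option.elim_some]
      ring
    rw [List.flatMap_cons, List.getElem?_append]
    by_cases hi : i < (f x).length
    · have hj : j = 0 := Finset.sum_eq_zero fun k _ => by
        rw [if_neg]
        rw [hS]
        omega
      rw [if_pos hi, hj]
      simp [S]
    · rw [if_neg hi, ih]
      have hj : j = (∑ k ∈ Finset.range l.length,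
          if (∑ i ∈ Finset.range (k + 1), (l[i]?).elim 0 (fun x => (f x).length)) ≤
            i - (f x).length then 1 else 0) + 1 := by
        simp only [j, List.length_cons, Finset.sum_range_succ' _ l.length]
        congr 1
        · refine Finset.sum_congr rfl fun k _ => ?_
          rw [hS]
          congr 1
          rw [eq_iff_iff]
          omega
        · rw [hS]
          simp
          omega
      rw [hj, List.getElem?_cons_succ, hS]
      simp only [Nat.sub_sub]

instance PolyList.flatMap {S : α → Type} [∀ a, Enc (S a)] {f : ∀ a, T a → List (S a)}
    {l : ∀ a, List (T a)} [hl : PolyList l] [hf : PolyList (fun q : Σ a, T a => f q.1 q.2)] :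
    PolyList (fun a => (l a).flatMap (f a)) := by
  have hget := PolyList.getElem? l
  have hlen := PolyList.length l
  have hat : PolyMap (fun q : α × ℕ => ((l q.1)[q.2]?).elim 0 (fun x => (f q.1 x).length)) :=
    PolyMap.optionElim (γ := fun q : α × ℕ => T q.1) (o := fun q => (l q.1)[q.2]?)
      (f := fun _ => 0) (g := fun q x => (f q.1 x).length) hget inferInstance
      ((PolyList.length (fun q : Σ a, T a => f q.1 q.2)).comp
        (fun q : Σ p : α × ℕ, T p.1 => (⟨q.1.1, q.2⟩ : Σ a, T a)) .reassoc)
  have hS : PolyMap (fun q : α × ℕ =>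
      ∑ i ∈ Finset.range q.2, ((l q.1)[i]?).elim 0 (fun x => (f q.1 x).length)) :=
    PolyMap.sum (f := fun q : (α × ℕ) × ℕ =>
      ((l q.1.1)[q.2]?).elim 0 (fun x => (f q.1.1 x).length))
      (hat.comp (fun q : (α × ℕ) × ℕ => (q.1.1, q.2)) inferInstance) inferInstance
  have hlen' := hlen.comp (fun q : α × ℕ => q.1) inferInstance
  have hj : PolyMap (fun q : α × ℕ => ∑ k ∈ Finset.range (l q.1).length,
      if (∑ i ∈ Finset.range (k + 1), ((l q.1)[i]?).elim 0 (fun x => (f q.1 x).length)) ≤ q.2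
      then 1 else 0) := by
    have h0 : PolyMap (fun q : (α × ℕ) × ℕ => (q.1.1, (q.2 + 1 : ℕ))) := inferInstance
    have := hS.comp (fun q : (α × ℕ) × ℕ => (q.1.1, (q.2 + 1 : ℕ))) h0
    exact PolyMap.sum (f := fun q : (α × ℕ) × ℕ =>
      if (∑ i ∈ Finset.range (q.2 + 1), ((l q.1.1)[i]?).elim 0 (fun x => (f q.1.1 x).length)) ≤
        q.1.2 then 1 else 0) inferInstance hlen'
  refine .mk' ?_ ?_
  · have := PolyMap.sum hat hlen
    refine this.of_enc fun a => congrArg enc ?_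
    rw [List.length_flatMap, ← Fin.sum_univ_eq_sum_range
      (fun i => ((l a)[i]?).elim 0 (fun x => (f a x).length))]
    simp [← List.sum_ofFn]
    congr 1
    exact (List.ofFn_getElem_eq_map (l a) (fun x => (f a x).length)).symm
  · obtain ⟨M, hM⟩ : ∃ M : α × ℕ → ℕ, ∀ q, M q = ∑ i ∈ Finset.range q.2,
      ((l q.1)[i]?).elim 0 (fun x => (f q.1 x).length) := ⟨_, fun _ => rfl⟩
    obtain ⟨J, hJ⟩ : ∃ J : α × ℕ → ℕ, ∀ q, J q = ∑ k ∈ Finset.range (l q.1).length,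
      if (∑ i ∈ Finset.range (k + 1), ((l q.1)[i]?).elim 0 (fun x => (f q.1 x).length)) ≤ q.2
      then 1 else 0 := ⟨_, fun _ => rfl⟩
    replace hS : PolyMap M := hS.of_enc fun q => by rw [hM]
    replace hj : PolyMap J := hj.of_enc fun q => by rw [hJ]
    have h0 : PolyMap (fun q : α × ℕ => (q.1, J q)) := inferInstance
    have hg := hget.comp _ h0
    have hSj := hS.comp _ h0
    have h2 := hSj.comp (fun q : Σ p : α × ℕ, T p.1 => q.1) inferInstance
    have h1 := PolyList.getElem? (fun q : Σ a, T a => f q.1 q.2)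
    have h3 : PolyMap (fun q : Σ p : α × ℕ, T p.1 => (⟨q.1.1, q.2⟩ : Σ a, T a)) := .reassoc
    have h4 : PolyMap (fun q : Σ p : α × ℕ, T p.1 =>
        ((⟨q.1.1, q.2⟩ : Σ a, T a), (q.1.2 - M (q.1.1, J q.1) : ℕ))) := inferInstance
    have h := PolyMap.optionElim (γ := fun q : α × ℕ => T q.1)
      (β := fun q : α × ℕ => Option (S q.1))
      (o := fun q => (l q.1)[J q]?) (f := fun _ => none) hg inferInstance
      (g := fun q x => (f q.1 x)[q.2 - M (q.1, J q)]?) (h1.comp _ h4)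
    refine h.of_enc fun q => congrArg Enc.enc ?_
    rw [List.getElem?_flatMap_sum, hJ]
    simp only [hM]

instance PolyList.filter {p : ∀ a, T a → Bool} {l : ∀ a, List (T a)} [hl : PolyList l]
    [hp : PolyPred (fun q : Σ a, T a => p q.1 q.2 = true)] :
    PolyList (fun a => (l a).filter (p a)) := by
  have h : PolyList (fun a => (l a).flatMap (fun x => if p a x = true then [x] else [])) :=
    inferInstance
  refine h.of_enc fun a => congrArg _ ?_
  induction l a with
  | nil => rfl
  | cons x l ih => by_cases hx : p a x <;> simp [hx, ih]

theorem PolyMap.getElem? {l : ∀ a, List (T a)} {i : α → ℕ} (hl : PolyList l) (hi : PolyMap i) :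
    PolyMap (fun a => (l a)[i a]?) :=
  (PolyList.getElem? l).comp (fun a => (a, i a)) inferInstance

instance PolyPred.mem {x : ∀ a, T a} {l : ∀ a, List (T a)} [hx : PolyMap x] [hl : PolyList l] :
    PolyPred (fun a => x a ∈ l a) := by
  classical
  have h1 := PolyList.getElem? l
  have h2 := PolyList.length l
  have h3 := hx.comp (fun q : α × ℕ => q.1) inferInstance
  have h : PolyMap (fun q : α × ℕ => if (l q.1)[q.2]? = some (x q.1) then 1 else 0) :=
    inferInstance
  refine .of_ne_zero (h.sum h2) fun a => ?_
  rw [List.mem_iff_getElem?, Ne, Finset.sum_eq_zero_iff]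
  simp only [Finset.mem_range, ite_eq_right_iff, not_forall]
  constructor
  · rintro ⟨i, hi⟩
    exact ⟨i, (List.getElem?_eq_some_iff.1 hi).1, hi, one_ne_zero⟩
  · rintro ⟨i, _, hi, _⟩
    exact ⟨i, hi⟩

/-- Moves the index of a list into the first component of the context. -/
theorem PolyList.toMap {A : α → Type} [∀ a, Enc (A a)] {S : (Σ a, A a) → Type}
    [∀ q, Enc (S q)] {l : ∀ q : Σ a, A a, List (S q)} (h : PolyList l) :
    PolyMap (fun q : Σ p : α × ℕ, A p.1 =>
      ((l ⟨q.1.1, q.2⟩).length, (l ⟨q.1.1, q.2⟩)[q.1.2]?)) := by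
  have h3 : PolyMap (fun q : Σ p : α × ℕ, A p.1 => (⟨q.1.1, q.2⟩ : Σ a, A a)) := .reassoc
  exact h.out.comp (fun q : Σ p : α × ℕ, A p.1 => ((⟨q.1.1, q.2⟩ : Σ a, A a), q.1.2))
    inferInstance

end PolyList

/-! ### Printing a list with entries computable in polynomial time -/

/-- Registers `0, 1, 2, 3` hold the numbers `n, m, s, t`, whose code is put into register `7`. -/
def encodeProg : Prog :=
  .seq (.add 12 2 4) <| .seq (.add 13 3 4) <| .seq (pairProg 11) <|
  .seq (.add 10 1 4) <| .seq (pairProg 9) <| .seq (.add 8 0 4) (pairProg 7)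

theorem encodeProg_exec (n m s t : ℕ) :
    Exec encodeProg ⟨fun x => [n, m, s, t].getD x 0, []⟩
      (3 * (s + t) + 20 + (3 * (m + Nat.pair s t) + 20) +
        (3 * (n + Nat.pair m (Nat.pair s t)) + 20) + 4)
      (fun σ => σ.out = [] ∧ σ.mem 7 = Nat.pair n (Nat.pair m (Nat.pair s t))) := by
  unfold encodeProg
  refine Exec.mono (T := 1 + (1 + ((3 * (s + t) + 20) + (1 + ((3 * (m + Nat.pair s t) + 20) +
    (1 + (3 * (n + Nat.pair m (Nat.pair s t)) + 20))))))) ?_ (by omega) (fun _ h => h)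
  refine .seq (.add (.seq (.add (.seq ((pairProg_exec 11 _).mono ?t1 fun σ₁ h1 => ?s1)))))
  case s1 =>
    have a0 := h1.1.1 0 (by omega)
    have a1 := h1.1.1 1 (by omega)
    have a4 := h1.1.1 4 (by omega)
    have a11 := h1.2
    simp [Config.set_mem] at a0 a1 a4 a11
    refine .seq (.add (.seq ((pairProg_exec 9 _).mono ?t2 fun σ₂ h3 => ?s2)))
    case t2 => simp [Config.set_mem, a1, a4, a11]
    have b0 := h3.1.1 0 (by omega)
    have b4 := h3.1.1 4 (by omega)
    have b9 := h3.2
    simp [Config.set_mem, a0, a1, a4, a11] at b0 b4 b9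
    refine .seq (.add ((pairProg_exec 7 _).mono ?t3 fun σ₃ h5 => ?s3))
    case t3 => simp [Config.set_mem, b0, b4, b9]
    have c7 := h5.2
    simp [Config.set_mem, b0, b4, b9] at c7
    exact ⟨by rw [h5.1.2]; simp [h3.1.2, h1.1.2], c7⟩
  case t1 => simp [Config.set_mem]

/-- The code of `n, m, s, t` is polynomially bounded. -/
theorem exists_bound_pair : ∃ B : Polynomial ℕ, ∀ n m s t : ℕ,
    n + m + s + t + Nat.pair s t + Nat.pair m (Nat.pair s t) +
      Nat.pair n (Nat.pair m (Nat.pair s t)) ≤ B.eval (n + m + s + t) := by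
  let B1 : Polynomial ℕ := (Polynomial.X + 1) ^ 2
  let B2 : Polynomial ℕ := (Polynomial.X + B1 + 1) ^ 2
  let B3 : Polynomial ℕ := (Polynomial.X + B2 + 1) ^ 2
  refine ⟨Polynomial.X + B1 + B2 + B3, fun n m s t => ?_⟩
  have h1 : Nat.pair s t ≤ B1.eval (n + m + s + t) := by
    refine (PolyTime.pair_le s t).trans ?_
    simp only [B1, Polynomial.eval_pow, Polynomial.eval_add, Polynomial.eval_X,
      Polynomial.eval_one]
    gcongr
    omega
  have h2 : Nat.pair m (Nat.pair s t) ≤ B2.eval (n + m + s + t) := by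
    refine (PolyTime.pair_le _ _).trans ?_
    simp only [B2, Polynomial.eval_pow, Polynomial.eval_add, Polynomial.eval_X,
      Polynomial.eval_one]
    gcongr
    omega
  have h3 : Nat.pair n (Nat.pair m (Nat.pair s t)) ≤ B3.eval (n + m + s + t) := by
    refine (PolyTime.pair_le _ _).trans ?_
    simp only [B3, Polynomial.eval_pow, Polynomial.eval_add, Polynomial.eval_X,
      Polynomial.eval_one]
    gcongr
    omega
  simp only [Polynomial.eval_add, Polynomial.eval_X]
  omega

/-- A program that prints the list `l (n, m, s, t)` in polynomial time. -/
theorem PolyList.exists_prog {l : ℕ × ℕ × ℕ × ℕ → List ℕ} (h : PolyList l) :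
    ∃ (P : Polynomial ℕ) (M : Prog), ∀ n m s t,
      (l (n, m, s, t)).length ≤ P.eval (n + m + s + t) ∧
        ∃ k ≤ P.eval (n + m + s + t), M.Computes n m s t (l (n, m, s, t)) k := by
  obtain ⟨G, hG, eG⟩ := h.out.out
  have hlen : PolyTime (fun x => (G (Nat.pair x 0)).unpair.1) :=
    PolyTime.left.comp (hG.comp (PolyTime.id'.pair (PolyTime.const 0)))
  have hent : PolyTime (fun x => (G x).unpair.2.unpair.2) :=
    PolyTime.right.comp (PolyTime.right.comp hG)
  have e1 : ∀ p, (G (Nat.pair (Enc.enc p) 0)).unpair.1 = (l p).length := fun p => by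
    have := eG (p, 0)
    simp only [Enc.enc] at this ⊢
    rw [this]; simp
  have e2 : ∀ p i v, (l p)[i]? = some v →
      (G (Nat.pair (Enc.enc p) i)).unpair.2.unpair.2 = v := fun p i v hv => by
    have := eG (p, i)
    simp only [hv] at this
    simp only [Enc.enc] at this ⊢
    rw [this]; simp
  obtain ⟨⟨Bl, hBl⟩, Pl, hPl⟩ := hlen
  obtain ⟨_, Pe, hPe⟩ := hent
  obtain ⟨cl, hcl⟩ := hPl 8
  obtain ⟨ce, hce⟩ := hPe 8
  obtain ⟨B, hB⟩ := exists_bound_pair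
  -- bounds for the length, for the argument of the entry function, and for one iteration
  set L : Polynomial ℕ := Bl.comp B with hL
  set A : Polynomial ℕ := (B + L + 1) ^ 2 with hA
  set T : Polynomial ℕ := 3 * (B + L) + 20 + Pe.comp A + 6 with hT
  refine ⟨9 * B + 80 + Pl.comp B + (L * (T + 1) + 1) + L, .seq encodeProg <| .seq (.const 6 0) <|
    .seq (.add 8 7 6) <| .seq cl <| .seq (.add 4 8 6) <| .seq (.const 5 0) <|
    .seq (.const 3 1) <| .loop 4 (.seq (.add 9 7 6) <| .seq (.add 10 5 6) <| .seq (pairProg 8) <|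
      .seq ce <| .seq (.print 8) <| .seq (.add 5 5 3) <| .sub 4 4 3), fun n m s t => ?_⟩
  have hX := hB n m s t
  set N := n + m + s + t with hN
  set X := Nat.pair n (Nat.pair m (Nat.pair s t)) with hXd
  have hXe : X = Enc.enc (n, m, s, t) := rfl
  set w := l (n, m, s, t) with hw
  have hXB : X ≤ B.eval N := by omega
  have hwL : w.length ≤ L.eval N := by
    rw [hw, ← e1, ← hXe, hL, Polynomial.eval_comp]
    exact (hBl X).trans (PolyTime.eval_le hXB)
  refine ⟨by simp only [Polynomial.eval_add]; omega, ?_⟩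
  suffices hE : Exec _ _ ((9 * B + 80 + Pl.comp B + (L * (T + 1) + 1)).eval N)
      (fun σ : Config => σ.out = w) by
    obtain ⟨σ, k, h1, h2, h3⟩ := hE
    exact ⟨k, by rw [Polynomial.eval_add]; omega, σ, h1, h3⟩
  have hTN : T.eval N = 3 * (B.eval N + L.eval N) + 20 + Pe.eval (A.eval N) + 6 := by
    simp [hT, Polynomial.eval_comp]
  refine Exec.mono (T := (3 * (s + t) + 20 + (3 * (m + Nat.pair s t) + 20) +
        (3 * (n + Nat.pair m (Nat.pair s t)) + 20) + 4) +
      (1 + (1 + (Pl.eval X + (1 + (1 + (1 + (w.length * (T.eval N + 1) + 1)))))))) ?_ ?time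
    (fun _ h => h)
  case' time =>
    have b1 : Pl.eval X ≤ Pl.eval (B.eval N) := PolyTime.eval_le hXB
    have b2 : w.length * (T.eval N + 1) ≤ L.eval N * (T.eval N + 1) := by gcongr
    have e9 : (9 : Polynomial ℕ).eval N = 9 := by simp
    have e80 : (80 : Polynomial ℕ).eval N = 80 := by simp
    simp only [Polynomial.eval_add, Polynomial.eval_mul, Polynomial.eval_comp,
      Polynomial.eval_one, e9, e80]
    omega
  refine .seq ((encodeProg_exec n m s t).mono le_rfl fun σ₁ h12 => ?_)
  obtain ⟨h1, h2⟩ := h12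
  refine .seq (.const (.seq (.add (.seq ((hcl _).mono ?len fun σ₂ h34 => ?_)))))
  case len => simp [Config.set_mem, h2, hXd]
  obtain ⟨h3, h4⟩ := h34
  have c6 := h3.1 6 (by omega)
  have c7 := h3.1 7 (by omega)
  simp [Config.set_mem, h2, ← hXd] at c6 c7 h4
  have h4' : σ₂.mem 8 = w.length := by rw [h4, hXe, e1]
  have co := h3.2
  simp [h1] at co
  refine .seq (.add (.seq (.const (.seq (.const ?_)))))
  refine (Exec.loop (fun k τ => τ.mem 4 = k ∧ τ.mem 5 + k = w.length ∧ τ.mem 7 = X ∧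
    τ.mem 6 = 0 ∧ τ.mem 3 = 1 ∧ τ.out = w.take (τ.mem 5)) ?_ (fun τ h => h.1)
    w.length _ ?_).mono le_rfl ?_
  · rintro k τ ⟨i1, i2, i3, i4, i5, i6⟩
    refine ⟨by omega, ?_⟩
    set i := τ.mem 5 with hi
    have hiw : i < w.length := by omega
    have hp : Nat.pair X i ≤ A.eval N := by
      refine (PolyTime.pair_le _ _).trans ?_
      simp only [hA, Polynomial.eval_pow, Polynomial.eval_add, Polynomial.eval_one]
      gcongr
      omega
    refine Exec.mono (T := 1 + (1 + ((3 * (X + i) + 20) + (Pe.eval (Nat.pair X i) +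
        (1 + (1 + 1)))))) ?_ ?step (fun _ h => h)
    case' step =>
      have q1 := PolyTime.eval_le (P := Pe) hp
      rw [hTN]
      omega
    refine .seq (.add (.seq (.add (.seq ((pairProg_exec 8 _).mono ?pair fun τ₁ j12 => ?_)))))
    case pair => simp [Config.set_mem, ← hi, i3, i4]
    obtain ⟨j1, j2⟩ := j12
    have a3 := j1.1 3 (by omega)
    have a4 := j1.1 4 (by omega)
    have a5 := j1.1 5 (by omega)
    have a6 := j1.1 6 (by omega)
    have a7 := j1.1 7 (by omega)
    simp [Config.set_mem, ← hi, i1, i3, i4, i5] at a3 a4 a5 a6 a7 j2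
    refine .seq ((hce _).mono ?ent fun τ₂ j34 => ?_)
    case ent => rw [j2]
    obtain ⟨j3, j4⟩ := j34
    refine .seq (.print (.seq (.add (.sub ?_))))
    have b3 := j3.1 3 (by omega)
    have b4 := j3.1 4 (by omega)
    have b5 := j3.1 5 (by omega)
    have b6 := j3.1 6 (by omega)
    have b7 := j3.1 7 (by omega)
    rw [j2, hXe] at j4
    replace j4 := j4.trans (e2 _ i w[i] (by simp [← hw]))
    have bo := j3.2
    rw [j1.2] at bo
    simp [i6] at bo
    have d4 : τ₂.mem 4 = k + 1 := b4.trans a4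
    have d5 : τ₂.mem 5 = i := b5.trans a5
    have d3 : τ₂.mem 3 = 1 := b3.trans a3
    have d6 : τ₂.mem 6 = 0 := b6.trans a6
    have d7 : τ₂.mem 7 = X := b7.trans a7
    refine ⟨?_, ?_, ?_, ?_, ?_, ?_⟩
    · simp [Config.set_mem, d4, d3]
    · simp only [Config.set_mem, d5, d3]
      simp
      omega
    · simpa [Config.set_mem] using d7
    · simpa [Config.set_mem] using d6
    · simpa [Config.set_mem] using d3
    · simp only [Config.set_mem, Config.set_out, bo, j4, d5, d3]
      simp only [Nat.reduceEqDiff, if_true, if_false]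
      rw [List.take_add_one, List.getElem?_eq_getElem hiw]
      rfl
  · simp [Config.set_mem, c6, c7, h4', co]
  · rintro τ ⟨i1, i2, i3, i4, i5, i6⟩
    rw [i6, List.take_of_length_le (by omega)]

/-! ### Case distinctions -/

section Cases

variable {α : Type} [Enc α] {T : α → Type} [∀ a, Enc (T a)] {β : α → Type} [∀ a, Enc (β a)]

/-- On the objects whose codes are pairs with a first component at least `k`, the function `F` is
computable in polynomial time. The first components number the constructors of a type. -/
def CasesFrom (F : ∀ a, T a → β a) (k : ℕ) : Prop :=
  ∃ G, PolyTime G ∧ ∀ a (x : T a), k ≤ (enc x).unpair.1 →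
    G (Nat.pair (enc a) (enc x)) = enc (F a x)

theorem CasesFrom.last {F : ∀ a, T a → β a} {k : ℕ} (h : ∀ a (x : T a), (enc x).unpair.1 < k) :
    CasesFrom F k :=
  ⟨_, PolyTime.id', fun a x hx => absurd (h a x) (by omega)⟩

/-- One more constructor `c`, with number `k`. -/
theorem CasesFrom.step {F : ∀ a, T a → β a} {k : ℕ} {Y : α → Type} [∀ a, Enc (Y a)]
    {c : ∀ a, Y a → T a} (h : PolyMap (fun q : Σ a, Y a => F q.1 (c q.1 q.2)))
    (hc : ∀ a y, enc (c a y) = Nat.pair k (enc y))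
    (hk : ∀ a (x : T a), (enc x).unpair.1 = k → ∃ y, x = c a y) (h' : CasesFrom F (k + 1)) :
    CasesFrom F k := by
  obtain ⟨G, hG, eG⟩ := h'
  obtain ⟨H, hH, eH⟩ := h.out
  refine ⟨_, ((PolyTime.left.comp PolyTime.right).sub (PolyTime.const k)).ite hG
    (hH.comp (PolyTime.left.pair (PolyTime.right.comp PolyTime.right))), fun a x hx => ?_⟩
  simp only [Nat.unpair_pair]
  split_ifs with h1
  · exact eG a x (by omega)
  · obtain ⟨y, rfl⟩ := hk a x (by omega)
    rw [hc, Nat.unpair_pair]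
    exact eH ⟨a, y⟩

theorem CasesFrom.map {F : ∀ a, T a → β a} (h : CasesFrom F 0) {x : ∀ a, T a} (hx : PolyMap x) :
    PolyMap (fun a => F a (x a)) := by
  obtain ⟨G, hG, eG⟩ := h
  obtain ⟨X, hX, eX⟩ := hx.out
  exact ⟨_, hG.comp (PolyTime.id'.pair hX), fun a => by rw [eX, eG a _ (Nat.zero_le _)]⟩

/-- Case distinction between zero and successors, as for a definition by pattern matching on a
natural number. -/
theorem PolyMap.natCases {f : ∀ a, β a} (x : α → ℕ) (F : ∀ a, ℕ → β a) (h : ∀ a, f a = F a (x a))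
    [hx : PolyMap x] (h0 : PolyMap (fun a => F a 0))
    (h1 : PolyMap (fun q : α × ℕ => F q.1 (q.2 + 1))) : PolyMap f := by
  have hp : PolyMap (fun a => (a, (x a - 1 : ℕ))) := inferInstance
  have h2 := h1.comp _ hp
  have h2 : PolyMap (fun a => if x a = 0 then F a 0 else F a (x a - 1 + 1)) := inferInstance
  refine h2.of_enc fun a => congrArg Enc.enc ((h a).trans ?_)
  split_ifs with hx
  · rw [hx]
  · rw [Nat.sub_add_cancel (by omega)]

end Cases

instance {V : Type} [Enc V] : Enc (Lit V) :=
  ⟨fun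
    | .pos x => Nat.pair 0 (enc x)
    | .neg x => Nat.pair 1 (enc x), fun a b h => by
    cases a <;> cases b <;> simp only [Nat.pair_eq_pair, Enc.inj.eq_iff] at h <;>
      first | rfl | (obtain ⟨-, h⟩ := h; cases h; rfl) | exact absurd h.1 (by decide)⟩

section Lit

variable {α : Type} [Enc α] {V : α → Type} [∀ a, Enc (V a)]

instance {f : ∀ a, V a}
    [hf : PolyMap f] :
    PolyMap (fun a => (Lit.pos (f a) : Lit (V a))) := by
  obtain ⟨F, hF, eF⟩ := hf.out
  exact ⟨_, (PolyTime.const 0).pair hF, fun a => by rw [eF]; rfl⟩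

instance {f : ∀ a, V a}
    [hf : PolyMap f] :
    PolyMap (fun a => (Lit.neg (f a) : Lit (V a))) := by
  obtain ⟨F, hF, eF⟩ := hf.out
  exact ⟨_, (PolyTime.const 1).pair hF, fun a => by rw [eF]; rfl⟩

variable {β : α → Type} [∀ a, Enc (β a)]

/-- Case distinction on a literal. There is one hypothesis for each constructor, on the function
of the parameter and the arguments of the constructor; the lemmas for the other types have the
same form. -/
theorem Lit.polyMap {f : ∀ a, β a} (x : ∀ a, Lit (V a)) (F : ∀ a, Lit (V a) → β a)
    (h : ∀ a, f a = F a (x a)) [hx : PolyMap x]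
    (h0 : PolyMap (fun q : Σ a : α, V a => F q.1 (.pos q.2)))
    (h1 : PolyMap (fun q : Σ a : α, V a => F q.1 (.neg q.2))) :
    PolyMap f :=
  (funext h : f = _) ▸ CasesFrom.map (F := F) (
    .step (Y := fun a => V a) (c := fun _ y => .pos y) h0 (fun _ _ => rfl)
      (fun _ x h => by cases x <;> simp [enc] at h; exact ⟨_, rfl⟩) <|
    .step (Y := fun a => V a) (c := fun _ y => .neg y) h1 (fun _ _ => rfl)
      (fun _ x h => by cases x <;> simp [enc] at h; exact ⟨_, rfl⟩) <|
    .last (fun _ x => by cases x <;> simp [enc])) hx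

theorem Lit.polyList {f : ∀ a, List (β a)} (x : ∀ a, Lit (V a)) (F : ∀ a, Lit (V a) → List (β a))
    (h : ∀ a, f a = F a (x a)) [hx : PolyMap x]
    (h0 : PolyList (fun q : Σ a : α, V a => F q.1 (.pos q.2)))
    (h1 : PolyList (fun q : Σ a : α, V a => F q.1 (.neg q.2))) :
    PolyList f :=
  have _ := hx.comp (fun q : α × ℕ => q.1) inferInstance
  (funext h : f = _) ▸ ⟨Lit.polyMap (fun q : α × ℕ => x q.1)
    (fun q x => ((F q.1 x).length, (F q.1 x)[q.2]?)) (fun _ => rfl)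
    h0.toMap h1.toMap⟩

end Lit

instance {n m : ℕ} : Enc (SVar n m) :=
  ⟨fun
    | .alpha x => Nat.pair 0 (enc x)
    | .alit x y => Nat.pair 1 (enc (⟨x, y⟩ : Fin m × Lit (Fin n)))
    | .sat x y => Nat.pair 2 (enc (⟨x, y⟩ : Fin m × Lit (Fin n))), fun a b h => by
    cases a <;> cases b <;> simp only [Nat.pair_eq_pair, Enc.inj.eq_iff] at h <;>
      first | rfl | (obtain ⟨-, h⟩ := h; cases h; rfl) | exact absurd h.1 (by decide)⟩

section SVar

variable {α : Type} [Enc α] {n m : α → ℕ}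

instance {f : ∀ a, Fin (n a)}
    [hf : PolyMap f] :
    PolyMap (fun a => (SVar.alpha (f a) : SVar (n a) (m a))) := by
  obtain ⟨F, hF, eF⟩ := hf.out
  exact ⟨_, (PolyTime.const 0).pair hF, fun a => by rw [eF]; rfl⟩

instance {f : ∀ a, Fin (m a)} {g : ∀ a, Lit (Fin (n a))}
    [hf : PolyMap f] [hg : PolyMap g] :
    PolyMap (fun a => (SVar.alit (f a) (g a) : SVar (n a) (m a))) := by
  obtain ⟨F, hF, eF⟩ := hf.out
  obtain ⟨G, hG, eG⟩ := hg.out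
  exact ⟨_, (PolyTime.const 1).pair (hF.pair hG), fun a => by rw [eF, eG]; rfl⟩

instance {f : ∀ a, Fin (m a)} {g : ∀ a, Lit (Fin (n a))}
    [hf : PolyMap f] [hg : PolyMap g] :
    PolyMap (fun a => (SVar.sat (f a) (g a) : SVar (n a) (m a))) := by
  obtain ⟨F, hF, eF⟩ := hf.out
  obtain ⟨G, hG, eG⟩ := hg.out
  exact ⟨_, (PolyTime.const 2).pair (hF.pair hG), fun a => by rw [eF, eG]; rfl⟩

variable {β : α → Type} [∀ a, Enc (β a)]

theorem SVar.polyMap {f : ∀ a, β a} (x : ∀ a, SVar (n a) (m a)) (F : ∀ a, SVar (n a) (m a) → β a)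
    (h : ∀ a, f a = F a (x a)) [hx : PolyMap x]
    (h0 : PolyMap (fun q : Σ a : α, Fin (n a) => F q.1 (.alpha q.2)))
    (h1 : PolyMap (fun q : Σ a : α, Fin (m a) × Lit (Fin (n a)) => F q.1 (.alit q.2.1 q.2.2)))
    (h2 : PolyMap (fun q : Σ a : α, Fin (m a) × Lit (Fin (n a)) => F q.1 (.sat q.2.1 q.2.2))) :
    PolyMap f :=
  (funext h : f = _) ▸ CasesFrom.map (F := F) (
    .step (Y := fun a => Fin (n a)) (c := fun _ y => .alpha y) h0 (fun _ _ => rfl)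
      (fun _ x h => by cases x <;> simp [enc] at h; exact ⟨_, rfl⟩) <|
    .step (Y := fun a => Fin (m a) × Lit (Fin (n a)))
      (c := fun _ y => .alit y.1 y.2) h1 (fun _ _ => rfl)
      (fun _ x h => by cases x <;> simp [enc] at h; exact ⟨⟨_, _⟩, rfl⟩) <|
    .step (Y := fun a => Fin (m a) × Lit (Fin (n a)))
      (c := fun _ y => .sat y.1 y.2) h2 (fun _ _ => rfl)
      (fun _ x h => by cases x <;> simp [enc] at h; exact ⟨⟨_, _⟩, rfl⟩) <|
    .last (fun _ x => by cases x <;> simp [enc])) hx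

theorem SVar.polyList {f : ∀ a, List (β a)} (x : ∀ a, SVar (n a) (m a))
    (F : ∀ a, SVar (n a) (m a) → List (β a))
    (h : ∀ a, f a = F a (x a)) [hx : PolyMap x]
    (h0 : PolyList (fun q : Σ a : α, Fin (n a) => F q.1 (.alpha q.2)))
    (h1 : PolyList (fun q : Σ a : α, Fin (m a) × Lit (Fin (n a)) => F q.1 (.alit q.2.1 q.2.2)))
    (h2 : PolyList (fun q : Σ a : α, Fin (m a) × Lit (Fin (n a)) => F q.1 (.sat q.2.1 q.2.2))) :
    PolyList f :=
  have _ := hx.comp (fun q : α × ℕ => q.1) inferInstance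
  (funext h : f = _) ▸ ⟨SVar.polyMap (fun q : α × ℕ => x q.1)
    (fun q x => ((F q.1 x).length, (F q.1 x)[q.2]?)) (fun _ => rfl)
    h0.toMap h1.toMap h2.toMap⟩

end SVar

instance {V I : Type} [Enc V] [Enc I] {s : ℕ} : Enc (RVar V I s) :=
  ⟨fun
    | .en x => Nat.pair 0 (enc x)
    | .der x => Nat.pair 1 (enc x)
    | .weak x y => Nat.pair 2 (enc (⟨x, y⟩ : Fin s × I))
    | .lit x y => Nat.pair 3 (enc (⟨x, y⟩ : Fin s × Lit V))
    | .res x y => Nat.pair 4 (enc (⟨x, y⟩ : Fin s × V))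
    | .lp x y => Nat.pair 5 (enc (⟨x, y⟩ : Σ B : Fin s, Fin B))
    | .rp x y => Nat.pair 6 (enc (⟨x, y⟩ : Σ B : Fin s, Fin B)), fun a b h => by
    cases a <;> cases b <;> simp only [Nat.pair_eq_pair, Enc.inj.eq_iff] at h <;>
      first | rfl | (obtain ⟨-, h⟩ := h; cases h; rfl) | exact absurd h.1 (by decide)⟩

section RVar

variable {α : Type} [Enc α] {V I : α → Type} [∀ a, Enc (V a)] [∀ a, Enc (I a)] {s : α → ℕ}

instance {f : ∀ a, Fin (s a)}
    [hf : PolyMap f] :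
    PolyMap (fun a => (RVar.en (f a) : RVar (V a) (I a) (s a))) := by
  obtain ⟨F, hF, eF⟩ := hf.out
  exact ⟨_, (PolyTime.const 0).pair hF, fun a => by rw [eF]; rfl⟩

instance {f : ∀ a, Fin (s a)}
    [hf : PolyMap f] :
    PolyMap (fun a => (RVar.der (f a) : RVar (V a) (I a) (s a))) := by
  obtain ⟨F, hF, eF⟩ := hf.out
  exact ⟨_, (PolyTime.const 1).pair hF, fun a => by rw [eF]; rfl⟩

instance {f : ∀ a, Fin (s a)} {g : ∀ a, I a}
    [hf : PolyMap f] [hg : PolyMap g] :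
    PolyMap (fun a => (RVar.weak (f a) (g a) : RVar (V a) (I a) (s a))) := by
  obtain ⟨F, hF, eF⟩ := hf.out
  obtain ⟨G, hG, eG⟩ := hg.out
  exact ⟨_, (PolyTime.const 2).pair (hF.pair hG), fun a => by rw [eF, eG]; rfl⟩

instance {f : ∀ a, Fin (s a)} {g : ∀ a, Lit (V a)}
    [hf : PolyMap f] [hg : PolyMap g] :
    PolyMap (fun a => (RVar.lit (f a) (g a) : RVar (V a) (I a) (s a))) := by
  obtain ⟨F, hF, eF⟩ := hf.out
  obtain ⟨G, hG, eG⟩ := hg.out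
  exact ⟨_, (PolyTime.const 3).pair (hF.pair hG), fun a => by rw [eF, eG]; rfl⟩

instance {f : ∀ a, Fin (s a)} {g : ∀ a, V a}
    [hf : PolyMap f] [hg : PolyMap g] :
    PolyMap (fun a => (RVar.res (f a) (g a) : RVar (V a) (I a) (s a))) := by
  obtain ⟨F, hF, eF⟩ := hf.out
  obtain ⟨G, hG, eG⟩ := hg.out
  exact ⟨_, (PolyTime.const 4).pair (hF.pair hG), fun a => by rw [eF, eG]; rfl⟩

instance {f : ∀ a, Fin (s a)} {g : ∀ a, Fin (f a)}
    [hf : PolyMap f] [hg : PolyMap g] :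
    PolyMap (fun a => (RVar.lp (f a) (g a) : RVar (V a) (I a) (s a))) := by
  obtain ⟨F, hF, eF⟩ := hf.out
  obtain ⟨G, hG, eG⟩ := hg.out
  exact ⟨_, (PolyTime.const 5).pair (hF.pair hG), fun a => by rw [eF, eG]; rfl⟩

instance {f : ∀ a, Fin (s a)} {g : ∀ a, Fin (f a)}
    [hf : PolyMap f] [hg : PolyMap g] :
    PolyMap (fun a => (RVar.rp (f a) (g a) : RVar (V a) (I a) (s a))) := by
  obtain ⟨F, hF, eF⟩ := hf.out
  obtain ⟨G, hG, eG⟩ := hg.out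
  exact ⟨_, (PolyTime.const 6).pair (hF.pair hG), fun a => by rw [eF, eG]; rfl⟩

variable {β : α → Type} [∀ a, Enc (β a)]

theorem RVar.polyMap {f : ∀ a, β a} (x : ∀ a, RVar (V a) (I a) (s a))
    (F : ∀ a, RVar (V a) (I a) (s a) → β a)
    (h : ∀ a, f a = F a (x a)) [hx : PolyMap x]
    (h0 : PolyMap (fun q : Σ a : α, Fin (s a) => F q.1 (.en q.2)))
    (h1 : PolyMap (fun q : Σ a : α, Fin (s a) => F q.1 (.der q.2)))
    (h2 : PolyMap (fun q : Σ a : α, Fin (s a) × I a => F q.1 (.weak q.2.1 q.2.2)))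
    (h3 : PolyMap (fun q : Σ a : α, Fin (s a) × Lit (V a) => F q.1 (.lit q.2.1 q.2.2)))
    (h4 : PolyMap (fun q : Σ a : α, Fin (s a) × V a => F q.1 (.res q.2.1 q.2.2)))
    (h5 : PolyMap (fun q : Σ a : α, Σ B : Fin (s a), Fin B => F q.1 (.lp q.2.1 q.2.2)))
    (h6 : PolyMap (fun q : Σ a : α, Σ B : Fin (s a), Fin B => F q.1 (.rp q.2.1 q.2.2))) :
    PolyMap f :=
  (funext h : f = _) ▸ CasesFrom.map (F := F) (
    .step (Y := fun a => Fin (s a)) (c := fun _ y => .en y) h0 (fun _ _ => rfl)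
      (fun _ x h => by cases x <;> simp [enc] at h; exact ⟨_, rfl⟩) <|
    .step (Y := fun a => Fin (s a)) (c := fun _ y => .der y) h1 (fun _ _ => rfl)
      (fun _ x h => by cases x <;> simp [enc] at h; exact ⟨_, rfl⟩) <|
    .step (Y := fun a => Fin (s a) × I a) (c := fun _ y => .weak y.1 y.2) h2 (fun _ _ => rfl)
      (fun _ x h => by cases x <;> simp [enc] at h; exact ⟨⟨_, _⟩, rfl⟩) <|
    .step (Y := fun a => Fin (s a) × Lit (V a)) (c := fun _ y => .lit y.1 y.2) h3 (fun _ _ => rfl)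
      (fun _ x h => by cases x <;> simp [enc] at h; exact ⟨⟨_, _⟩, rfl⟩) <|
    .step (Y := fun a => Fin (s a) × V a) (c := fun _ y => .res y.1 y.2) h4 (fun _ _ => rfl)
      (fun _ x h => by cases x <;> simp [enc] at h; exact ⟨⟨_, _⟩, rfl⟩) <|
    .step (Y := fun a => Σ B : Fin (s a), Fin B) (c := fun _ y => .lp y.1 y.2) h5 (fun _ _ => rfl)
      (fun _ x h => by cases x <;> simp [enc] at h; exact ⟨⟨_, _⟩, rfl⟩) <|
    .step (Y := fun a => Σ B : Fin (s a), Fin B) (c := fun _ y => .rp y.1 y.2) h6 (fun _ _ => rfl)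
      (fun _ x h => by cases x <;> simp [enc] at h; exact ⟨⟨_, _⟩, rfl⟩) <|
    .last (fun _ x => by cases x <;> simp [enc])) hx

theorem RVar.polyList {f : ∀ a, List (β a)} (x : ∀ a, RVar (V a) (I a) (s a))
    (F : ∀ a, RVar (V a) (I a) (s a) → List (β a))
    (h : ∀ a, f a = F a (x a)) [hx : PolyMap x]
    (h0 : PolyList (fun q : Σ a : α, Fin (s a) => F q.1 (.en q.2)))
    (h1 : PolyList (fun q : Σ a : α, Fin (s a) => F q.1 (.der q.2)))
    (h2 : PolyList (fun q : Σ a : α, Fin (s a) × I a => F q.1 (.weak q.2.1 q.2.2)))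
    (h3 : PolyList (fun q : Σ a : α, Fin (s a) × Lit (V a) => F q.1 (.lit q.2.1 q.2.2)))
    (h4 : PolyList (fun q : Σ a : α, Fin (s a) × V a => F q.1 (.res q.2.1 q.2.2)))
    (h5 : PolyList (fun q : Σ a : α, Σ B : Fin (s a), Fin B => F q.1 (.lp q.2.1 q.2.2)))
    (h6 : PolyList (fun q : Σ a : α, Σ B : Fin (s a), Fin B => F q.1 (.rp q.2.1 q.2.2))) :
    PolyList f :=
  have _ := hx.comp (fun q : α × ℕ => q.1) inferInstance
  (funext h : f = _) ▸ ⟨RVar.polyMap (fun q : α × ℕ => x q.1)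
    (fun q x => ((F q.1 x).length, (F q.1 x)[q.2]?)) (fun _ => rfl)
    h0.toMap h1.toMap h2.toMap h3.toMap h4.toMap h5.toMap h6.toMap⟩

end RVar

instance {V I P : Type} [Enc V] [Enc I] [Enc P] {s : ℕ} : Enc (RAx V I P s) :=
  ⟨fun
    | .left x y z w => Nat.pair 0 (enc (⟨x, y, z, w⟩ : Σ B : Fin s, Fin B × V × Lit V))
    | .right x y z w => Nat.pair 1 (enc (⟨x, y, z, w⟩ : Σ B : Fin s, Fin B × V × Lit V))
    | .weak x y z => Nat.pair 2 (enc (⟨x, y, z⟩ : Fin s × I × Lit V))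
    | .mustRes x => Nat.pair 3 (enc x)
    | .mustLeft x => Nat.pair 4 (enc x)
    | .mustRight x => Nat.pair 5 (enc x)
    | .mustWeak x => Nat.pair 6 (enc x)
    | .enLeft x y => Nat.pair 7 (enc (⟨x, y⟩ : Σ B : Fin s, Fin B))
    | .enRight x y => Nat.pair 8 (enc (⟨x, y⟩ : Σ B : Fin s, Fin B))
    | .rootEmpty x y => Nat.pair 9 (enc (⟨x, y⟩ : Fin s × Lit V))
    | .rootEn x => Nat.pair 10 (enc x)
    | .guard x y z => Nat.pair 11 (enc (⟨x, y, z⟩ : Fin s × I × Lit P)), fun a b h => by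
    cases a <;> cases b <;> simp only [Nat.pair_eq_pair, Enc.inj.eq_iff] at h <;>
      first | rfl | (obtain ⟨-, h⟩ := h; cases h; rfl) | exact absurd h.1 (by decide)⟩

section RAx

variable {α : Type} [Enc α] {V I P : α → Type} [∀ a, Enc (V a)] [∀ a, Enc (I a)] [∀ a, Enc (P a)]
  {s : α → ℕ}

instance {f : ∀ a, Fin (s a)} {g : ∀ a, Fin (f a)} {h : ∀ a, V a} {k : ∀ a, Lit (V a)}
    [hf : PolyMap f] [hg : PolyMap g] [hh : PolyMap h] [hk : PolyMap k] :
    PolyMap (fun a => (RAx.left (f a) (g a) (h a) (k a) : RAx (V a) (I a) (P a) (s a))) := by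
  obtain ⟨F, hF, eF⟩ := hf.out
  obtain ⟨G, hG, eG⟩ := hg.out
  obtain ⟨H, hH, eH⟩ := hh.out
  obtain ⟨K, hK, eK⟩ := hk.out
  exact ⟨_, (PolyTime.const 0).pair (hF.pair (hG.pair (hH.pair hK))),
    fun a => by rw [eF, eG, eH, eK]; rfl⟩

instance {f : ∀ a, Fin (s a)} {g : ∀ a, Fin (f a)} {h : ∀ a, V a} {k : ∀ a, Lit (V a)}
    [hf : PolyMap f] [hg : PolyMap g] [hh : PolyMap h] [hk : PolyMap k] :
    PolyMap (fun a => (RAx.right (f a) (g a) (h a) (k a) : RAx (V a) (I a) (P a) (s a))) := by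
  obtain ⟨F, hF, eF⟩ := hf.out
  obtain ⟨G, hG, eG⟩ := hg.out
  obtain ⟨H, hH, eH⟩ := hh.out
  obtain ⟨K, hK, eK⟩ := hk.out
  exact ⟨_, (PolyTime.const 1).pair (hF.pair (hG.pair (hH.pair hK))),
    fun a => by rw [eF, eG, eH, eK]; rfl⟩

instance {f : ∀ a, Fin (s a)} {g : ∀ a, I a} {h : ∀ a, Lit (V a)}
    [hf : PolyMap f] [hg : PolyMap g] [hh : PolyMap h] :
    PolyMap (fun a => (RAx.weak (f a) (g a) (h a) : RAx (V a) (I a) (P a) (s a))) := by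
  obtain ⟨F, hF, eF⟩ := hf.out
  obtain ⟨G, hG, eG⟩ := hg.out
  obtain ⟨H, hH, eH⟩ := hh.out
  exact ⟨_, (PolyTime.const 2).pair (hF.pair (hG.pair hH)), fun a => by rw [eF, eG, eH]; rfl⟩

instance {f : ∀ a, Fin (s a)}
    [hf : PolyMap f] :
    PolyMap (fun a => (RAx.mustRes (f a) : RAx (V a) (I a) (P a) (s a))) := by
  obtain ⟨F, hF, eF⟩ := hf.out
  exact ⟨_, (PolyTime.const 3).pair hF, fun a => by rw [eF]; rfl⟩

instance {f : ∀ a, Fin (s a)}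
    [hf : PolyMap f] :
    PolyMap (fun a => (RAx.mustLeft (f a) : RAx (V a) (I a) (P a) (s a))) := by
  obtain ⟨F, hF, eF⟩ := hf.out
  exact ⟨_, (PolyTime.const 4).pair hF, fun a => by rw [eF]; rfl⟩

instance {f : ∀ a, Fin (s a)}
    [hf : PolyMap f] :
    PolyMap (fun a => (RAx.mustRight (f a) : RAx (V a) (I a) (P a) (s a))) := by
  obtain ⟨F, hF, eF⟩ := hf.out
  exact ⟨_, (PolyTime.const 5).pair hF, fun a => by rw [eF]; rfl⟩

instance {f : ∀ a, Fin (s a)}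
    [hf : PolyMap f] :
    PolyMap (fun a => (RAx.mustWeak (f a) : RAx (V a) (I a) (P a) (s a))) := by
  obtain ⟨F, hF, eF⟩ := hf.out
  exact ⟨_, (PolyTime.const 6).pair hF, fun a => by rw [eF]; rfl⟩

instance {f : ∀ a, Fin (s a)} {g : ∀ a, Fin (f a)}
    [hf : PolyMap f] [hg : PolyMap g] :
    PolyMap (fun a => (RAx.enLeft (f a) (g a) : RAx (V a) (I a) (P a) (s a))) := by
  obtain ⟨F, hF, eF⟩ := hf.out
  obtain ⟨G, hG, eG⟩ := hg.out
  exact ⟨_, (PolyTime.const 7).pair (hF.pair hG), fun a => by rw [eF, eG]; rfl⟩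

instance {f : ∀ a, Fin (s a)} {g : ∀ a, Fin (f a)}
    [hf : PolyMap f] [hg : PolyMap g] :
    PolyMap (fun a => (RAx.enRight (f a) (g a) : RAx (V a) (I a) (P a) (s a))) := by
  obtain ⟨F, hF, eF⟩ := hf.out
  obtain ⟨G, hG, eG⟩ := hg.out
  exact ⟨_, (PolyTime.const 8).pair (hF.pair hG), fun a => by rw [eF, eG]; rfl⟩

instance {f : ∀ a, Fin (s a)} {g : ∀ a, Lit (V a)}
    [hf : PolyMap f] [hg : PolyMap g] :
    PolyMap (fun a => (RAx.rootEmpty (f a) (g a) : RAx (V a) (I a) (P a) (s a))) := by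
  obtain ⟨F, hF, eF⟩ := hf.out
  obtain ⟨G, hG, eG⟩ := hg.out
  exact ⟨_, (PolyTime.const 9).pair (hF.pair hG), fun a => by rw [eF, eG]; rfl⟩

instance {f : ∀ a, Fin (s a)}
    [hf : PolyMap f] :
    PolyMap (fun a => (RAx.rootEn (f a) : RAx (V a) (I a) (P a) (s a))) := by
  obtain ⟨F, hF, eF⟩ := hf.out
  exact ⟨_, (PolyTime.const 10).pair hF, fun a => by rw [eF]; rfl⟩

instance {f : ∀ a, Fin (s a)} {g : ∀ a, I a} {h : ∀ a, Lit (P a)}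
    [hf : PolyMap f] [hg : PolyMap g] [hh : PolyMap h] :
    PolyMap (fun a => (RAx.guard (f a) (g a) (h a) : RAx (V a) (I a) (P a) (s a))) := by
  obtain ⟨F, hF, eF⟩ := hf.out
  obtain ⟨G, hG, eG⟩ := hg.out
  obtain ⟨H, hH, eH⟩ := hh.out
  exact ⟨_, (PolyTime.const 11).pair (hF.pair (hG.pair hH)), fun a => by rw [eF, eG, eH]; rfl⟩

variable {β : α → Type} [∀ a, Enc (β a)]

theorem RAx.polyMap {f : ∀ a, β a} (x : ∀ a, RAx (V a) (I a) (P a) (s a))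
    (F : ∀ a, RAx (V a) (I a) (P a) (s a) → β a)
    (h : ∀ a, f a = F a (x a)) [hx : PolyMap x]
    (h0 : PolyMap (fun q : Σ a : α, Σ B : Fin (s a), Fin B × V a × Lit (V a) =>
      F q.1 (.left q.2.1 q.2.2.1 q.2.2.2.1 q.2.2.2.2)))
    (h1 : PolyMap (fun q : Σ a : α, Σ B : Fin (s a), Fin B × V a × Lit (V a) =>
      F q.1 (.right q.2.1 q.2.2.1 q.2.2.2.1 q.2.2.2.2)))
    (h2 : PolyMap (fun q : Σ a : α, Fin (s a) × I a × Lit (V a) =>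
      F q.1 (.weak q.2.1 q.2.2.1 q.2.2.2)))
    (h3 : PolyMap (fun q : Σ a : α, Fin (s a) => F q.1 (.mustRes q.2)))
    (h4 : PolyMap (fun q : Σ a : α, Fin (s a) => F q.1 (.mustLeft q.2)))
    (h5 : PolyMap (fun q : Σ a : α, Fin (s a) => F q.1 (.mustRight q.2)))
    (h6 : PolyMap (fun q : Σ a : α, Fin (s a) => F q.1 (.mustWeak q.2)))
    (h7 : PolyMap (fun q : Σ a : α, Σ B : Fin (s a), Fin B => F q.1 (.enLeft q.2.1 q.2.2)))
    (h8 : PolyMap (fun q : Σ a : α, Σ B : Fin (s a), Fin B => F q.1 (.enRight q.2.1 q.2.2)))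
    (h9 : PolyMap (fun q : Σ a : α, Fin (s a) × Lit (V a) => F q.1 (.rootEmpty q.2.1 q.2.2)))
    (h10 : PolyMap (fun q : Σ a : α, Fin (s a) => F q.1 (.rootEn q.2)))
    (h11 : PolyMap (fun q : Σ a : α, Fin (s a) × I a × Lit (P a) =>
      F q.1 (.guard q.2.1 q.2.2.1 q.2.2.2))) :
    PolyMap f :=
  (funext h : f = _) ▸ CasesFrom.map (F := F) (
    .step (Y := fun a => Σ B : Fin (s a), Fin B × V a × Lit (V a))
      (c := fun _ y => .left y.1 y.2.1 y.2.2.1 y.2.2.2) h0 (fun _ _ => rfl)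
      (fun _ x h => by cases x <;> simp [enc] at h; exact ⟨⟨_, _, _, _⟩, rfl⟩) <|
    .step (Y := fun a => Σ B : Fin (s a), Fin B × V a × Lit (V a))
      (c := fun _ y => .right y.1 y.2.1 y.2.2.1 y.2.2.2) h1 (fun _ _ => rfl)
      (fun _ x h => by cases x <;> simp [enc] at h; exact ⟨⟨_, _, _, _⟩, rfl⟩) <|
    .step (Y := fun a => Fin (s a) × I a × Lit (V a))
      (c := fun _ y => .weak y.1 y.2.1 y.2.2) h2 (fun _ _ => rfl)
      (fun _ x h => by cases x <;> simp [enc] at h; exact ⟨⟨_, _, _⟩, rfl⟩) <|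
    .step (Y := fun a => Fin (s a)) (c := fun _ y => .mustRes y) h3 (fun _ _ => rfl)
      (fun _ x h => by cases x <;> simp [enc] at h; exact ⟨_, rfl⟩) <|
    .step (Y := fun a => Fin (s a)) (c := fun _ y => .mustLeft y) h4 (fun _ _ => rfl)
      (fun _ x h => by cases x <;> simp [enc] at h; exact ⟨_, rfl⟩) <|
    .step (Y := fun a => Fin (s a)) (c := fun _ y => .mustRight y) h5 (fun _ _ => rfl)
      (fun _ x h => by cases x <;> simp [enc] at h; exact ⟨_, rfl⟩) <|
    .step (Y := fun a => Fin (s a)) (c := fun _ y => .mustWeak y) h6 (fun _ _ => rfl)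
      (fun _ x h => by cases x <;> simp [enc] at h; exact ⟨_, rfl⟩) <|
    .step (Y := fun a => Σ B : Fin (s a), Fin B)
      (c := fun _ y => .enLeft y.1 y.2) h7 (fun _ _ => rfl)
      (fun _ x h => by cases x <;> simp [enc] at h; exact ⟨⟨_, _⟩, rfl⟩) <|
    .step (Y := fun a => Σ B : Fin (s a), Fin B)
      (c := fun _ y => .enRight y.1 y.2) h8 (fun _ _ => rfl)
      (fun _ x h => by cases x <;> simp [enc] at h; exact ⟨⟨_, _⟩, rfl⟩) <|
    .step (Y := fun a => Fin (s a) × Lit (V a))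
      (c := fun _ y => .rootEmpty y.1 y.2) h9 (fun _ _ => rfl)
      (fun _ x h => by cases x <;> simp [enc] at h; exact ⟨⟨_, _⟩, rfl⟩) <|
    .step (Y := fun a => Fin (s a)) (c := fun _ y => .rootEn y) h10 (fun _ _ => rfl)
      (fun _ x h => by cases x <;> simp [enc] at h; exact ⟨_, rfl⟩) <|
    .step (Y := fun a => Fin (s a) × I a × Lit (P a))
      (c := fun _ y => .guard y.1 y.2.1 y.2.2) h11 (fun _ _ => rfl)
      (fun _ x h => by cases x <;> simp [enc] at h; exact ⟨⟨_, _, _⟩, rfl⟩) <|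
    .last (fun _ x => by cases x <;> simp [enc])) hx

theorem RAx.polyList {f : ∀ a, List (β a)} (x : ∀ a, RAx (V a) (I a) (P a) (s a))
    (F : ∀ a, RAx (V a) (I a) (P a) (s a) → List (β a))
    (h : ∀ a, f a = F a (x a)) [hx : PolyMap x]
    (h0 : PolyList (fun q : Σ a : α, Σ B : Fin (s a), Fin B × V a × Lit (V a) =>
      F q.1 (.left q.2.1 q.2.2.1 q.2.2.2.1 q.2.2.2.2)))
    (h1 : PolyList (fun q : Σ a : α, Σ B : Fin (s a), Fin B × V a × Lit (V a) =>
      F q.1 (.right q.2.1 q.2.2.1 q.2.2.2.1 q.2.2.2.2)))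
    (h2 : PolyList (fun q : Σ a : α, Fin (s a) × I a × Lit (V a) =>
      F q.1 (.weak q.2.1 q.2.2.1 q.2.2.2)))
    (h3 : PolyList (fun q : Σ a : α, Fin (s a) => F q.1 (.mustRes q.2)))
    (h4 : PolyList (fun q : Σ a : α, Fin (s a) => F q.1 (.mustLeft q.2)))
    (h5 : PolyList (fun q : Σ a : α, Fin (s a) => F q.1 (.mustRight q.2)))
    (h6 : PolyList (fun q : Σ a : α, Fin (s a) => F q.1 (.mustWeak q.2)))
    (h7 : PolyList (fun q : Σ a : α, Σ B : Fin (s a), Fin B => F q.1 (.enLeft q.2.1 q.2.2)))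
    (h8 : PolyList (fun q : Σ a : α, Σ B : Fin (s a), Fin B => F q.1 (.enRight q.2.1 q.2.2)))
    (h9 : PolyList (fun q : Σ a : α, Fin (s a) × Lit (V a) => F q.1 (.rootEmpty q.2.1 q.2.2)))
    (h10 : PolyList (fun q : Σ a : α, Fin (s a) => F q.1 (.rootEn q.2)))
    (h11 : PolyList (fun q : Σ a : α, Fin (s a) × I a × Lit (P a) =>
      F q.1 (.guard q.2.1 q.2.2.1 q.2.2.2))) :
    PolyList f :=
  have _ := hx.comp (fun q : α × ℕ => q.1) inferInstance
  (funext h : f = _) ▸ ⟨RAx.polyMap (fun q : α × ℕ => x q.1)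
    (fun q x => ((F q.1 x).length, (F q.1 x)[q.2]?)) (fun _ => rfl)
    h0.toMap h1.toMap h2.toMap h3.toMap h4.toMap h5.toMap h6.toMap
    h7.toMap h8.toMap h9.toMap h10.toMap h11.toMap⟩

end RAx

instance {X : Type} [Enc X] : Enc (Gate X) :=
  ⟨fun
    | .const x => Nat.pair 0 (enc x)
    | .lit x => Nat.pair 1 (enc x)
    | .and x y => Nat.pair 2 (enc (⟨x, y⟩ : Lit X × Lit X)), fun a b h => by
    cases a <;> cases b <;> simp only [Nat.pair_eq_pair, Enc.inj.eq_iff] at h <;>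
      first | rfl | (obtain ⟨-, h⟩ := h; cases h; rfl) | exact absurd h.1 (by decide)⟩

section Gate

variable {α : Type} [Enc α] {X : α → Type} [∀ a, Enc (X a)]

instance {f : α → Bool}
    [hf : PolyMap f] :
    PolyMap (fun a => (Gate.const (f a) : Gate (X a))) := by
  obtain ⟨F, hF, eF⟩ := hf.out
  exact ⟨_, (PolyTime.const 0).pair hF, fun a => by rw [eF]; rfl⟩

instance {f : ∀ a, Lit (X a)}
    [hf : PolyMap f] :
    PolyMap (fun a => (Gate.lit (f a) : Gate (X a))) := by
  obtain ⟨F, hF, eF⟩ := hf.out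
  exact ⟨_, (PolyTime.const 1).pair hF, fun a => by rw [eF]; rfl⟩

instance {f : ∀ a, Lit (X a)} {g : ∀ a, Lit (X a)}
    [hf : PolyMap f] [hg : PolyMap g] :
    PolyMap (fun a => (Gate.and (f a) (g a) : Gate (X a))) := by
  obtain ⟨F, hF, eF⟩ := hf.out
  obtain ⟨G, hG, eG⟩ := hg.out
  exact ⟨_, (PolyTime.const 2).pair (hF.pair hG), fun a => by rw [eF, eG]; rfl⟩

variable {β : α → Type} [∀ a, Enc (β a)]

theorem Gate.polyMap {f : ∀ a, β a} (x : ∀ a, Gate (X a)) (F : ∀ a, Gate (X a) → β a)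
    (h : ∀ a, f a = F a (x a)) [hx : PolyMap x]
    (h0 : PolyMap (fun q : Σ _ : α, Bool => F q.1 (.const q.2)))
    (h1 : PolyMap (fun q : Σ a : α, Lit (X a) => F q.1 (.lit q.2)))
    (h2 : PolyMap (fun q : Σ a : α, Lit (X a) × Lit (X a) => F q.1 (.and q.2.1 q.2.2))) :
    PolyMap f :=
  (funext h : f = _) ▸ CasesFrom.map (F := F) (
    .step (Y := fun _ => Bool) (c := fun _ y => .const y) h0 (fun _ _ => rfl)
      (fun _ x h => by cases x <;> simp [enc] at h; exact ⟨_, rfl⟩) <|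
    .step (Y := fun a => Lit (X a)) (c := fun _ y => .lit y) h1 (fun _ _ => rfl)
      (fun _ x h => by cases x <;> simp [enc] at h; exact ⟨_, rfl⟩) <|
    .step (Y := fun a => Lit (X a) × Lit (X a)) (c := fun _ y => .and y.1 y.2) h2 (fun _ _ => rfl)
      (fun _ x h => by cases x <;> simp [enc] at h; exact ⟨⟨_, _⟩, rfl⟩) <|
    .last (fun _ x => by cases x <;> simp [enc])) hx

theorem Gate.polyList {f : ∀ a, List (β a)} (x : ∀ a, Gate (X a)) (F : ∀ a, Gate (X a) → List (β a))
    (h : ∀ a, f a = F a (x a)) [hx : PolyMap x]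
    (h0 : PolyList (fun q : Σ _ : α, Bool => F q.1 (.const q.2)))
    (h1 : PolyList (fun q : Σ a : α, Lit (X a) => F q.1 (.lit q.2)))
    (h2 : PolyList (fun q : Σ a : α, Lit (X a) × Lit (X a) => F q.1 (.and q.2.1 q.2.2))) :
    PolyList f :=
  have _ := hx.comp (fun q : α × ℕ => q.1) inferInstance
  (funext h : f = _) ▸ ⟨Gate.polyMap (fun q : α × ℕ => x q.1)
    (fun q x => ((F q.1 x).length, (F q.1 x)[q.2]?)) (fun _ => rfl)
    h0.toMap h1.toMap h2.toMap⟩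

end Gate

instance {n : ℕ} : Enc (Line n) :=
  ⟨fun
    | .l1 x y => Nat.pair 0 (enc (⟨x, y⟩ : ℕ × ℕ))
    | .l2 x y => Nat.pair 1 (enc (⟨x, y⟩ : ℕ × ℕ))
    | .mear x y z w => Nat.pair 2 (enc (⟨x, y, z, w⟩ : ℕ × ℕ × Fin n × Fin n))
    | .r1 x y z w => Nat.pair 3 (enc (⟨x, y, z, w⟩ : ℕ × ℕ × Fin n × Fin n))
    | .mel x y z => Nat.pair 4 (enc (⟨x, y, z⟩ : ℕ × ℕ × Fin n))
    | .r2 x y z => Nat.pair 5 (enc (⟨x, y, z⟩ : ℕ × ℕ × Fin n))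
    | .r3 x y z => Nat.pair 6 (enc (⟨x, y, z⟩ : ℕ × Fin n × ℕ))
    | .r4 x y => Nat.pair 7 (enc (⟨x, y⟩ : ℕ × ℕ))
    | .tr x => Nat.pair 8 (enc x)
    | .rootEn => Nat.pair 9 (enc ())
    | .re x => Nat.pair 10 (enc x)
    | .fin x => Nat.pair 11 (enc x), fun a b h => by
    cases a <;> cases b <;> simp only [Nat.pair_eq_pair, Enc.inj.eq_iff] at h <;>
      first | rfl | (obtain ⟨-, h⟩ := h; cases h; rfl) | exact absurd h.1 (by decide)⟩

section Line

variable {α : Type} [Enc α] {n : α → ℕ}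

instance {f : α → ℕ} {g : α → ℕ}
    [hf : PolyMap f] [hg : PolyMap g] :
    PolyMap (fun a => (Line.l1 (f a) (g a) : Line (n a))) := by
  obtain ⟨F, hF, eF⟩ := hf.out
  obtain ⟨G, hG, eG⟩ := hg.out
  exact ⟨_, (PolyTime.const 0).pair (hF.pair hG), fun a => by rw [eF, eG]; rfl⟩

instance {f : α → ℕ} {g : α → ℕ}
    [hf : PolyMap f] [hg : PolyMap g] :
    PolyMap (fun a => (Line.l2 (f a) (g a) : Line (n a))) := by
  obtain ⟨F, hF, eF⟩ := hf.out
  obtain ⟨G, hG, eG⟩ := hg.out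
  exact ⟨_, (PolyTime.const 1).pair (hF.pair hG), fun a => by rw [eF, eG]; rfl⟩

instance {f : α → ℕ} {g : α → ℕ} {h : ∀ a, Fin (n a)} {k : ∀ a, Fin (n a)}
    [hf : PolyMap f] [hg : PolyMap g] [hh : PolyMap h] [hk : PolyMap k] :
    PolyMap (fun a => (Line.mear (f a) (g a) (h a) (k a) : Line (n a))) := by
  obtain ⟨F, hF, eF⟩ := hf.out
  obtain ⟨G, hG, eG⟩ := hg.out
  obtain ⟨H, hH, eH⟩ := hh.out
  obtain ⟨K, hK, eK⟩ := hk.out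
  exact ⟨_, (PolyTime.const 2).pair (hF.pair (hG.pair (hH.pair hK))),
    fun a => by rw [eF, eG, eH, eK]; rfl⟩

instance {f : α → ℕ} {g : α → ℕ} {h : ∀ a, Fin (n a)} {k : ∀ a, Fin (n a)}
    [hf : PolyMap f] [hg : PolyMap g] [hh : PolyMap h] [hk : PolyMap k] :
    PolyMap (fun a => (Line.r1 (f a) (g a) (h a) (k a) : Line (n a))) := by
  obtain ⟨F, hF, eF⟩ := hf.out
  obtain ⟨G, hG, eG⟩ := hg.out
  obtain ⟨H, hH, eH⟩ := hh.out
  obtain ⟨K, hK, eK⟩ := hk.out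
  exact ⟨_, (PolyTime.const 3).pair (hF.pair (hG.pair (hH.pair hK))),
    fun a => by rw [eF, eG, eH, eK]; rfl⟩

instance {f : α → ℕ} {g : α → ℕ} {h : ∀ a, Fin (n a)}
    [hf : PolyMap f] [hg : PolyMap g] [hh : PolyMap h] :
    PolyMap (fun a => (Line.mel (f a) (g a) (h a) : Line (n a))) := by
  obtain ⟨F, hF, eF⟩ := hf.out
  obtain ⟨G, hG, eG⟩ := hg.out
  obtain ⟨H, hH, eH⟩ := hh.out
  exact ⟨_, (PolyTime.const 4).pair (hF.pair (hG.pair hH)), fun a => by rw [eF, eG, eH]; rfl⟩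

instance {f : α → ℕ} {g : α → ℕ} {h : ∀ a, Fin (n a)}
    [hf : PolyMap f] [hg : PolyMap g] [hh : PolyMap h] :
    PolyMap (fun a => (Line.r2 (f a) (g a) (h a) : Line (n a))) := by
  obtain ⟨F, hF, eF⟩ := hf.out
  obtain ⟨G, hG, eG⟩ := hg.out
  obtain ⟨H, hH, eH⟩ := hh.out
  exact ⟨_, (PolyTime.const 5).pair (hF.pair (hG.pair hH)), fun a => by rw [eF, eG, eH]; rfl⟩

instance {f : α → ℕ} {g : ∀ a, Fin (n a)} {h : α → ℕ}
    [hf : PolyMap f] [hg : PolyMap g] [hh : PolyMap h] :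
    PolyMap (fun a => (Line.r3 (f a) (g a) (h a) : Line (n a))) := by
  obtain ⟨F, hF, eF⟩ := hf.out
  obtain ⟨G, hG, eG⟩ := hg.out
  obtain ⟨H, hH, eH⟩ := hh.out
  exact ⟨_, (PolyTime.const 6).pair (hF.pair (hG.pair hH)), fun a => by rw [eF, eG, eH]; rfl⟩

instance {f : α → ℕ} {g : α → ℕ}
    [hf : PolyMap f] [hg : PolyMap g] :
    PolyMap (fun a => (Line.r4 (f a) (g a) : Line (n a))) := by
  obtain ⟨F, hF, eF⟩ := hf.out
  obtain ⟨G, hG, eG⟩ := hg.out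
  exact ⟨_, (PolyTime.const 7).pair (hF.pair hG), fun a => by rw [eF, eG]; rfl⟩

instance {f : α → ℕ}
    [hf : PolyMap f] :
    PolyMap (fun a => (Line.tr (f a) : Line (n a))) := by
  obtain ⟨F, hF, eF⟩ := hf.out
  exact ⟨_, (PolyTime.const 8).pair hF, fun a => by rw [eF]; rfl⟩

instance : PolyMap (fun a => (Line.rootEn : Line (n a))) :=
  ⟨_, PolyTime.const _, fun _ => rfl⟩

instance {f : ∀ a, Fin (n a)}
    [hf : PolyMap f] :
    PolyMap (fun a => (Line.re (f a) : Line (n a))) := by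
  obtain ⟨F, hF, eF⟩ := hf.out
  exact ⟨_, (PolyTime.const 10).pair hF, fun a => by rw [eF]; rfl⟩

instance {f : α → ℕ}
    [hf : PolyMap f] :
    PolyMap (fun a => (Line.fin (f a) : Line (n a))) := by
  obtain ⟨F, hF, eF⟩ := hf.out
  exact ⟨_, (PolyTime.const 11).pair hF, fun a => by rw [eF]; rfl⟩

variable {β : α → Type} [∀ a, Enc (β a)]

theorem Line.polyMap {f : ∀ a, β a} (x : ∀ a, Line (n a)) (F : ∀ a, Line (n a) → β a)
    (h : ∀ a, f a = F a (x a)) [hx : PolyMap x]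
    (h0 : PolyMap (fun q : Σ _ : α, ℕ × ℕ => F q.1 (.l1 q.2.1 q.2.2)))
    (h1 : PolyMap (fun q : Σ _ : α, ℕ × ℕ => F q.1 (.l2 q.2.1 q.2.2)))
    (h2 : PolyMap (fun q : Σ a : α, ℕ × ℕ × Fin (n a) × Fin (n a) =>
      F q.1 (.mear q.2.1 q.2.2.1 q.2.2.2.1 q.2.2.2.2)))
    (h3 : PolyMap (fun q : Σ a : α, ℕ × ℕ × Fin (n a) × Fin (n a) =>
      F q.1 (.r1 q.2.1 q.2.2.1 q.2.2.2.1 q.2.2.2.2)))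
    (h4 : PolyMap (fun q : Σ a : α, ℕ × ℕ × Fin (n a) => F q.1 (.mel q.2.1 q.2.2.1 q.2.2.2)))
    (h5 : PolyMap (fun q : Σ a : α, ℕ × ℕ × Fin (n a) => F q.1 (.r2 q.2.1 q.2.2.1 q.2.2.2)))
    (h6 : PolyMap (fun q : Σ a : α, ℕ × Fin (n a) × ℕ => F q.1 (.r3 q.2.1 q.2.2.1 q.2.2.2)))
    (h7 : PolyMap (fun q : Σ _ : α, ℕ × ℕ => F q.1 (.r4 q.2.1 q.2.2)))
    (h8 : PolyMap (fun q : Σ _ : α, ℕ => F q.1 (.tr q.2)))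
    (h9 : PolyMap (fun q : Σ _ : α, Unit => F q.1 .rootEn))
    (h10 : PolyMap (fun q : Σ a : α, Fin (n a) => F q.1 (.re q.2)))
    (h11 : PolyMap (fun q : Σ _ : α, ℕ => F q.1 (.fin q.2))) :
    PolyMap f :=
  (funext h : f = _) ▸ CasesFrom.map (F := F) (
    .step (Y := fun _ => ℕ × ℕ) (c := fun _ y => .l1 y.1 y.2) h0 (fun _ _ => rfl)
      (fun _ x h => by cases x <;> simp [enc] at h; exact ⟨⟨_, _⟩, rfl⟩) <|
    .step (Y := fun _ => ℕ × ℕ) (c := fun _ y => .l2 y.1 y.2) h1 (fun _ _ => rfl)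
      (fun _ x h => by cases x <;> simp [enc] at h; exact ⟨⟨_, _⟩, rfl⟩) <|
    .step (Y := fun a => ℕ × ℕ × Fin (n a) × Fin (n a))
      (c := fun _ y => .mear y.1 y.2.1 y.2.2.1 y.2.2.2) h2 (fun _ _ => rfl)
      (fun _ x h => by cases x <;> simp [enc] at h; exact ⟨⟨_, _, _, _⟩, rfl⟩) <|
    .step (Y := fun a => ℕ × ℕ × Fin (n a) × Fin (n a))
      (c := fun _ y => .r1 y.1 y.2.1 y.2.2.1 y.2.2.2) h3 (fun _ _ => rfl)
      (fun _ x h => by cases x <;> simp [enc] at h; exact ⟨⟨_, _, _, _⟩, rfl⟩) <|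
    .step (Y := fun a => ℕ × ℕ × Fin (n a))
      (c := fun _ y => .mel y.1 y.2.1 y.2.2) h4 (fun _ _ => rfl)
      (fun _ x h => by cases x <;> simp [enc] at h; exact ⟨⟨_, _, _⟩, rfl⟩) <|
    .step (Y := fun a => ℕ × ℕ × Fin (n a))
      (c := fun _ y => .r2 y.1 y.2.1 y.2.2) h5 (fun _ _ => rfl)
      (fun _ x h => by cases x <;> simp [enc] at h; exact ⟨⟨_, _, _⟩, rfl⟩) <|
    .step (Y := fun a => ℕ × Fin (n a) × ℕ)
      (c := fun _ y => .r3 y.1 y.2.1 y.2.2) h6 (fun _ _ => rfl)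
      (fun _ x h => by cases x <;> simp [enc] at h; exact ⟨⟨_, _, _⟩, rfl⟩) <|
    .step (Y := fun _ => ℕ × ℕ) (c := fun _ y => .r4 y.1 y.2) h7 (fun _ _ => rfl)
      (fun _ x h => by cases x <;> simp [enc] at h; exact ⟨⟨_, _⟩, rfl⟩) <|
    .step (Y := fun _ => ℕ) (c := fun _ y => .tr y) h8 (fun _ _ => rfl)
      (fun _ x h => by cases x <;> simp [enc] at h; exact ⟨_, rfl⟩) <|
    .step (Y := fun _ => Unit) (c := fun _ _ => .rootEn) h9 (fun _ _ => rfl)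
      (fun _ x h => by cases x <;> simp [enc] at h; exact ⟨(), rfl⟩) <|
    .step (Y := fun a => Fin (n a)) (c := fun _ y => .re y) h10 (fun _ _ => rfl)
      (fun _ x h => by cases x <;> simp [enc] at h; exact ⟨_, rfl⟩) <|
    .step (Y := fun _ => ℕ) (c := fun _ y => .fin y) h11 (fun _ _ => rfl)
      (fun _ x h => by cases x <;> simp [enc] at h; exact ⟨_, rfl⟩) <|
    .last (fun _ x => by cases x <;> simp [enc])) hx

theorem Line.polyList {f : ∀ a, List (β a)} (x : ∀ a, Line (n a)) (F : ∀ a, Line (n a) → List (β a))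
    (h : ∀ a, f a = F a (x a)) [hx : PolyMap x]
    (h0 : PolyList (fun q : Σ _ : α, ℕ × ℕ => F q.1 (.l1 q.2.1 q.2.2)))
    (h1 : PolyList (fun q : Σ _ : α, ℕ × ℕ => F q.1 (.l2 q.2.1 q.2.2)))
    (h2 : PolyList (fun q : Σ a : α, ℕ × ℕ × Fin (n a) × Fin (n a) =>
      F q.1 (.mear q.2.1 q.2.2.1 q.2.2.2.1 q.2.2.2.2)))
    (h3 : PolyList (fun q : Σ a : α, ℕ × ℕ × Fin (n a) × Fin (n a) =>
      F q.1 (.r1 q.2.1 q.2.2.1 q.2.2.2.1 q.2.2.2.2)))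
    (h4 : PolyList (fun q : Σ a : α, ℕ × ℕ × Fin (n a) => F q.1 (.mel q.2.1 q.2.2.1 q.2.2.2)))
    (h5 : PolyList (fun q : Σ a : α, ℕ × ℕ × Fin (n a) => F q.1 (.r2 q.2.1 q.2.2.1 q.2.2.2)))
    (h6 : PolyList (fun q : Σ a : α, ℕ × Fin (n a) × ℕ => F q.1 (.r3 q.2.1 q.2.2.1 q.2.2.2)))
    (h7 : PolyList (fun q : Σ _ : α, ℕ × ℕ => F q.1 (.r4 q.2.1 q.2.2)))
    (h8 : PolyList (fun q : Σ _ : α, ℕ => F q.1 (.tr q.2)))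
    (h9 : PolyList (fun q : Σ _ : α, Unit => F q.1 .rootEn))
    (h10 : PolyList (fun q : Σ a : α, Fin (n a) => F q.1 (.re q.2)))
    (h11 : PolyList (fun q : Σ _ : α, ℕ => F q.1 (.fin q.2))) :
    PolyList f :=
  have _ := hx.comp (fun q : α × ℕ => q.1) inferInstance
  (funext h : f = _) ▸ ⟨Line.polyMap (fun q : α × ℕ => x q.1)
    (fun q x => ((F q.1 x).length, (F q.1 x)[q.2]?)) (fun _ => rfl)
    h0.toMap h1.toMap h2.toMap h3.toMap h4.toMap h5.toMap h6.toMap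
    h7.toMap h8.toMap h9.toMap h10.toMap h11.toMap⟩

end Line

section Option

variable {α : Type} [Enc α] {V : α → Type} [∀ a, Enc (V a)]

variable {β : α → Type} [∀ a, Enc (β a)]

theorem Option.polyMap {f : ∀ a, β a} (x : ∀ a, Option (V a)) (F : ∀ a, Option (V a) → β a)
    (h : ∀ a, f a = F a (x a)) [hx : PolyMap x]
    (h0 : PolyMap (fun q : Σ _ : α, Unit => F q.1 .none))
    (h1 : PolyMap (fun q : Σ a : α, V a => F q.1 (.some q.2))) :
    PolyMap f :=
  (funext h : f = _) ▸ CasesFrom.map (F := F) (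
    .step (Y := fun _ => Unit) (c := fun _ _ => .none) h0 (fun _ _ => rfl)
      (fun _ x h => by cases x <;> simp [enc] at h; exact ⟨(), rfl⟩) <|
    .step (Y := fun a => V a) (c := fun _ y => .some y) h1 (fun _ _ => rfl)
      (fun _ x h => by cases x <;> simp [enc] at h; exact ⟨_, rfl⟩) <|
    .last (fun _ x => by cases x <;> simp [enc])) hx

theorem Option.polyList {f : ∀ a, List (β a)} (x : ∀ a, Option (V a))
    (F : ∀ a, Option (V a) → List (β a))
    (h : ∀ a, f a = F a (x a)) [hx : PolyMap x]
    (h0 : PolyList (fun q : Σ _ : α, Unit => F q.1 .none))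
    (h1 : PolyList (fun q : Σ a : α, V a => F q.1 (.some q.2))) :
    PolyList f :=
  have _ := hx.comp (fun q : α × ℕ => q.1) inferInstance
  (funext h : f = _) ▸ ⟨Option.polyMap (fun q : α × ℕ => x q.1)
    (fun q x => ((F q.1 x).length, (F q.1 x)[q.2]?)) (fun _ => rfl)
    h0.toMap h1.toMap⟩

end Option

section Sum

variable {α : Type} [Enc α] {V I : α → Type} [∀ a, Enc (V a)] [∀ a, Enc (I a)]

variable {β : α → Type} [∀ a, Enc (β a)]

theorem Sum.polyMap {f : ∀ a, β a} (x : ∀ a, V a ⊕ I a) (F : ∀ a, V a ⊕ I a → β a)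
    (h : ∀ a, f a = F a (x a)) [hx : PolyMap x]
    (h0 : PolyMap (fun q : Σ a : α, V a => F q.1 (.inl q.2)))
    (h1 : PolyMap (fun q : Σ a : α, I a => F q.1 (.inr q.2))) :
    PolyMap f :=
  (funext h : f = _) ▸ CasesFrom.map (F := F) (
    .step (Y := fun a => V a) (c := fun _ y => .inl y) h0 (fun _ _ => rfl)
      (fun _ x h => by cases x <;> simp [enc] at h; exact ⟨_, rfl⟩) <|
    .step (Y := fun a => I a) (c := fun _ y => .inr y) h1 (fun _ _ => rfl)
      (fun _ x h => by cases x <;> simp [enc] at h; exact ⟨_, rfl⟩) <|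
    .last (fun _ x => by cases x <;> simp [enc])) hx

theorem Sum.polyList {f : ∀ a, List (β a)} (x : ∀ a, V a ⊕ I a) (F : ∀ a, V a ⊕ I a → List (β a))
    (h : ∀ a, f a = F a (x a)) [hx : PolyMap x]
    (h0 : PolyList (fun q : Σ a : α, V a => F q.1 (.inl q.2)))
    (h1 : PolyList (fun q : Σ a : α, I a => F q.1 (.inr q.2))) :
    PolyList f :=
  have _ := hx.comp (fun q : α × ℕ => q.1) inferInstance
  (funext h : f = _) ▸ ⟨Sum.polyMap (fun q : α × ℕ => x q.1)
    (fun q x => ((F q.1 x).length, (F q.1 x)[q.2]?)) (fun _ => rfl)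
    h0.toMap h1.toMap⟩

end Sum

/-! ### Enumerations of variables and clauses -/

/-- All literals over the variables `vs`. -/
def allLit {V : Type} (vs : List V) : List (Lit V) := vs.flatMap (fun v => [.pos v, .neg v])

/-- All variables of `Sat(φ, α)`. -/
def allSVar (n m : ℕ) : List (SVar n m) :=
  (List.finRange n).map .alpha ++ (List.finRange m).flatMap (fun A =>
    (allLit (List.finRange n)).flatMap (fun l => [.alit A l, .sat A l]))

section Lists

variable {V I P : Type} (s : ℕ) (vs : List V) (is : List I) (ps : List P)

/-- All variables of `Ref_s(ψ)`, for `ψ` with variables `vs` and clauses `is`. -/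
def allRVar : List (RVar V I s) :=
  (List.finRange s).flatMap (fun (B : Fin s) =>
    [.en B, .der B] ++ is.map (fun A => .weak B A) ++ (allLit vs).map (fun l => .lit B l) ++
      vs.map (fun x => .res B x) ++
      (List.finRange B.val).flatMap (fun C => [.lp B C, .rp B C]))

/-- All labels of clauses of `Ref_s(ψ)`, for `ψ` with variables `vs`, clauses `is` and parameters
`ps`. -/
def allRAx : List (RAx V I P s) :=
  (List.finRange s).flatMap (fun (B : Fin s) =>
    [.mustRes B, .mustLeft B, .mustRight B, .mustWeak B, .rootEn B] ++
      (List.finRange B.val).flatMap (fun C => [.enLeft B C, .enRight B C] ++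
        vs.flatMap (fun x => (allLit vs).flatMap (fun l => [.left B C x l, .right B C x l]))) ++
      (allLit vs).map (fun l => .rootEmpty B l) ++
      is.flatMap (fun A => (allLit vs).map (fun l => .weak B A l) ++
        (allLit ps).map (fun g => .guard B A g)))

variable [DecidableEq V] [DecidableEq I] [DecidableEq P] (ψ : PCNF V I P)

/-- All clauses of `Ref_s(ψ)`. -/
def allRefIdx : List (RefIdx ψ s) :=
  (allRAx s vs is ps).flatMap (fun a => if h : refOk ψ s a = true then [⟨a, h⟩] else [])

/-- The parameters in a condition, negated. -/
def Cond.negLits {P : Type} : Cond P → List (Lit P)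
  | .var p => [.neg p]
  | _ => []

/-- The literals of a clause of `Ref_s(ψ)`, for `ψ` with variables `vs` and clauses `is`. -/
def refClauseList : RAx V I P s → List (Lit (RVar V I s ⊕ P))
  | .left B C x l => [.neg (.inl (.en B)), .neg (.inl (.res B x)), .neg (.inl (.lp B C)),
      .neg (.inl (.lit (earlier B C) l)), .pos (.inl (.lit B l))]
  | .right B C x l => [.neg (.inl (.en B)), .neg (.inl (.res B x)), .neg (.inl (.rp B C)),
      .neg (.inl (.lit (earlier B C) l)), .pos (.inl (.lit B l))]
  | .weak B A l => [.neg (.inl (.en B)), .neg (.inl (.weak B A)), .pos (.inl (.lit B l))] ++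
      (ψ.mem A l).negLits.map (fun l => l.map .inr)
  | .mustRes B => [.neg (.inl (.en B)), .neg (.inl (.der B))] ++
      vs.map (fun x => .pos (.inl (.res B x)))
  | .mustLeft B => [.neg (.inl (.en B)), .neg (.inl (.der B))] ++
      (List.finRange B.val).map (fun C => .pos (.inl (.lp B C)))
  | .mustRight B => [.neg (.inl (.en B)), .neg (.inl (.der B))] ++
      (List.finRange B.val).map (fun C => .pos (.inl (.rp B C)))
  | .mustWeak B => [.neg (.inl (.en B)), .pos (.inl (.der B))] ++
      is.map (fun A => .pos (.inl (.weak B A)))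
  | .enLeft B C => [.neg (.inl (.en B)), .neg (.inl (.lp B C)), .pos (.inl (.en (earlier B C)))]
  | .enRight B C => [.neg (.inl (.en B)), .neg (.inl (.rp B C)), .pos (.inl (.en (earlier B C)))]
  | .rootEmpty B l => [.neg (.inl (.lit B l))]
  | .rootEn B => [.pos (.inl (.en B))]
  | .guard B A g => [.neg (.inl (.en B)), .neg (.inl (.weak B A)), g.map .inr]

end Lists

section MainLists

variable (n m s t : ℕ)

/-- All variables of `Ref_s(φ)`. -/
def inVars : List (InVar n m s) := allRVar s (List.finRange n) (List.finRange m)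

/-- All clauses of `Ref_s(φ)`. -/
def inIdxs : List (InIdx n m s) :=
  allRefIdx s (List.finRange n) (List.finRange m) (allSVar n m) (phi n m)

/-- All variables of `Ref_t(Ref_s(φ), π)`. -/
def outVars : List (OutVar n m s t) := allRVar t (inVars n m s) (inIdxs n m s)

/-- All clauses of `Ref_t(Ref_s(φ), π)`. -/
def outIdxs : List (OutIdx n m s t) :=
  allRefIdx t (inVars n m s) (inIdxs n m s) (allSVar n m) (refPhi n m s)

variable {n m s t}

/-- The literals of a clause of `Ref_s(φ)`. -/
def inClause (c : InIdx n m s) : List (Lit (InVar n m s ⊕ SVar n m)) :=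
  refClauseList s (List.finRange n) (List.finRange m) (phi n m) c.1

/-- The literals of a clause of `Ref_t(Ref_s(φ), π)`. -/
def outClause (c : OutIdx n m s t) : List (Lit (OutVar n m s t ⊕ SVar n m)) :=
  refClauseList t (inVars n m s) (inIdxs n m s) (refPhi n m s) c.1

/-! ### The refutation -/

/-- The gate computing a variable of `Ref_t(Ref_s(φ), π)` from `φ` and `α`. -/
def outGate : OutVar n m s t ⊕ SVar n m → Gate (SVar n m)
  | .inl z => pudlak n m s t z
  | .inr x => .lit (.pos x)

/-- The variables that a gate depends on. -/
def Gate.vars {X : Type} : Gate X → List X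
  | .const _ => []
  | .lit l => [l.var]
  | .and l l' => [l.var, l'.var]

/-- The clauses expressing `z ↔ g`, as lists. -/
def Gate.clauseList {X Y : Type} (z : Y) : Gate X → List (List (Lit (Y ⊕ X)))
  | .const b => if b = true then [[.pos (.inl z)]] else [[.neg (.inl z)]]
  | .lit l => [[.neg (.inl z), l.map .inr], [.pos (.inl z), (l.map .inr).compl]]
  | .and l l' => [[.neg (.inl z), l.map .inr], [.neg (.inl z), l'.map .inr],
      [.pos (.inl z), (l.map .inr).compl, (l'.map .inr).compl]]

/-- The clauses of the main formula expressing `z ↔ g`. -/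
def gateLines (z : OutVar n m s t) (g : Gate (SVar n m)) : List (List (Lit (MainVar n m s t))) :=
  (g.clauseList z).map (fun D => D.map (fun l => l.map .inl))

/-- The literals in `r` make the gate true. -/
def Gate.forcesTrue {X : Type} [DecidableEq X] (r : List (Option (Lit X))) : Gate X → Bool
  | .const b => b
  | .lit l => some l ∈ r
  | .and l l' => some l ∈ r ∧ some l' ∈ r

/-- The literals in `r` make the gate false. -/
def Gate.forcesFalse {X : Type} [DecidableEq X] (r : List (Option (Lit X))) : Gate X → Bool
  | .const b => b = false
  | .lit l => some l.compl ∈ r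
  | .and l l' => some l.compl ∈ r ∨ some l'.compl ∈ r

/-- The literals in `r` make the literal over the outputs of the circuit true. -/
def forces (r : List (Option (Lit (SVar n m)))) : Lit (OutVar n m s t ⊕ SVar n m) → Bool
  | .pos w => (outGate w).forcesTrue r
  | .neg w => (outGate w).forcesFalse r

/-- The premises of a line on a variable of `Ref_s(φ)` or the axiom it comes from depend on the
values of at most two variables. -/
def Line.branchVars : Line n → List (SVar n m)
  | .mear _ _ i j => [.alpha i, .alpha j]
  | .r1 _ _ _ j => [.alpha j]
  | .mel _ _ i => [.alpha i]
  | .r3 _ i _ => [.alpha i]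
  | .re j => [.alpha j]
  | .fin j => ((List.finRange n)[j - 1]?).toList.map .alpha
  | _ => []

/-- The block `B` in the clauses `mustRes B` and `mustWeak B`, which may be long. -/
def RAx.longBlock {V I P : Type} {s : ℕ} : RAx V I P s → Option (Fin s)
  | .mustRes B => some B
  | .mustWeak B => some B
  | _ => none

/-- The block `B` in the clause `mustWeak B`. -/
def RAx.weakBlock {V I P : Type} {s : ℕ} : RAx V I P s → Option (Fin s)
  | .mustWeak B => some B
  | _ => none

/-- At most three variables whose values determine a true literal in the clause `c` of
`Ref_t(Ref_s(φ), π)`. -/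
def branchVars (c : OutIdx n m s t) : List (SVar n m) :=
  c.1.longBlock.elim ((outClause c).flatMap (fun l => (outGate l.var).vars))
    (fun b => (lineAt n m s t b).elim [] Line.branchVars)

/-- The number of the clause of `φ` in a line of the form `l1`. -/
def Line.l1Clause : Line n → Option ℕ
  | .l1 _ k => some k
  | _ => none

/-- The clause of `φ` that has to be satisfied in order that the clause `c` is: if the clause `c`
says that a line of the form `l1` is a weakening of some axiom. -/
def satClause (c : OutIdx n m s t) : Option (Fin m) :=
  c.1.weakBlock.elim none (fun b =>
    ((lineAt n m s t b).elim none Line.l1Clause).elim none (fun k => (List.finRange m)[k]?))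

/-- The literals on the variable `v`, if there is one. -/
def choices {X : Type} : Option X → List (Option (Lit X))
  | none => [none]
  | some v => [some (.pos v), some (.neg v)]

/-- The negations of the literals in `r`, with renamed variables. -/
def negs {X W : Type} (e : X → W) (r : List (Option (Lit X))) : List (Lit W) :=
  r.flatMap (fun o => o.toList.map (fun l => (l.map e).compl))

/-- The lines `f r`, for both literals `r` on the variable `v`, and then the clause `A`. -/
def branch {X W : Type} (v : Option X) (A : List (Lit W))
    (f : Option (Lit X) → List (List (Lit W))) : List (List (Lit W)) :=
  (choices v).flatMap f ++ [A]

/-- The variable of `φ` and `α`, as a variable of the main formula. -/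
abbrev mainSVar (x : SVar n m) : MainVar n m s t := .inl (.inr x)

/-- The clause `c` of `Ref_t(Ref_s(φ), π)` is not falsified. -/
abbrev notMu (c : OutIdx n m s t) : Lit (MainVar n m s t) := .neg (.inr c)

/-- Derivation of `¬μ_c` from the literals `r`, for every literal of `c` that they make true. -/
def leafLines (c : OutIdx n m s t) (r : List (Option (Lit (SVar n m)))) :
    List (List (Lit (MainVar n m s t))) :=
  (outClause c).flatMap (fun l => if forces r l then
    l.var.elim (fun _ => [l.map .inl :: negs mainSVar r]) (fun _ => []) ++
      [notMu c :: negs mainSVar r]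
    else [])

/-- The `k`-th branching variable, if there is one. -/
def branchVar (k : ℕ) (c : OutIdx n m s t) : Option (SVar n m) := (branchVars c)[k]?

/-- Derivation of `¬μ_c` by branching over the values of at most three variables. -/
def branchLines (c : OutIdx n m s t) : List (List (Lit (MainVar n m s t))) :=
  branch (branchVar 0 c) [notMu c] fun r1 =>
    branch (branchVar 1 c) (notMu c :: negs mainSVar [r1]) fun r2 =>
      branch (branchVar 2 c) (notMu c :: negs mainSVar [r1, r2]) fun r3 =>
        leafLines c [r1, r2, r3]

/-- The clauses consisting of `A` and an end segment of `l`. -/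
def chainLines {W : Type} (A l : List (Lit W)) : List (List (Lit W)) :=
  (List.range (l.length + 1)).map (fun j => A ++ l.drop j)

/-- Derivation of `¬μ_c` from the clauses saying that the clause `A` of `φ` is satisfied. -/
def satLines (c : OutIdx n m s t) (A : Fin m) : List (List (Lit (MainVar n m s t))) :=
  (allLit (List.finRange n)).flatMap (fun l =>
    [[notMu c, .neg (mainSVar (.alit A l)), ((trueLit l).map mainSVar).compl],
      [notMu c, .neg (mainSVar (.sat A l)), ((trueLit l).map mainSVar).compl],
      [notMu c, .neg (mainSVar (.sat A l))]]) ++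
  chainLines [notMu c]
    ((allLit (List.finRange n)).map (fun l => .pos (mainSVar (.sat A l))))

/-- Derivation of `¬μ_c`. -/
def clauseLines (c : OutIdx n m s t) : List (List (Lit (MainVar n m s t))) :=
  (satClause c).elim (branchLines c) (satLines c)

variable (n m s t)

/-- The clauses of the main formula. -/
def axiomLines : List (List (Lit (MainVar n m s t))) :=
  (List.finRange m).flatMap (fun A =>
    (allLit (List.finRange n)).flatMap (fun l =>
      [[.neg (mainSVar (.sat A l)), .pos (mainSVar (.alit A l))],
        [.neg (mainSVar (.sat A l)), (trueLit l).map mainSVar]]) ++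
    [(allLit (List.finRange n)).map (fun l => .pos (mainSVar (.sat A l)))]) ++
  [(outIdxs n m s t).map (fun c => .pos (.inr c))] ++
  (outIdxs n m s t).flatMap (fun c =>
    (outClause c).map (fun l => [notMu c, (l.map .inl).compl])) ++
  (outVars n m s t).flatMap (fun z => gateLines z (pudlak n m s t z))

/-- The refutation of the main formula. -/
def mainRefutation : List (List (Lit (MainVar n m s t))) :=
  axiomLines n m s t ++ (outIdxs n m s t).flatMap clauseLines ++
    chainLines [] ((outIdxs n m s t).map (fun c => .pos (.inr c)))

end MainLists

set_option synthInstance.maxSize 100000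
set_option synthInstance.maxHeartbeats 400000
set_option maxHeartbeats 4000000

/-! ### The construction is computable in polynomial time -/

section

variable {α : Type} [Enc α]

instance {X : α → Type} [∀ a, Enc (X a)] {p : α → Prop} {_h : ∀ a, Decidable (p a)}
    {g : ∀ a, Gate (X a)} [hp : PolyPred p] [hg : PolyMap g] :
    PolyMap (fun a => Gate.when (p a) (g a)) :=
  (inferInstance : PolyMap (fun a => if p a then g a else .const false))

instance {V : α → Type} [∀ a, Enc (V a)] {l : ∀ a, Lit (V a)} [hl : PolyMap l] :
    PolyMap (fun a => (l a).var) := by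
  refine Lit.polyMap l (fun _ l => l.var) (fun _ => rfl) ?_ ?_ <;> simp only [Lit.var] <;>
    infer_instance

instance {V : α → Type} [∀ a, Enc (V a)] {l : ∀ a, Lit (V a)} [hl : PolyMap l] :
    PolyMap (fun a => (l a).compl) := by
  refine Lit.polyMap l (fun _ l => l.compl) (fun _ => rfl) ?_ ?_ <;> simp only [Lit.compl] <;>
    infer_instance

instance {V W : α → Type} [∀ a, Enc (V a)] [∀ a, Enc (W a)] {f : ∀ a, V a → W a}
    {l : ∀ a, Lit (V a)} [hf : PolyMap (fun q : Σ a, V a => f q.1 q.2)] [hl : PolyMap l] :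
    PolyMap (fun a => (l a).map (f a)) := by
  refine Lit.polyMap l (fun a l => l.map (f a)) (fun _ => rfl) ?_ ?_ <;> simp only [Lit.map] <;>
    infer_instance

instance {s : α → ℕ} {B : ∀ a, Fin (s a)} {C : ∀ a, Fin (B a)} [hC : PolyMap C] :
    PolyMap (fun a => earlier (B a) (C a)) :=
  (inferInstance : PolyMap (fun a => (⟨(C a).val, (C a).2.trans (B a).2⟩ : Fin (s a))))

instance {T : α → Type} [∀ a, Enc (T a)] {l : ∀ a, List (T a)} {i : α → ℕ} [hl : PolyList l]
    [hi : PolyMap i] : PolyMap (fun a => (l a)[i a]?) := .getElem? hl hi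

instance {T : α → Type} [∀ a, Enc (T a)] {l : ∀ a, List (T a)} {i : α → ℕ} [hl : PolyList l]
    [hi : PolyMap i] : PolyList (fun a => (l a).drop (i a)) := by
  have h1 := PolyList.length l
  have h2 := hi.comp (fun q : α × ℕ => q.1) inferInstance
  have h3 := (PolyList.getElem? l).comp (fun q : α × ℕ => (q.1, i q.1 + q.2)) inferInstance
  refine .mk' (by simp only [List.length_drop]; infer_instance) ?_
  exact h3.of_enc fun q => by rw [List.getElem?_drop]

instance {T : α → Type} [∀ a, Enc (T a)] {o : ∀ a, Option (T a)} [ho : PolyMap o] :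
    PolyList (fun a => (o a).toList) := by
  refine Option.polyList o (fun _ o => o.toList) (fun _ => rfl) ?_ ?_ <;>
    simp only [Option.toList] <;> infer_instance

instance {V : α → Type} [∀ a, Enc (V a)] {l : ∀ a, List (V a)} [hl : PolyList l] :
    PolyList (fun a => allLit (l a)) := by
  unfold allLit; infer_instance

variable {n m s t : α → ℕ}

instance {l : ∀ a, Lit (Fin (n a))} [hl : PolyMap l] :
    PolyMap (fun a => (trueLit (l a) : Lit (SVar (n a) (m a)))) := by
  refine Lit.polyMap l (fun _ l => trueLit l) (fun _ => rfl) ?_ ?_ <;> simp only [trueLit] <;>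
    infer_instance

instance {i : ∀ a, Fin (n a)} [hi : PolyMap i] :
    PolyMap (fun a => (isOne (i a) : Lit (SVar (n a) (m a)))) := by
  unfold isOne; infer_instance

instance {i : ∀ a, Fin (n a)} [hi : PolyMap i] :
    PolyMap (fun a => (isZero (i a) : Lit (SVar (n a) (m a)))) := by
  unfold isZero; infer_instance

instance {L : ∀ a, Line (n a)} [hL : PolyMap L] : PolyMap (fun a => (L a).derived) := by
  refine Line.polyMap L (fun _ L => L.derived) (fun _ => rfl) ?_ ?_ ?_ ?_ ?_ ?_ ?_ ?_ ?_ ?_ ?_ ?_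
  case refine_2 =>
    refine PolyMap.natCases (fun q => q.2.2) (fun q k => Line.derived (.l2 q.2.1 k))
      (fun _ => rfl) ?_ ?_ <;> simp only [Line.derived] <;> infer_instance
  case refine_7 =>
    refine PolyMap.natCases (fun q => q.2.2.2) (fun q k => Line.derived (.r3 q.2.1 q.2.2.1 k))
      (fun _ => rfl) ?_ ?_ <;> simp only [Line.derived] <;> infer_instance
  case refine_8 =>
    refine PolyMap.natCases (fun q => q.2.2) (fun q k => Line.derived (.r4 q.2.1 k))
      (fun _ => rfl) ?_ ?_ <;> simp only [Line.derived] <;> infer_instance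
  all_goals simp only [Line.derived]; infer_instance

theorem Line.polyMap_lit :
    PolyMap (fun a : Σ p : ℕ × ℕ × ℕ, Line p.1 × Lit (InVar p.1 p.2.1 p.2.2) =>
      a.2.1.lit a.2.2) := by
  refine Line.polyMap (fun a => a.2.1) (fun a L => L.lit a.2.2) (fun _ => rfl)
    ?_ ?_ ?_ ?_ ?_ ?_ ?_ ?_ ?_ ?_ ?_ ?_
  all_goals
    refine Lit.polyMap (fun q => q.1.2.2) (fun q z => Line.lit _ z) (fun _ => rfl) ?_ ?_
    · refine RVar.polyMap (fun q => q.2) (fun q z => Line.lit _ (.pos z)) (fun _ => rfl)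
        ?_ ?_ ?_ ?_ ?_ ?_ ?_
      all_goals simp only [Line.lit]; infer_instance
    · refine RVar.polyMap (fun q => q.2) (fun q z => Line.lit _ (.neg z)) (fun _ => rfl)
        ?_ ?_ ?_ ?_ ?_ ?_ ?_
      all_goals simp only [Line.lit]; infer_instance

theorem Line.polyMap_res :
    PolyMap (fun a : Σ p : ℕ × ℕ × ℕ, Line p.1 × InVar p.1 p.2.1 p.2.2 => a.2.1.res a.2.2) := by
  refine Line.polyMap (fun a => a.2.1) (fun a L => L.res a.2.2) (fun _ => rfl)
    ?_ ?_ ?_ ?_ ?_ ?_ ?_ ?_ ?_ ?_ ?_ ?_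
  on_goal 12 =>
    refine PolyMap.natCases (fun q => q.2) (fun q k => Line.res (.fin k) _) (fun _ => rfl) ?_ ?_
  on_goal 8 =>
    refine PolyMap.natCases (fun q => q.2.2) (fun q k => Line.res (.r4 _ k) _) (fun _ => rfl) ?_ ?_
  on_goal 7 =>
    refine PolyMap.natCases (fun q => q.2.2.2) (fun q k => Line.res (.r3 _ _ k) _)
      (fun _ => rfl) ?_ ?_
  on_goal 2 =>
    refine PolyMap.natCases (fun q => q.2.2) (fun q k => Line.res (.l2 _ k) _) (fun _ => rfl) ?_ ?_
  all_goals first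
    | refine RVar.polyMap (fun q => q.1.2.2) (fun q z => Line.res _ z) (fun _ => rfl)
        ?_ ?_ ?_ ?_ ?_ ?_ ?_
    | refine RVar.polyMap (fun q => q.1.1.2.2) (fun q z => Line.res _ z) (fun _ => rfl)
        ?_ ?_ ?_ ?_ ?_ ?_ ?_
  all_goals simp only [Line.res]; infer_instance

theorem Line.polyMap_weak :
    PolyMap (fun a : Σ p : ℕ × ℕ × ℕ,
      Line p.1 × RAx (Fin p.1) (Fin p.2.1) (SVar p.1 p.2.1) p.2.2 => a.2.1.weak a.2.2) := by
  refine Line.polyMap (fun a => a.2.1) (fun a L => L.weak a.2.2) (fun _ => rfl)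
    ?_ ?_ ?_ ?_ ?_ ?_ ?_ ?_ ?_ ?_ ?_ ?_
  on_goal 8 =>
    refine PolyMap.natCases (fun q => q.2.2) (fun q k => Line.weak (.r4 _ k) _) (fun _ => rfl) ?_ ?_
  on_goal 7 =>
    refine PolyMap.natCases (fun q => q.2.2.2) (fun q k => Line.weak (.r3 _ _ k) _)
      (fun _ => rfl) ?_ ?_
  on_goal 2 =>
    refine PolyMap.natCases (fun q => q.2.2) (fun q k => Line.weak (.l2 _ k) _) (fun _ => rfl) ?_ ?_
  all_goals first
    | refine RAx.polyMap (fun q => q.1.2.2) (fun q z => Line.weak _ z) (fun _ => rfl)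
        ?_ ?_ ?_ ?_ ?_ ?_ ?_ ?_ ?_ ?_ ?_ ?_
    | refine RAx.polyMap (fun q => q.1.1.2.2) (fun q z => Line.weak _ z) (fun _ => rfl)
        ?_ ?_ ?_ ?_ ?_ ?_ ?_ ?_ ?_ ?_ ?_ ?_
  all_goals simp only [Line.weak]; infer_instance

theorem Line.polyMap_leftFrom :
    PolyMap (fun a : Σ p : ℕ × ℕ, Line p.1 × Line p.1 => a.2.1.leftFrom a.1.2 a.2.2) := by
  refine Line.polyMap (fun a => a.2.1) (fun a L => L.leftFrom a.1.2 a.2.2) (fun _ => rfl)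
    ?_ ?_ ?_ ?_ ?_ ?_ ?_ ?_ ?_ ?_ ?_ ?_
  on_goal 12 =>
    refine PolyMap.natCases (fun q => q.2) (fun q k => Line.leftFrom _ (.fin k) _)
      (fun _ => rfl) ?_ ?_
  on_goal 8 =>
    refine PolyMap.natCases (fun q => q.2.2) (fun q k => Line.leftFrom _ (.r4 _ k) _)
      (fun _ => rfl) ?_ ?_
  on_goal 7 =>
    refine PolyMap.natCases (fun q => q.2.2.2) (fun q k => Line.leftFrom _ (.r3 _ _ k) _)
      (fun _ => rfl) ?_ ?_
  on_goal 2 =>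
    refine PolyMap.natCases (fun q => q.2.2) (fun q k => Line.leftFrom _ (.l2 _ k) _)
      (fun _ => rfl) ?_ ?_
  all_goals first
    | refine Line.polyMap (fun q => q.1.2.2) (fun q z => Line.leftFrom _ _ z) (fun _ => rfl)
        ?_ ?_ ?_ ?_ ?_ ?_ ?_ ?_ ?_ ?_ ?_ ?_
    | refine Line.polyMap (fun q => q.1.1.2.2) (fun q z => Line.leftFrom _ _ z) (fun _ => rfl)
        ?_ ?_ ?_ ?_ ?_ ?_ ?_ ?_ ?_ ?_ ?_ ?_
  all_goals simp only [Line.leftFrom]; infer_instance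

theorem Line.polyMap_rightFrom :
    PolyMap (fun a : Σ p : ℕ × ℕ, Line p.1 × Line p.1 => a.2.1.rightFrom a.1.2 a.2.2) := by
  refine Line.polyMap (fun a => a.2.1) (fun a L => L.rightFrom a.1.2 a.2.2) (fun _ => rfl)
    ?_ ?_ ?_ ?_ ?_ ?_ ?_ ?_ ?_ ?_ ?_ ?_
  on_goal 12 =>
    refine PolyMap.natCases (fun q => q.2) (fun q k => Line.rightFrom _ (.fin k) _)
      (fun _ => rfl) ?_ ?_
  on_goal 8 =>
    refine PolyMap.natCases (fun q => q.2.2) (fun q k => Line.rightFrom _ (.r4 _ k) _)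
      (fun _ => rfl) ?_ ?_
  on_goal 7 =>
    refine PolyMap.natCases (fun q => q.2.2.2) (fun q k => Line.rightFrom _ (.r3 _ _ k) _)
      (fun _ => rfl) ?_ ?_
  on_goal 2 =>
    refine PolyMap.natCases (fun q => q.2.2) (fun q k => Line.rightFrom _ (.l2 _ k) _)
      (fun _ => rfl) ?_ ?_
  all_goals first
    | refine Line.polyMap (fun q => q.1.2.2) (fun q z => Line.rightFrom _ _ z) (fun _ => rfl)
        ?_ ?_ ?_ ?_ ?_ ?_ ?_ ?_ ?_ ?_ ?_ ?_
    | refine Line.polyMap (fun q => q.1.1.2.2) (fun q z => Line.rightFrom _ _ z) (fun _ => rfl)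
        ?_ ?_ ?_ ?_ ?_ ?_ ?_ ?_ ?_ ?_ ?_ ?_
  all_goals simp only [Line.rightFrom]; infer_instance

instance [hn : PolyMap n] [hm : PolyMap m] [hs : PolyMap s] {L : ∀ a, Line (n a)}
    {z : ∀ a, Lit (InVar (n a) (m a) (s a))} [hL : PolyMap L] [hz : PolyMap z] :
    PolyMap (fun a => (L a).lit (z a)) :=
  Line.polyMap_lit.comp (fun a => ⟨(n a, m a, s a), L a, z a⟩) (.sigma inferInstance)

instance [hn : PolyMap n] [hm : PolyMap m] [hs : PolyMap s] {L : ∀ a, Line (n a)}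
    {z : ∀ a, InVar (n a) (m a) (s a)} [hL : PolyMap L] [hz : PolyMap z] :
    PolyMap (fun a => (L a).res (z a)) :=
  Line.polyMap_res.comp (fun a => ⟨(n a, m a, s a), L a, z a⟩) (.sigma inferInstance)

instance [hn : PolyMap n] [hm : PolyMap m] [hs : PolyMap s] {L : ∀ a, Line (n a)}
    {z : ∀ a, RAx (Fin (n a)) (Fin (m a)) (SVar (n a) (m a)) (s a)} [hL : PolyMap L]
    [hz : PolyMap z] : PolyMap (fun a => (L a).weak (z a)) :=
  Line.polyMap_weak.comp (fun a => ⟨(n a, m a, s a), L a, z a⟩) (.sigma inferInstance)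

instance [hn : PolyMap n] [hm : PolyMap m] {L K : ∀ a, Line (n a)} [hL : PolyMap L]
    [hK : PolyMap K] : PolyMap (fun a => (L a).leftFrom (m a) (K a)) :=
  Line.polyMap_leftFrom.comp (fun a => ⟨(n a, m a), L a, K a⟩) (.sigma inferInstance)

instance [hn : PolyMap n] [hs : PolyMap s] {L K : ∀ a, Line (n a)} [hL : PolyMap L]
    [hK : PolyMap K] : PolyMap (fun a => (L a).rightFrom (s a) (K a)) :=
  Line.polyMap_rightFrom.comp (fun a => ⟨(n a, s a), L a, K a⟩) (.sigma inferInstance)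

end

/-! ### Completeness of the enumerations -/

theorem mem_allLit {V : Type} {vs : List V} (l : Lit V) : l ∈ allLit vs ↔ l.var ∈ vs := by
  cases l <;> simp [allLit, Lit.var]

theorem mem_allSVar {n m : ℕ} (x : SVar n m) : x ∈ allSVar n m := by
  cases x <;> simp [allSVar, mem_allLit]

section

variable {V I P : Type} {s : ℕ} {vs : List V} {is : List I} {ps : List P}

theorem mem_allRVar (hv : ∀ v, v ∈ vs) (hi : ∀ i, i ∈ is) (x : RVar V I s) :
    x ∈ allRVar s vs is := by
  cases x <;> simp [allRVar, mem_allLit, hv, hi]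

theorem mem_allRAx (hv : ∀ v, v ∈ vs) (hi : ∀ i, i ∈ is) (hp : ∀ p, p ∈ ps) (x : RAx V I P s) :
    x ∈ allRAx s vs is ps := by
  cases x <;> simp [allRAx, mem_allLit, hv, hi, hp]

variable [DecidableEq V] [DecidableEq I] [DecidableEq P] {ψ : PCNF V I P}

theorem mem_allRefIdx (hv : ∀ v, v ∈ vs) (hi : ∀ i, i ∈ is) (hp : ∀ p, p ∈ ps) (x : RefIdx ψ s) :
    x ∈ allRefIdx s vs is ps ψ := by
  simp only [allRefIdx, List.mem_flatMap]
  exact ⟨x.1, mem_allRAx hv hi hp _, by simp [x.2]⟩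

theorem mem_refClauseList [Fintype V] [Fintype I] (hv : ∀ v, v ∈ vs) (hi : ∀ i, i ∈ is)
    (x : RAx V I P s) (l) : l ∈ refClauseList s vs is ψ x ↔ l ∈ refClause ψ s x := by
  cases x <;> simp [refClauseList, refClause, hv, hi]
  case weak B A l =>
    cases ψ.mem A l <;> simp [Cond.negLits, Lit.map, eq_comm]

end

theorem mem_inVars {n m s : ℕ} (x : InVar n m s) : x ∈ inVars n m s :=
  mem_allRVar (by simp) (by simp) x

theorem mem_inIdxs {n m s : ℕ} (x : InIdx n m s) : x ∈ inIdxs n m s :=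
  mem_allRefIdx (by simp) (by simp) mem_allSVar x

theorem mem_outVars {n m s t : ℕ} (x : OutVar n m s t) : x ∈ outVars n m s t :=
  mem_allRVar mem_inVars mem_inIdxs x

theorem mem_outIdxs {n m s t : ℕ} (x : OutIdx n m s t) : x ∈ outIdxs n m s t :=
  mem_allRefIdx mem_inVars mem_inIdxs mem_allSVar x

theorem mem_inClause {n m s : ℕ} (c : InIdx n m s) (l) :
    l ∈ inClause c ↔ l ∈ refCNF (phi n m) s c :=
  mem_refClauseList (by simp) (by simp) c.1 l

theorem mem_outClause {n m s t : ℕ} (c : OutIdx n m s t) (l) :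
    l ∈ outClause c ↔ l ∈ refRef n m s t c :=
  mem_refClauseList mem_inVars mem_inIdxs c.1 l

/-! ### The enumerations are computable in polynomial time -/

section

variable {α : Type} [Enc α] {n m s t : α → ℕ}

theorem polyList_allSVar : PolyList (fun p : ℕ × ℕ => allSVar p.1 p.2) := by
  unfold allSVar; infer_instance

theorem polyList_inVars : PolyList (fun p : ℕ × ℕ × ℕ => inVars p.1 p.2.1 p.2.2) := by
  unfold inVars allRVar; infer_instance

theorem polyList_blockLines : PolyList (fun p : ℕ × ℕ × ℕ => blockLines p.1 p.2.1 p.2.2) := by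
  unfold blockLines; infer_instance

instance [hn : PolyMap n] [hm : PolyMap m] : PolyList (fun a => allSVar (n a) (m a)) :=
  polyList_allSVar.comp (fun a => (n a, m a)) inferInstance

instance [hn : PolyMap n] [hm : PolyMap m] [hs : PolyMap s] :
    PolyList (fun a => inVars (n a) (m a) (s a)) :=
  polyList_inVars.comp (fun a => (n a, m a, s a)) inferInstance

instance [hn : PolyMap n] [hm : PolyMap m] [hs : PolyMap s] :
    PolyList (fun a => blockLines (n a) (m a) (s a)) :=
  polyList_blockLines.comp (fun a => (n a, m a, s a)) inferInstance

theorem polyList_initLines : PolyList (fun p : ℕ × ℕ × ℕ => initLines p.1 p.2.1 p.2.2) := by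
  unfold initLines; infer_instance

instance [hn : PolyMap n] [hm : PolyMap m] [hs : PolyMap s] :
    PolyList (fun a => initLines (n a) (m a) (s a)) :=
  polyList_initLines.comp (fun a => (n a, m a, s a)) inferInstance

instance [hn : PolyMap n] [hm : PolyMap m] [hs : PolyMap s] [ht : PolyMap t] {b : α → ℕ}
    [hb : PolyMap b] : PolyMap (fun a => lineAt (n a) (m a) (s a) (t a) (b a)) := by
  unfold lineAt; infer_instance

theorem polyMap_refOk_phi :
    PolyMap (fun a : Σ p : ℕ × ℕ × ℕ, RAx (Fin p.1) (Fin p.2.1) (SVar p.1 p.2.1) p.2.2 =>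
      refOk (phi a.1.1 a.1.2.1) a.1.2.2 a.2) := by
  refine RAx.polyMap (fun a => a.2) (fun a x => refOk (phi a.1.1 a.1.2.1) a.1.2.2 x)
    (fun _ => rfl) ?_ ?_ ?_ ?_ ?_ ?_ ?_ ?_ ?_ ?_ ?_ ?_
  all_goals simp only [refOk, phi, Finset.notMem_empty]; infer_instance

theorem polyList_allRAx_phi : PolyList (fun p : ℕ × ℕ × ℕ => allRAx p.2.2 (List.finRange p.1)
    (List.finRange p.2.1) (allSVar p.1 p.2.1)) := by
  unfold allRAx; infer_instance

/-- A label in the subtype `RefIdx` has the same code as the label itself, so that the enumeration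
is that of `RAx`, filtered. -/
theorem map_enc_allRefIdx {V I P : Type} [DecidableEq V] [DecidableEq I] [DecidableEq P] [Enc V]
    [Enc I] [Enc P] (s : ℕ) (vs : List V) (is : List I) (ps : List P) (ψ : PCNF V I P) :
    (allRefIdx s vs is ps ψ).map enc =
      ((allRAx s vs is ps).filter (fun a => refOk ψ s a)).map enc := by
  unfold allRefIdx
  induction allRAx s vs is ps with
  | nil => rfl
  | cons x l ih =>
    rw [List.flatMap_cons, List.map_append, ih, List.filter_cons]
    split_ifs <;> rfl

theorem polyList_inIdxs : PolyList (fun p : ℕ × ℕ × ℕ => inIdxs p.1 p.2.1 p.2.2) := by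
  have h1 := polyList_allRAx_phi
  have h2 := polyMap_refOk_phi
  have h : PolyList (fun p : ℕ × ℕ × ℕ => (allRAx p.2.2 (List.finRange p.1)
    (List.finRange p.2.1) (allSVar p.1 p.2.1)).filter (fun a => refOk (phi p.1 p.2.1) p.2.2 a)) :=
    inferInstance
  exact h.of_enc fun p => map_enc_allRefIdx ..

instance [hn : PolyMap n] [hm : PolyMap m] [hs : PolyMap s] :
    PolyList (fun a => inIdxs (n a) (m a) (s a)) :=
  polyList_inIdxs.comp (fun a => (n a, m a, s a)) inferInstance

theorem polyList_inClause : PolyList (fun a : Σ p : ℕ × ℕ × ℕ, InIdx p.1 p.2.1 p.2.2 =>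
    inClause a.2) := by
  refine RAx.polyList (fun a => a.2.1) (fun a x => refClauseList a.1.2.2 (List.finRange a.1.1)
    (List.finRange a.1.2.1) (phi a.1.1 a.1.2.1) x)
    (fun _ => rfl) ?_ ?_ ?_ ?_ ?_ ?_ ?_ ?_ ?_ ?_ ?_ ?_
  all_goals simp only [refClauseList, phi, Cond.negLits]; infer_instance

instance [hn : PolyMap n] [hm : PolyMap m] [hs : PolyMap s] {c : ∀ a, InIdx (n a) (m a) (s a)}
    [hc : PolyMap c] : PolyList (fun a => inClause (c a)) :=
  polyList_inClause.comp (fun a => ⟨(n a, m a, s a), c a⟩) (.sigma inferInstance)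

theorem refPhi_mem {n m s : ℕ} (A : InIdx n m s) (l : Lit (InVar n m s)) :
    (refPhi n m s).mem A l = if l.map Sum.inl ∈ inClause A then .yes else .no := by
  simp only [refPhi, PCNF.ofCNF, mem_inClause]

theorem mem_refPhi_guard {n m s : ℕ} (A : InIdx n m s) (g : Lit (SVar n m)) :
    g ∈ (refPhi n m s).guard A ↔ g.compl.map Sum.inr ∈ inClause A := by
  simp only [refPhi, PCNF.ofCNF, mem_inClause, Finset.mem_filter, Finset.mem_univ, true_and]

theorem refOk_refPhi_weak {n m s t : ℕ} (B : Fin t) (A : InIdx n m s) (l : Lit (InVar n m s)) :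
    refOk (refPhi n m s) t (.weak B A l) = decide (l.map Sum.inl ∈ inClause A) := by
  simp only [refOk, refPhi_mem]
  split_ifs with h <;> simp [h]

theorem polyMap_refOk_refPhi :
    PolyMap (fun a : Σ p : ℕ × ℕ × ℕ × ℕ, RAx (InVar p.1 p.2.1 p.2.2.1) (InIdx p.1 p.2.1 p.2.2.1)
      (SVar p.1 p.2.1) p.2.2.2 => refOk (refPhi a.1.1 a.1.2.1 a.1.2.2.1) a.1.2.2.2 a.2) := by
  refine RAx.polyMap (fun a => a.2) (fun a x => refOk (refPhi a.1.1 a.1.2.1 a.1.2.2.1) a.1.2.2.2 x)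
    (fun _ => rfl) ?_ ?_ ?_ ?_ ?_ ?_ ?_ ?_ ?_ ?_ ?_ ?_
  case refine_3 => simp only [refOk_refPhi_weak]; infer_instance
  all_goals simp only [refOk, mem_refPhi_guard]; infer_instance

theorem polyList_allRAx_refPhi : PolyList (fun p : ℕ × ℕ × ℕ × ℕ => allRAx p.2.2.2
    (inVars p.1 p.2.1 p.2.2.1) (inIdxs p.1 p.2.1 p.2.2.1) (allSVar p.1 p.2.1)) := by
  unfold allRAx; infer_instance

theorem polyList_outIdxs :
    PolyList (fun p : ℕ × ℕ × ℕ × ℕ => outIdxs p.1 p.2.1 p.2.2.1 p.2.2.2) := by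
  have h1 := polyList_allRAx_refPhi
  have h2 := polyMap_refOk_refPhi
  have h : PolyList (fun p : ℕ × ℕ × ℕ × ℕ => (allRAx p.2.2.2
    (inVars p.1 p.2.1 p.2.2.1) (inIdxs p.1 p.2.1 p.2.2.1) (allSVar p.1 p.2.1)).filter
      (fun a => refOk (refPhi p.1 p.2.1 p.2.2.1) p.2.2.2 a)) :=
    inferInstance
  exact h.of_enc fun p => map_enc_allRefIdx ..

instance [hn : PolyMap n] [hm : PolyMap m] [hs : PolyMap s] [ht : PolyMap t] :
    PolyList (fun a => outIdxs (n a) (m a) (s a) (t a)) :=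
  polyList_outIdxs.comp (fun a => (n a, m a, s a, t a)) inferInstance

theorem polyList_outVars :
    PolyList (fun p : ℕ × ℕ × ℕ × ℕ => outVars p.1 p.2.1 p.2.2.1 p.2.2.2) := by
  unfold outVars allRVar; infer_instance

instance [hn : PolyMap n] [hm : PolyMap m] [hs : PolyMap s] [ht : PolyMap t] :
    PolyList (fun a => outVars (n a) (m a) (s a) (t a)) :=
  polyList_outVars.comp (fun a => (n a, m a, s a, t a)) inferInstance

theorem negLits_refPhi_mem {n m s : ℕ} (A : InIdx n m s) (l : Lit (InVar n m s)) :
    ((refPhi n m s).mem A l).negLits = [] := by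
  rw [refPhi_mem]
  split_ifs <;> rfl

theorem polyList_outClause : PolyList (fun a : Σ p : ℕ × ℕ × ℕ × ℕ,
    OutIdx p.1 p.2.1 p.2.2.1 p.2.2.2 => outClause a.2) := by
  refine RAx.polyList (fun a => a.2.1) (fun a x => refClauseList a.1.2.2.2
    (inVars a.1.1 a.1.2.1 a.1.2.2.1) (inIdxs a.1.1 a.1.2.1 a.1.2.2.1)
    (refPhi a.1.1 a.1.2.1 a.1.2.2.1) x)
    (fun _ => rfl) ?_ ?_ ?_ ?_ ?_ ?_ ?_ ?_ ?_ ?_ ?_ ?_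
  all_goals simp only [refClauseList, negLits_refPhi_mem]; infer_instance

instance [hn : PolyMap n] [hm : PolyMap m] [hs : PolyMap s] [ht : PolyMap t]
    {c : ∀ a, OutIdx (n a) (m a) (s a) (t a)} [hc : PolyMap c] :
    PolyList (fun a => outClause (c a)) :=
  polyList_outClause.comp (fun a => ⟨(n a, m a, s a, t a), c a⟩) (.sigma inferInstance)

end

/-! ### The code of the refutation is computable in polynomial time -/

section

variable {α : Type} [Enc α] {n m s t : α → ℕ}

instance {γ β : α → Type} [∀ a, Enc (γ a)] [∀ a, Enc (β a)] {o : ∀ a, Option (γ a)}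
    {f : ∀ a, β a} {g : ∀ a, γ a → β a} [ho : PolyMap o] [hf : PolyMap f]
    [hg : PolyMap (fun q : Σ a, γ a => g q.1 q.2)] :
    PolyMap (fun a => (o a).elim (f a) (g a)) := .optionElim ho hf hg

instance {γ β : α → Type} [∀ a, Enc (γ a)] [∀ a, Enc (β a)] {o : ∀ a, Option (γ a)}
    {f : ∀ a, List (β a)} {g : ∀ a, γ a → List (β a)} [ho : PolyMap o] [hf : PolyList f]
    [hg : PolyList (fun q : Σ a, γ a => g q.1 q.2)] :
    PolyList (fun a => (o a).elim (f a) (g a)) := by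
  refine Option.polyList o (fun a o => o.elim (f a) (g a)) (fun _ => rfl) ?_ hg
  exact hf.comp (fun q : Σ _ : α, Unit => q.1) inferInstance

/-- The gates of the circuit, as a function of the line in a block. -/
theorem pudlak_eq (n m s t : ℕ) (z : OutVar n m s t) : pudlak n m s t z = match z with
    | .en b => .const (lineAt n m s t b).isSome
    | .der b => (lineAt n m s t b).elim (.const false) fun L => .const L.derived
    | .weak b a => (lineAt n m s t b).elim (.const false) fun L => L.weak a.1
    | .lit b z => (lineAt n m s t b).elim (.const false) fun L => L.lit z
    | .res b v => (lineAt n m s t b).elim (.const false) fun L => L.res v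
    | .lp b c => (lineAt n m s t b).elim (.const false) fun L =>
      (lineAt n m s t c).elim (.const false) fun K => .const (L.leftFrom m K)
    | .rp b c => (lineAt n m s t b).elim (.const false) fun L =>
      (lineAt n m s t c).elim (.const false) fun K => .const (L.rightFrom s K) := by
  cases z with
  | en b => rfl
  | lp b c => simp only [pudlak]; cases lineAt n m s t b <;> cases lineAt n m s t c <;> rfl
  | rp b c => simp only [pudlak]; cases lineAt n m s t b <;> cases lineAt n m s t c <;> rfl
  | _ => simp only [pudlak]; cases lineAt n m s t _ <;> rfl

theorem polyMap_pudlak : PolyMap (fun a : Σ p : ℕ × ℕ × ℕ × ℕ,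
    OutVar p.1 p.2.1 p.2.2.1 p.2.2.2 => pudlak a.1.1 a.1.2.1 a.1.2.2.1 a.1.2.2.2 a.2) := by
  refine RVar.polyMap (fun a => a.2) (fun a z => pudlak a.1.1 a.1.2.1 a.1.2.2.1 a.1.2.2.2 z)
    (fun _ => rfl) ?_ ?_ ?_ ?_ ?_ ?_ ?_ <;> simp only [pudlak_eq] <;> infer_instance

instance [hn : PolyMap n] [hm : PolyMap m] [hs : PolyMap s] [ht : PolyMap t]
    {z : ∀ a, OutVar (n a) (m a) (s a) (t a)} [hz : PolyMap z] :
    PolyMap (fun a => pudlak (n a) (m a) (s a) (t a) (z a)) :=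
  polyMap_pudlak.comp (fun a => ⟨(n a, m a, s a, t a), z a⟩) (.sigma inferInstance)

theorem polyMap_outGate : PolyMap (fun a : Σ p : ℕ × ℕ × ℕ × ℕ,
    OutVar p.1 p.2.1 p.2.2.1 p.2.2.2 ⊕ SVar p.1 p.2.1 => outGate a.2) := by
  refine Sum.polyMap (fun a => a.2) (fun a w => outGate w) (fun _ => rfl) ?_ ?_ <;>
    simp only [outGate] <;> infer_instance

instance [hn : PolyMap n] [hm : PolyMap m] [hs : PolyMap s] [ht : PolyMap t]
    {z : ∀ a, OutVar (n a) (m a) (s a) (t a) ⊕ SVar (n a) (m a)} [hz : PolyMap z] :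
    PolyMap (fun a => outGate (z a)) :=
  polyMap_outGate.comp (fun a => ⟨(n a, m a, s a, t a), z a⟩) (.sigma inferInstance)

instance {X : α → Type} [∀ a, Enc (X a)] {g : ∀ a, Gate (X a)} [hg : PolyMap g] :
    PolyList (fun a => (g a).vars) := by
  refine Gate.polyList g (fun _ g => g.vars) (fun _ => rfl) ?_ ?_ ?_ <;> simp only [Gate.vars] <;>
    infer_instance

theorem polyMap_forcesTrue : PolyMap (fun a : Σ p : ℕ × ℕ,
    Option (Lit (SVar p.1 p.2)) × Option (Lit (SVar p.1 p.2)) × Option (Lit (SVar p.1 p.2)) ×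
      Gate (SVar p.1 p.2) => a.2.2.2.2.forcesTrue [a.2.1, a.2.2.1, a.2.2.2.1]) := by
  refine Gate.polyMap (fun a => a.2.2.2.2) (fun _ g => g.forcesTrue _) (fun _ => rfl) ?_ ?_ ?_ <;>
    simp only [Gate.forcesTrue] <;> infer_instance

theorem polyMap_forcesFalse : PolyMap (fun a : Σ p : ℕ × ℕ,
    Option (Lit (SVar p.1 p.2)) × Option (Lit (SVar p.1 p.2)) × Option (Lit (SVar p.1 p.2)) ×
      Gate (SVar p.1 p.2) => a.2.2.2.2.forcesFalse [a.2.1, a.2.2.1, a.2.2.2.1]) := by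
  refine Gate.polyMap (fun a => a.2.2.2.2) (fun _ g => g.forcesFalse _) (fun _ => rfl) ?_ ?_ ?_ <;>
    simp only [Gate.forcesFalse] <;> infer_instance

instance [hn : PolyMap n] [hm : PolyMap m] {g : ∀ a, Gate (SVar (n a) (m a))}
    {r1 r2 r3 : ∀ a, Option (Lit (SVar (n a) (m a)))} [hg : PolyMap g] [h1 : PolyMap r1]
    [h2 : PolyMap r2] [h3 : PolyMap r3] :
    PolyMap (fun a => (g a).forcesTrue [r1 a, r2 a, r3 a]) :=
  polyMap_forcesTrue.comp (fun a => ⟨(n a, m a), r1 a, r2 a, r3 a, g a⟩) (.sigma inferInstance)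

instance [hn : PolyMap n] [hm : PolyMap m] {g : ∀ a, Gate (SVar (n a) (m a))}
    {r1 r2 r3 : ∀ a, Option (Lit (SVar (n a) (m a)))} [hg : PolyMap g] [h1 : PolyMap r1]
    [h2 : PolyMap r2] [h3 : PolyMap r3] :
    PolyMap (fun a => (g a).forcesFalse [r1 a, r2 a, r3 a]) :=
  polyMap_forcesFalse.comp (fun a => ⟨(n a, m a), r1 a, r2 a, r3 a, g a⟩) (.sigma inferInstance)

theorem polyMap_forces : PolyMap (fun a : Σ p : ℕ × ℕ × ℕ × ℕ,
    Option (Lit (SVar p.1 p.2.1)) × Option (Lit (SVar p.1 p.2.1)) ×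
      Option (Lit (SVar p.1 p.2.1)) × Lit (OutVar p.1 p.2.1 p.2.2.1 p.2.2.2 ⊕ SVar p.1 p.2.1) =>
      forces [a.2.1, a.2.2.1, a.2.2.2.1] a.2.2.2.2) := by
  refine Lit.polyMap (fun a => a.2.2.2.2) (fun _ l => forces _ l) (fun _ => rfl) ?_ ?_ <;>
    simp only [forces] <;> infer_instance

instance [hn : PolyMap n] [hm : PolyMap m] [hs : PolyMap s] [ht : PolyMap t]
    {l : ∀ a, Lit (OutVar (n a) (m a) (s a) (t a) ⊕ SVar (n a) (m a))}
    {r1 r2 r3 : ∀ a, Option (Lit (SVar (n a) (m a)))} [hl : PolyMap l] [h1 : PolyMap r1]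
    [h2 : PolyMap r2] [h3 : PolyMap r3] :
    PolyMap (fun a => forces [r1 a, r2 a, r3 a] (l a)) :=
  polyMap_forces.comp (fun a => ⟨(n a, m a, s a, t a), r1 a, r2 a, r3 a, l a⟩)
    (.sigma inferInstance)

theorem Line.polyList_branchVars : PolyList (fun a : Σ p : ℕ × ℕ, Line p.1 =>
    (a.2.branchVars : List (SVar a.1.1 a.1.2))) := by
  refine Line.polyList (fun a => a.2) (fun a L => L.branchVars) (fun _ => rfl)
    ?_ ?_ ?_ ?_ ?_ ?_ ?_ ?_ ?_ ?_ ?_ ?_ <;> simp only [Line.branchVars] <;> infer_instance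

instance [hn : PolyMap n] [hm : PolyMap m] {L : ∀ a, Line (n a)} [hL : PolyMap L] :
    PolyList (fun a => ((L a).branchVars : List (SVar (n a) (m a)))) :=
  Line.polyList_branchVars.comp (fun a => ⟨(n a, m a), L a⟩) (.sigma inferInstance)

instance {L : ∀ a, Line (n a)} [hL : PolyMap L] : PolyMap (fun a => (L a).l1Clause) := by
  refine Line.polyMap L (fun a L => L.l1Clause) (fun _ => rfl)
    ?_ ?_ ?_ ?_ ?_ ?_ ?_ ?_ ?_ ?_ ?_ ?_ <;> simp only [Line.l1Clause] <;> infer_instance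

instance {V I P : α → Type} [∀ a, Enc (V a)] [∀ a, Enc (I a)] [∀ a, Enc (P a)]
    {x : ∀ a, RAx (V a) (I a) (P a) (s a)} [hx : PolyMap x] :
    PolyMap (fun a => (x a).longBlock) := by
  refine RAx.polyMap x (fun _ x => x.longBlock) (fun _ => rfl)
    ?_ ?_ ?_ ?_ ?_ ?_ ?_ ?_ ?_ ?_ ?_ ?_ <;>
    simp only [RAx.longBlock] <;> infer_instance

instance {V I P : α → Type} [∀ a, Enc (V a)] [∀ a, Enc (I a)] [∀ a, Enc (P a)]
    {x : ∀ a, RAx (V a) (I a) (P a) (s a)} [hx : PolyMap x] :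
    PolyMap (fun a => (x a).weakBlock) := by
  refine RAx.polyMap x (fun _ x => x.weakBlock) (fun _ => rfl)
    ?_ ?_ ?_ ?_ ?_ ?_ ?_ ?_ ?_ ?_ ?_ ?_ <;>
    simp only [RAx.weakBlock] <;> infer_instance

theorem polyList_branchVars : PolyList (fun a : Σ p : ℕ × ℕ × ℕ × ℕ,
    OutIdx p.1 p.2.1 p.2.2.1 p.2.2.2 => branchVars a.2) := by
  unfold branchVars; infer_instance

instance [hn : PolyMap n] [hm : PolyMap m] [hs : PolyMap s] [ht : PolyMap t]
    {c : ∀ a, OutIdx (n a) (m a) (s a) (t a)} [hc : PolyMap c] :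
    PolyList (fun a => branchVars (c a)) :=
  polyList_branchVars.comp (fun a => ⟨(n a, m a, s a, t a), c a⟩) (.sigma inferInstance)

theorem polyMap_satClause : PolyMap (fun a : Σ p : ℕ × ℕ × ℕ × ℕ,
    OutIdx p.1 p.2.1 p.2.2.1 p.2.2.2 => satClause a.2) := by
  unfold satClause; infer_instance

instance [hn : PolyMap n] [hm : PolyMap m] [hs : PolyMap s] [ht : PolyMap t]
    {c : ∀ a, OutIdx (n a) (m a) (s a) (t a)} [hc : PolyMap c] :
    PolyMap (fun a => satClause (c a)) :=
  polyMap_satClause.comp (fun a => ⟨(n a, m a, s a, t a), c a⟩) (.sigma inferInstance)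

theorem polyMap_branchVar (k : ℕ) : PolyMap (fun a : Σ p : ℕ × ℕ × ℕ × ℕ,
    OutIdx p.1 p.2.1 p.2.2.1 p.2.2.2 => branchVar k a.2) := by
  unfold branchVar; infer_instance

instance [hn : PolyMap n] [hm : PolyMap m] [hs : PolyMap s] [ht : PolyMap t]
    {c : ∀ a, OutIdx (n a) (m a) (s a) (t a)} [hc : PolyMap c] (k : ℕ) :
    PolyMap (fun a => branchVar k (c a)) :=
  (polyMap_branchVar k).comp (fun a => ⟨(n a, m a, s a, t a), c a⟩) (.sigma inferInstance)

instance {X : α → Type} [∀ a, Enc (X a)] {v : ∀ a, Option (X a)} [hv : PolyMap v] :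
    PolyList (fun a => choices (v a)) := by
  refine Option.polyList v (fun _ v => choices v) (fun _ => rfl) ?_ ?_ <;>
    simp only [choices] <;> infer_instance

instance {r : ∀ a, List (Option (Lit (SVar (n a) (m a))))} [hr : PolyList r] :
    PolyList (fun a => (negs mainSVar (r a) : List (Lit (MainVar (n a) (m a) (s a) (t a))))) := by
  unfold negs
  infer_instance

instance {V : α → Type} [∀ a, Enc (V a)] {e : ∀ a, V a → List ℕ} {l : ∀ a, Lit (V a)}
    [he : PolyList (fun q : Σ a, V a => e q.1 q.2)] [hl : PolyMap l] :
    PolyList (fun a => (l a).code (e a)) := by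
  refine Lit.polyList l (fun a l => l.code (e a)) (fun _ => rfl) ?_ ?_ <;>
    simp only [Lit.code] <;> infer_instance

instance {z : ∀ a, SVar (n a) (m a)} [hz : PolyMap z] : PolyList (fun a => (z a).code) := by
  refine SVar.polyList z (fun a z => z.code) (fun _ => rfl) ?_ ?_ ?_ <;>
    simp only [SVar.code] <;> infer_instance

/-- The code of a variable of `Ref_s(φ)`. -/
def inVarCode {n m s : ℕ} : InVar n m s → List ℕ :=
  RVar.code (fun i => [i.val]) (fun A => [A.val])

/-- The code of a clause of `Ref_s(φ)`. -/
def inIdxCode {n m s : ℕ} (a : InIdx n m s) : List ℕ :=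
  a.1.code (fun i => [i.val]) (fun A => [A.val]) SVar.code

instance {z : ∀ a, InVar (n a) (m a) (s a)} [hz : PolyMap z] :
    PolyList (fun a => inVarCode (z a)) := by
  refine RVar.polyList z (fun a z => inVarCode z) (fun _ => rfl) ?_ ?_ ?_ ?_ ?_ ?_ ?_ <;>
    simp only [inVarCode, RVar.code] <;> infer_instance

instance {z : ∀ a, InIdx (n a) (m a) (s a)} [hz : PolyMap z] :
    PolyList (fun a => inIdxCode (z a)) := by
  refine RAx.polyList (fun a => (z a).1) (fun a z => z.code (fun i => [i.val]) (fun A => [A.val])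
    SVar.code) (fun _ => rfl)
    ?_ ?_ ?_ ?_ ?_ ?_ ?_ ?_ ?_ ?_ ?_ ?_ <;>
    simp only [RAx.code] <;> infer_instance

instance {z : ∀ a, OutVar (n a) (m a) (s a) (t a)} [hz : PolyMap z] :
    PolyList (fun a => (z a).code inVarCode inIdxCode) := by
  refine RVar.polyList z (fun a z => z.code inVarCode inIdxCode) (fun _ => rfl)
    ?_ ?_ ?_ ?_ ?_ ?_ ?_ <;> simp only [RVar.code] <;> infer_instance

instance {z : ∀ a, OutIdx (n a) (m a) (s a) (t a)} [hz : PolyMap z] :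
    PolyList (fun a => (z a).1.code inVarCode inIdxCode SVar.code) := by
  refine RAx.polyList (fun a => (z a).1) (fun a z => z.code inVarCode inIdxCode SVar.code)
    (fun _ => rfl)
    ?_ ?_ ?_ ?_ ?_ ?_ ?_ ?_ ?_ ?_ ?_ ?_ <;>
    simp only [RAx.code] <;> infer_instance

theorem mainCode_eq {n m s t : ℕ} (v : MainVar n m s t) : mainCode v = match v with
    | .inl (.inl z) => 0 :: z.code inVarCode inIdxCode
    | .inl (.inr x) => 1 :: x.code
    | .inr c => 2 :: c.1.code inVarCode inIdxCode SVar.code := rfl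

instance {v : ∀ a, MainVar (n a) (m a) (s a) (t a)} [hv : PolyMap v] :
    PolyList (fun a => mainCode (v a)) := by
  refine Sum.polyList v (fun a v => mainCode v) (fun _ => rfl) ?_ ?_
  · refine Sum.polyList (fun q => q.2) (fun q v => mainCode (.inl v)) (fun _ => rfl) ?_ ?_ <;>
      simp only [mainCode_eq] <;> infer_instance
  · simp only [mainCode_eq]
    infer_instance

theorem codeClauses_nil {V : Type} (e : V → List ℕ) : codeClauses e [] = [] := rfl

theorem codeClauses_cons {V : Type} (e : V → List ℕ) (C : List (Lit V)) (Q) :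
    codeClauses e (C :: Q) = C.flatMap (Lit.code e) ++ [0] ++ codeClauses e Q := rfl

theorem codeClauses_append {V : Type} (e : V → List ℕ) (P Q : List (List (Lit V))) :
    codeClauses e (P ++ Q) = codeClauses e P ++ codeClauses e Q := List.flatMap_append

theorem codeClauses_flatMap {V A : Type} (e : V → List ℕ) (l : List A)
    (f : A → List (List (Lit V))) :
    codeClauses e (l.flatMap f) = l.flatMap (fun x => codeClauses e (f x)) := List.flatMap_assoc

theorem codeClauses_map {V A : Type} (e : V → List ℕ) (l : List A) (f : A → List (Lit V)) :
    codeClauses e (l.map f) = l.flatMap (fun x => (f x).flatMap (Lit.code e) ++ [0]) :=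
  List.flatMap_map ..

theorem codeClauses_ite {V : Type} (e : V → List ℕ) (p : Prop) [Decidable p]
    (P Q : List (List (Lit V))) :
    codeClauses e (if p then P else Q) = if p then codeClauses e P else codeClauses e Q :=
  apply_ite ..

/-- The list of clauses is made explicit in each case, so that its code is built from codes of
variables. -/
theorem codeClauses_gateLines {n m s t : ℕ} (z : OutVar n m s t) (g : Gate (SVar n m)) :
    codeClauses mainCode (gateLines z g) =
      match g with
      | .const b => if b = true then codeClauses mainCode [[.pos (.inl (.inl z))]]
        else codeClauses mainCode [[.neg (.inl (.inl z))]]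
      | .lit l => codeClauses (mainCode (t := t)) [[.neg (.inl (.inl z)), l.map mainSVar],
          [.pos (.inl (.inl z)), (l.map mainSVar).compl]]
      | .and l l' => codeClauses mainCode [[.neg (.inl (.inl z)), l.map mainSVar],
          [.neg (.inl (.inl z)), l'.map mainSVar],
          [.pos (.inl (.inl z)), (l.map mainSVar).compl, (l'.map mainSVar).compl]] := by
  cases g with
  | const b => cases b <;> rfl
  | lit l => cases l <;> rfl
  | and l l' => cases l <;> cases l' <;> rfl

theorem polyList_gateLines : PolyList (fun a : Σ p : ℕ × ℕ × ℕ × ℕ,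
    OutVar p.1 p.2.1 p.2.2.1 p.2.2.2 × Gate (SVar p.1 p.2.1) => codeClauses mainCode
      (gateLines a.2.1 a.2.2)) := by
  refine Gate.polyList (fun a => a.2.2) (fun a g => codeClauses mainCode
    (gateLines a.2.1 g)) (fun _ => rfl) ?_ ?_ ?_ <;>
    simp only [codeClauses_gateLines, codeClauses_cons, codeClauses_nil] <;> infer_instance

instance [hn : PolyMap n] [hm : PolyMap m] [hs : PolyMap s] [ht : PolyMap t]
    {z : ∀ a, OutVar (n a) (m a) (s a) (t a)} {g : ∀ a, Gate (SVar (n a) (m a))}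
    [hz : PolyMap z] [hg : PolyMap g] : PolyList (fun a => codeClauses mainCode
      (gateLines (z a) (g a))) :=
  polyList_gateLines.comp (fun a => ⟨(n a, m a, s a, t a), z a, g a⟩) (.sigma inferInstance)

theorem polyList_axiomLines : PolyList (fun p : ℕ × ℕ × ℕ × ℕ =>
    codeClauses mainCode (axiomLines p.1 p.2.1 p.2.2.1 p.2.2.2)) := by
  simp only [axiomLines, codeClauses_append, codeClauses_flatMap, codeClauses_cons,
    codeClauses_nil, codeClauses_map]
  infer_instance

theorem codeClauses_sumElim {V A B : Type} (e : V → List ℕ) (x : A ⊕ B)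
    (f : A → List (List (Lit V))) (g : B → List (List (Lit V))) :
    codeClauses e (x.elim f g) = x.elim (fun y => codeClauses e (f y))
      (fun y => codeClauses e (g y)) := by
  cases x <;> rfl

theorem codeClauses_optionElim {V A : Type} (e : V → List ℕ) (x : Option A)
    (f : List (List (Lit V))) (g : A → List (List (Lit V))) :
    codeClauses e (x.elim f g) = x.elim (codeClauses e f) (fun y => codeClauses e (g y)) := by
  cases x <;> rfl

instance {γ δ β : α → Type} [∀ a, Enc (γ a)] [∀ a, Enc (δ a)] [∀ a, Enc (β a)]
    {x : ∀ a, γ a ⊕ δ a} {f : ∀ a, γ a → List (β a)} {g : ∀ a, δ a → List (β a)}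
    [hx : PolyMap x] [hf : PolyList (fun q : Σ a, γ a => f q.1 q.2)]
    [hg : PolyList (fun q : Σ a, δ a => g q.1 q.2)] :
    PolyList (fun a => (x a).elim (f a) (g a)) :=
  Sum.polyList x (fun a x => x.elim (f a) (g a)) (fun _ => rfl) hf hg

theorem polyList_leafLines : PolyList (fun a : Σ p : ℕ × ℕ × ℕ × ℕ,
    Option (Lit (SVar p.1 p.2.1)) × Option (Lit (SVar p.1 p.2.1)) ×
      Option (Lit (SVar p.1 p.2.1)) × OutIdx p.1 p.2.1 p.2.2.1 p.2.2.2 =>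
    codeClauses mainCode (leafLines a.2.2.2.2 [a.2.1, a.2.2.1, a.2.2.2.1])) := by
  simp only [leafLines, codeClauses_flatMap, codeClauses_ite, codeClauses_append,
    codeClauses_sumElim, codeClauses_cons, codeClauses_nil]
  infer_instance

instance [hn : PolyMap n] [hm : PolyMap m] [hs : PolyMap s] [ht : PolyMap t]
    {c : ∀ a, OutIdx (n a) (m a) (s a) (t a)}
    {r1 r2 r3 : ∀ a, Option (Lit (SVar (n a) (m a)))} [hc : PolyMap c] [h1 : PolyMap r1]
    [h2 : PolyMap r2] [h3 : PolyMap r3] :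
    PolyList (fun a => codeClauses mainCode (leafLines (c a) [r1 a, r2 a, r3 a])) :=
  polyList_leafLines.comp (fun a => ⟨(n a, m a, s a, t a), r1 a, r2 a, r3 a, c a⟩)
    (.sigma inferInstance)

theorem polyList_branchLines : PolyList (fun a : Σ p : ℕ × ℕ × ℕ × ℕ,
    OutIdx p.1 p.2.1 p.2.2.1 p.2.2.2 => codeClauses mainCode (branchLines a.2)) := by
  simp only [branchLines, branch, codeClauses_flatMap, codeClauses_append, codeClauses_cons,
    codeClauses_nil]
  infer_instance

theorem polyList_satLines : PolyList (fun a : Σ p : ℕ × ℕ × ℕ × ℕ,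
    OutIdx p.1 p.2.1 p.2.2.1 p.2.2.2 × Fin p.2.1 =>
      codeClauses mainCode (satLines a.2.1 a.2.2)) := by
  simp only [satLines, chainLines, codeClauses_flatMap, codeClauses_append, codeClauses_cons,
    codeClauses_nil, codeClauses_map, List.length_map]
  have h := PolyList.length (fun a : Σ p : ℕ × ℕ × ℕ × ℕ,
    OutIdx p.1 p.2.1 p.2.2.1 p.2.2.2 × Fin p.2.1 => allLit (List.finRange a.1.1))
  infer_instance

theorem polyList_mainRefutation : PolyList (fun p : ℕ × ℕ × ℕ × ℕ =>
    codeClauses mainCode (mainRefutation p.1 p.2.1 p.2.2.1 p.2.2.2)) := by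
  have h1 := polyList_axiomLines
  have h2 := polyList_branchLines
  have h3 : PolyList (fun q : Σ a : (Σ p : ℕ × ℕ × ℕ × ℕ, OutIdx p.1 p.2.1 p.2.2.1 p.2.2.2),
      Fin a.1.2.1 => codeClauses mainCode (satLines q.1.2 q.2)) :=
    polyList_satLines.comp (fun q : Σ a : (Σ p : ℕ × ℕ × ℕ × ℕ,
      OutIdx p.1 p.2.1 p.2.2.1 p.2.2.2), Fin a.1.2.1 => ⟨q.1.1, q.1.2, q.2⟩) (.sigma inferInstance)
  have h := PolyList.length (fun p : ℕ × ℕ × ℕ × ℕ => outIdxs p.1 p.2.1 p.2.2.1 p.2.2.2)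
  simp only [mainRefutation, clauseLines, chainLines, codeClauses_flatMap, codeClauses_append,
    codeClauses_optionElim, codeClauses_map, List.length_map]
  infer_instance

end

/-! ### The number of lines and the size of the circuit -/

theorem length_blockLines (n m B : ℕ) :
    (blockLines n m B).length = 2 * m + 2 * n + 3 + n * (2 * n + 3) * B := by
  simp [blockLines, List.length_flatMap]
  ring

/-- The exact value of `τ`, written without subtraction and division. -/
theorem two_mul_tau (n m s : ℕ) : 2 * tau n m s + n * (2 * n + 3) * s =
    2 * s * (2 * m + 2 * n + 3) + n * (2 * n + 3) * s * s + 4 * n + 4 := by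
  have h : ∀ s, 2 * ((List.range s).map (fun B => (blockLines n m B).length)).sum +
      n * (2 * n + 3) * s = 2 * s * (2 * m + 2 * n + 3) + n * (2 * n + 3) * s * s := by
    intro s
    induction s with
    | zero => simp
    | succ s ih =>
      rw [List.range_succ, List.map_append, List.sum_append]
      simp only [List.map_cons, List.map_nil, List.sum_cons, List.sum_nil,
        length_blockLines] at ih ⊢
      linarith
  have := h s
  simp only [tau, initLines, List.length_append, List.length_flatMap, List.length_map,
    List.length_range, List.length_finRange, List.length_cons, List.length_nil]
  omega

theorem tau_le {n m s : ℕ} (hs : 1 ≤ s) (hnm : 1 ≤ n + m) :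
    tau n m s ≤ 14 * (s * (m + s * n ^ 2)) := by
  have h := two_mul_tau n m s
  have h1 : n ≤ n ^ 2 := Nat.le_self_pow (by norm_num) n
  have h2 : s ≤ s * (m + s * n ^ 2) := by
    refine Nat.le_mul_of_pos_right _ ?_
    rcases Nat.eq_zero_or_pos m with rfl | hm
    · have : 0 < n := by omega
      positivity
    · omega
  have h3 : n ^ 2 * s ≤ n ^ 2 * s * s := Nat.le_mul_of_pos_right _ (by omega)
  have h4 : n ^ 2 ≤ n ^ 2 * s := Nat.le_mul_of_pos_right _ (by omega)
  have h5 : n * s ≤ n ^ 2 * s := Nat.mul_le_mul_right _ h1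
  have h6 : n * s * s ≤ n ^ 2 * s * s := Nat.mul_le_mul_right _ h5
  have h7 : s * (m + s * n ^ 2) = s * m + n ^ 2 * s * s := by ring
  have h8 : n * (2 * n + 3) * s * s = 2 * (n ^ 2 * s * s) + 3 * (n * s * s) := by ring
  have h9 : n * (2 * n + 3) * s = 2 * (n ^ 2 * s) + 3 * (n * s) := by ring
  have h10 : 2 * s * (2 * m + 2 * n + 3) = 4 * (s * m) + 4 * (n * s) + 6 * s := by ring
  omega

theorem le_tau {n m s : ℕ} (hs : 2 ≤ s) : s * (m + s * n ^ 2) ≤ 2 * tau n m s := by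
  have h := two_mul_tau n m s
  have h7 : s * (m + s * n ^ 2) = s * m + n ^ 2 * s * s := by ring
  have h8 : n * (2 * n + 3) * s * s = 2 * (n ^ 2 * s * s) + 3 * (n * s * s) := by ring
  have h9 : n * (2 * n + 3) * s = 2 * (n ^ 2 * s) + 3 * (n * s) := by ring
  have h10 : 2 * s * (2 * m + 2 * n + 3) = 4 * (s * m) + 4 * (n * s) + 6 * s := by ring
  have h3 : n ^ 2 * s * 2 ≤ n ^ 2 * s * s := Nat.mul_le_mul_left _ hs
  have h4 : n * s * 2 ≤ n * s * s := Nat.mul_le_mul_left _ hs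
  omega

theorem Gate.depth_le {X : Type} (g : Gate X) : g.toCircuit.depth ≤ 2 := by
  have h : ∀ l : Lit X, l.toCircuit.depth ≤ 1 := by
    rintro (x | x) <;> simp [Lit.toCircuit, Circuit.depth]
  cases g with
  | const b => simp [Gate.toCircuit, Circuit.depth]
  | lit l => exact (h l).trans (by norm_num)
  | and l l' =>
    have := h l
    have := h l'
    simp only [Gate.toCircuit, Circuit.depth]
    omega

theorem Gate.size_le {X : Type} (g : Gate X) : g.toCircuit.size ≤ 5 := by
  have h : ∀ l : Lit X, l.toCircuit.size ≤ 2 := by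
    rintro (x | x) <;> simp [Lit.toCircuit, Circuit.size]
  cases g with
  | const b => simp [Gate.toCircuit, Circuit.size]
  | lit l => exact (h l).trans (by norm_num)
  | and l l' =>
    have := h l
    have := h l'
    simp only [Gate.toCircuit, Circuit.size]
    omega

/-- The list of variables is an enumeration in polynomial time, hence its length is bounded by a
polynomial. -/
theorem exists_card_outVar_le : ∃ P : Polynomial ℕ, ∀ n m s t,
    Fintype.card (OutVar n m s t) ≤ P.eval (n + m + s + t) := by
  obtain ⟨g, ⟨⟨P, hP⟩, _⟩, hg⟩ := (PolyList.length (h := polyList_outVars)).out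
  obtain ⟨B, hB⟩ := exists_bound_pair
  refine ⟨P.comp B, fun n m s t => ?_⟩
  have h1 : Fintype.card (OutVar n m s t) ≤ (outVars n m s t).length := by
    have : (outVars n m s t).toFinset = Finset.univ := by
      ext x; simp [mem_outVars]
    rw [← Finset.card_univ, ← this]
    exact List.toFinset_card_le _
  have h2 := hg (n, m, s, t)
  have h3 := hP (Enc.enc (n, m, s, t))
  rw [h2] at h3
  rw [Polynomial.eval_comp]
  have h4 : Enc.enc (n, m, s, t) ≤ B.eval (n + m + s + t) := by
    have := hB n m s t
    simp only [Enc.enc]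
    omega
  exact h1.trans (h3.trans (PolyTime.eval_le h4))

theorem exists_size_pudlak_le : ∃ p : Polynomial ℕ, ∀ n m s t : ℕ,
    ∑ z : OutVar n m s t, (pudlak n m s t z).toCircuit.size ≤ p.eval (n + m + s + t) := by
  obtain ⟨P, hP⟩ := exists_card_outVar_le
  refine ⟨5 * P, fun n m s t => ?_⟩
  refine (Finset.sum_le_card_nsmul _ _ 5 fun z _ => Gate.size_le _).trans ?_
  have e5 : (5 : Polynomial ℕ).eval (n + m + s + t) = 5 := by simp
  rw [Polynomial.eval_mul, e5, Finset.card_univ, smul_eq_mul, mul_comm]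
  exact Nat.mul_le_mul_left _ (hP n m s t)

/-! ### Sequences in which every entry follows from earlier ones -/

/-- Every entry `x` of the list satisfies `R S x`, where `S` is the set of the earlier entries
together with the elements of `prev`. -/
def Derives {α : Type} (R : Set α → α → Prop) : Set α → List α → Prop
  | _, [] => True
  | prev, x :: xs => R prev x ∧ Derives R (insert x prev) xs

namespace Derives

variable {α β : Type} {R : Set α → α → Prop}

theorem mono (hR : ∀ A B x, A ⊆ B → R A x → R B x) {xs : List α} {A B : Set α} (h : A ⊆ B)
    (hd : Derives R A xs) : Derives R B xs := by
  induction xs generalizing A B with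
  | nil => trivial
  | cons x xs ih => exact ⟨hR _ _ _ h hd.1, ih (Set.insert_subset_insert h) hd.2⟩

theorem append {xs ys : List α} {A : Set α} (h1 : Derives R A xs)
    (h2 : Derives R (A ∪ {x | x ∈ xs}) ys) : Derives R A (xs ++ ys) := by
  induction xs generalizing A with
  | nil => simpa using h2
  | cons x xs ih =>
    refine ⟨h1.1, ih h1.2 ?_⟩
    convert h2 using 1
    ext y
    simp only [Set.mem_union, Set.mem_insert_iff, Set.mem_ofPred_eq, List.mem_cons]
    tauto

theorem of_forall (hR : ∀ A B x, A ⊆ B → R A x → R B x) {xs : List α} {A : Set α}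
    (h : ∀ x ∈ xs, R A x) : Derives R A xs := by
  induction xs generalizing A with
  | nil => trivial
  | cons x xs ih =>
    exact ⟨h x (by simp), ih fun y hy => hR _ _ _ (Set.subset_insert _ _) (h y (by simp [hy]))⟩

theorem flatMap {f : β → List α} {l : List β} {A : Set α}
    (h : ∀ (i : ℕ) (hi : i < l.length),
      Derives R (A ∪ {x | ∃ (j : ℕ) (hj : j < i), x ∈ f l[j]}) (f l[i])) :
    Derives R A (l.flatMap f) := by
  induction l generalizing A with
  | nil => trivial
  | cons b l ih =>
    rw [List.flatMap_cons]
    have h0 : Derives R A (f b) := by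
      convert h 0 (by simp) using 1
      · simp
      · rfl
    refine append h0 (ih fun i hi => ?_)
    refine (iff_of_eq (congrArg (fun S => Derives R S (f l[i])) ?_)).2
      (h (i + 1) (by simpa using hi))
    ext x
    simp only [Set.mem_union, Set.mem_ofPred_eq]
    constructor
    · rintro ((h | h) | ⟨j, hj, h⟩)
      · exact .inl h
      · exact .inr ⟨0, by omega, by simpa using h⟩
      · exact .inr ⟨j + 1, by omega, by simpa using h⟩
    · rintro (h | ⟨j, hj, h⟩)
      · exact .inl (.inl h)
      · rcases j with _ | j
        · exact .inl (.inr (by simpa using h))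
        · exact .inr ⟨j, by omega, by simpa using h⟩

theorem flatMap_of_forall (hR : ∀ A B x, A ⊆ B → R A x → R B x) {f : β → List α} {l : List β}
    {A : Set α} (h : ∀ b ∈ l, Derives R A (f b)) : Derives R A (l.flatMap f) :=
  .flatMap fun i _ => (h l[i] (List.getElem_mem _)).mono hR (by simp)

theorem flatMap_range {f : ℕ → List α} {k : ℕ} {A : Set α}
    (h : ∀ i < k, Derives R (A ∪ {x | ∃ j < i, x ∈ f j}) (f i)) :
    Derives R A ((List.range k).flatMap f) := by
  refine flatMap fun i hi => ?_
  simpa using h i (by simpa using hi)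

theorem flatMap_finRange {n : ℕ} {f : Fin n → List α} {A : Set α}
    (h : ∀ i : Fin n, Derives R (A ∪ {x | ∃ j < i, x ∈ f j}) (f i)) :
    Derives R A ((List.finRange n).flatMap f) := by
  refine flatMap fun i hi => ?_
  convert h ⟨i, by simpa using hi⟩ using 1
  · ext x
    simp only [Set.mem_union, Set.mem_ofPred_eq, List.getElem_finRange]
    refine or_congr_right ⟨?_, ?_⟩
    · rintro ⟨j, hj, h⟩
      exact ⟨⟨j, by simp at hi; omega⟩, hj, h⟩
    · rintro ⟨j, hj, h⟩
      exact ⟨j, hj, h⟩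
  · simp

theorem map_range {f : ℕ → α} {k : ℕ} {A : Set α}
    (h : ∀ i < k, R (A ∪ {x | ∃ j < i, x = f j}) (f i)) :
    Derives R A ((List.range k).map f) := by
  rw [← List.flatMap_singleton' ((List.range k).map f), List.flatMap_map]
  exact flatMap_range fun i hi => ⟨by simpa using h i hi, trivial⟩

/-- In the end, the entries follow from the earlier entries of the list alone. -/
theorem getElem {xs : List α} {A : Set α} (h : Derives R A xs) (k : ℕ) (hk : k < xs.length) :
    R (A ∪ {x | x ∈ xs.take k}) xs[k] := by
  induction xs generalizing A k with
  | nil => simp at hk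
  | cons x xs ih =>
    rcases k with _ | k
    · simpa using h.1
    · refine (iff_of_eq (congrArg (fun S => R S (xs[k]'(by simpa using hk))) ?_)).1
        (ih h.2 k (by simpa using hk))
      ext y
      simp only [Set.mem_union, Set.mem_insert_iff, Set.mem_ofPred_eq, List.take_succ_cons,
        List.mem_cons]
      tauto

end Derives

/-! ### The premises of the lines precede them -/

/-- If the line `L` was obtained by a Resolution step, its premises are in `S`. -/
def Line.Premises {n : ℕ} (m s : ℕ) (S : Set (Line n)) (L : Line n) : Prop :=
  L.derived = true → (∃ K ∈ S, L.leftFrom m K = true) ∧ (∃ K ∈ S, L.rightFrom s K = true)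

section Order

variable {n m s : ℕ}

theorem Line.Premises.mono (A B : Set (Line n)) (L : Line n) (h : A ⊆ B)
    (hL : L.Premises m s A) : L.Premises m s B := fun hd =>
  let ⟨⟨K, h1, h2⟩, ⟨K', h3, h4⟩⟩ := hL hd
  ⟨⟨K, h h1, h2⟩, ⟨K', h h3, h4⟩⟩

/-- Within the lines for `B` every derived line comes after its premises, provided that `tr C` is
already there for every earlier block `C`. -/
theorem derives_blockLines (B : ℕ) (S : Set (Line n)) (hS : ∀ C < B, .tr C ∈ S) :
    Derives (Line.Premises m s) S (blockLines n m B) := by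
  have hR := Line.Premises.mono (n := n) (m := m) (s := s)
  unfold blockLines
  refine .append (.append (.append (.append ?_ ?_) ?_) ?_) ?_
  · exact .of_forall hR (by simp [Line.Premises, Line.derived])
  · refine .map_range fun k hk => ?_
    rcases k with _ | k
    · simp [Line.Premises, Line.derived]
    · intro _
      refine ⟨⟨.l2 B k, .inr ⟨k, by omega, rfl⟩, by simp [Line.leftFrom]⟩,
        ⟨.l1 B k, .inl (.inr ?_), by simp [Line.rightFrom]⟩⟩
      simp; omega
  · refine .flatMap_finRange fun i => .append ?_ ?_
    · refine .flatMap_range fun C hC => .append ?_ ?_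
      · refine .flatMap_finRange fun j => ⟨by simp [Line.Premises, Line.derived], ?_, trivial⟩
        intro _
        refine ⟨?_, ⟨.mear B C i j, .inl rfl, by simp [Line.rightFrom]⟩⟩
        obtain ⟨j, hj⟩ := j
        rcases j with _ | j
        · exact ⟨.tr C, .inr (.inl (.inl (.inl (.inl (hS C hC))))), by simp [Line.leftFrom]⟩
        · exact ⟨.r1 B C i ⟨j, by omega⟩, .inr (.inr ⟨⟨j, by omega⟩, by simp, by simp⟩),
            by simp [Line.leftFrom]⟩
      · refine ⟨by simp [Line.Premises, Line.derived], ?_, trivial⟩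
        intro _
        have := i.2
        refine ⟨⟨.mel B C i, .inl rfl, by simp [Line.leftFrom]⟩,
          ⟨.r1 B C i ⟨n - 1, by omega⟩, .inr (.inr (by simp)), ?_⟩⟩
        simp [Line.rightFrom]; omega
    · refine .map_range fun c hc => ?_
      rcases c with _ | c
      · simp [Line.Premises, Line.derived]
      · intro _
        refine ⟨⟨.r3 B i c, .inr ⟨c, by omega, rfl⟩, by simp [Line.leftFrom]⟩,
          ⟨.r2 B c i, .inl (.inr ?_), by simp [Line.rightFrom]⟩⟩
        simp; omega
  · refine .map_range fun i hi => ?_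
    rcases i with _ | i
    · simp [Line.Premises, Line.derived]
    · intro _
      refine ⟨⟨.r4 B i, .inr ⟨i, by omega, rfl⟩, by simp [Line.leftFrom]⟩,
        ⟨.r3 B ⟨i, by omega⟩ B, .inl (.inr ?_), by simp [Line.rightFrom]⟩⟩
      simp
  · refine ⟨fun _ => ⟨⟨.l2 B m, .inr ?_, by simp [Line.leftFrom]⟩,
      ⟨.r4 B n, .inr ?_, by simp [Line.rightFrom]⟩⟩, trivial⟩ <;> simp

theorem tr_mem_blockLines (B : ℕ) : .tr B ∈ blockLines n m B := by simp [blockLines]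

/-- The premises of the last lines, those that remove the literals of the root one by one. -/
theorem premises_fin (hs : 1 ≤ s) (j : ℕ) (hj : j ≤ n) (S : Set (Line n))
    (h1 : .tr (s - 1) ∈ S) (h2 : .rootEn ∈ S) (h3 : ∀ i, .re i ∈ S) (h4 : ∀ i < j, .fin i ∈ S) :
    (Line.fin j).Premises m s S := by
  intro _
  rcases j with _ | j
  · exact ⟨⟨_, h2, rfl⟩, ⟨_, h1, by simp [Line.rightFrom]; omega⟩⟩
  · exact ⟨⟨_, h4 j (by omega), by simp [Line.leftFrom]⟩,
      ⟨_, h3 ⟨j, hj⟩, by simp [Line.rightFrom]⟩⟩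

theorem derives_initLines (hs : 1 ≤ s) : Derives (Line.Premises m s) ∅ (initLines n m s) := by
  have hR := Line.Premises.mono (n := n) (m := m) (s := s)
  unfold initLines
  refine .append (.append (.append ?_ ?_) ?_) ?_
  · exact .flatMap_range fun B hB => derives_blockLines B _
      fun C hC => .inr ⟨C, hC, tr_mem_blockLines C⟩
  · exact .of_forall hR (by simp [Line.Premises, Line.derived])
  · exact .of_forall hR (by simp [Line.Premises, Line.derived])
  · refine .map_range fun j hj => premises_fin hs j hj.le _ ?_ ?_ (fun i => ?_) (fun i hi => ?_)
    · refine .inl (.inr ?_)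
      simp only [Set.mem_ofPred_eq, List.mem_append, List.mem_flatMap, List.mem_range]
      exact .inl (.inl ⟨s - 1, by omega, tr_mem_blockLines _⟩)
    · exact .inl (.inr (by simp))
    · exact .inl (.inr (by simp))
    · exact .inr ⟨i, hi, rfl⟩

/-- The bounds for the parameters of a line. -/
def Line.InRange (m s : ℕ) : Line n → Prop
  | .l1 B k => B < s ∧ k < m
  | .l2 B k => B < s ∧ k ≤ m
  | .mear B C _ _ => B < s ∧ C < B
  | .r1 B C _ _ => B < s ∧ C < B
  | .mel B C _ => B < s ∧ C < B
  | .r2 B C _ => B < s ∧ C < B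
  | .r3 B _ c => B < s ∧ c ≤ B
  | .r4 B i => B < s ∧ i ≤ n
  | .tr B => B < s
  | .fin j => j ≤ n
  | _ => True

theorem Line.inRange_of_mem {L : Line n} (h : L ∈ initLines n m s) : L.InRange m s := by
  simp only [initLines, blockLines, List.mem_append, List.mem_flatMap, List.mem_map,
    List.mem_range, List.mem_cons, List.not_mem_nil, or_false, List.mem_finRange, true_and] at h
  rcases h with ((⟨B, hB, h⟩ | rfl) | ⟨j, rfl⟩) | ⟨j, hj, rfl⟩
  · rcases h with (((⟨k, hk, rfl⟩ | ⟨k, hk, rfl⟩) | ⟨i, (⟨C, hC, ⟨j, rfl | rfl⟩ | rfl | rfl⟩ |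
      ⟨c, hc, rfl⟩)⟩) | ⟨i, hi, rfl⟩) | rfl <;> simp only [Line.InRange] <;> omega
  · trivial
  · trivial
  · exact hj.le

variable {t : ℕ}

/-- The indices of a line that occurs are in their ranges, so that the variables and clauses named
by the line exist. -/
theorem lineAt_inRange {b : ℕ} {L : Line n} (h : lineAt n m s t b = some L) : L.InRange m s := by
  unfold lineAt at h
  split_ifs at h with hb
  · cases h; exact le_rfl
  · exact Line.inRange_of_mem (List.mem_of_getElem? h)

theorem lineAt_of_lt (ht : tau n m s ≤ t) {c : ℕ} (hc : c < (initLines n m s).length) :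
    lineAt n m s t c = some (initLines n m s)[c] := by
  have : c + 1 ≠ t := by unfold tau at ht; omega
  simp [lineAt, this, hc]

/-- The premises of the line in a block are in earlier blocks. -/
theorem lineAt_premises (hs : 1 ≤ s) (ht : tau n m s ≤ t) {b : ℕ} {L : Line n}
    (h : lineAt n m s t b = some L) :
    L.Premises m s {K | ∃ c < b, lineAt n m s t c = some K} := by
  have hmem : ∀ K, K ∈ initLines n m s → b + 1 = t → ∃ c < b, lineAt n m s t c = some K := by
    intro K hK hbt
    obtain ⟨c, hc, rfl⟩ := List.getElem_of_mem hK
    exact ⟨c, by unfold tau at ht; omega, lineAt_of_lt ht hc⟩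
  by_cases hbt : b + 1 = t
  · obtain rfl : .fin n = L := by simpa [lineAt, hbt] using h
    refine premises_fin hs n le_rfl _ ?_ ?_ (fun i => ?_) (fun i hi => ?_) <;>
      refine hmem _ ?_ hbt
    · simp only [initLines, List.mem_append, List.mem_flatMap, List.mem_range]
      exact .inl (.inl (.inl ⟨s - 1, by omega, tr_mem_blockLines _⟩))
    all_goals simp [initLines]
    exact .inr hi
  · rw [lineAt, if_neg hbt] at h
    obtain ⟨hb', rfl⟩ := List.getElem?_eq_some_iff.1 h
    refine Line.Premises.mono _ _ _ ?_ ((derives_initLines hs).getElem b hb')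
    rintro K (hK | hK)
    · exact hK.elim
    · obtain ⟨c, hc, rfl⟩ := List.getElem_of_mem hK
      simp only [List.length_take] at hc
      refine ⟨c, by omega, ?_⟩
      rw [lineAt_of_lt ht (by omega)]
      simp

theorem card_lineAt (ht : tau n m s ≤ t) :
    (Finset.univ.filter (fun b : Fin t => (lineAt n m s t b).isSome = true)).card = tau n m s := by
  have htau : tau n m s = (initLines n m s).length + 1 := rfl
  have h : (Finset.univ.filter (fun b : Fin t => (lineAt n m s t b).isSome = true)) =
      insert ⟨t - 1, by omega⟩
        (Finset.univ.filter (fun b : Fin t => b.val < (initLines n m s).length)) := by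
    ext b
    have := b.2
    by_cases hb : b.val + 1 = t
    · have h1 : lineAt n m s t b = some (.fin n) := if_pos hb
      simp [h1, Fin.ext_iff]
      omega
    · have h1 : lineAt n m s t b = (initLines n m s)[b.val]? := if_neg hb
      simp [h1, Fin.ext_iff]
      omega
  rw [h, Finset.card_insert_of_notMem (by simp; omega), htau, Fin.card_filter_val_lt]
  omega

end Order

/-! ### Soundness of the lines -/

/-- The output of the gate is 1. -/
def Gate.Holds {X : Type} (ρ : X → Bool) (g : Gate X) : Prop := g.toCircuit.eval ρ = true

section Gates

variable {X : Type} {ρ : X → Bool}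

theorem Lit.eval_toCircuit (l : Lit X) : l.toCircuit.eval ρ = l.eval ρ := by cases l <;> rfl

@[simp] theorem Gate.holds_const (b : Bool) : (Gate.const b).Holds ρ ↔ b = true := Iff.rfl

@[simp] theorem Gate.holds_lit (l : Lit X) : (Gate.lit l).Holds ρ ↔ l.eval ρ = true := by
  rw [Gate.Holds, Gate.toCircuit, Lit.eval_toCircuit]

@[simp] theorem Gate.holds_and (l l' : Lit X) :
    (Gate.and l l').Holds ρ ↔ l.eval ρ = true ∧ l'.eval ρ = true := by
  simp [Gate.Holds, Gate.toCircuit, Circuit.eval, Lit.eval_toCircuit]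

@[simp] theorem Gate.holds_when (p : Prop) [Decidable p] (g : Gate X) :
    (Gate.when p g).Holds ρ ↔ p ∧ g.Holds ρ := by
  unfold Gate.when
  split_ifs with h <;> simp [h]

end Gates

section Lines

variable {n m s : ℕ} {ρ : SVar n m → Bool}

theorem eval_isOne (i : Fin n) : (isOne (m := m) i).eval ρ = ρ (.alpha i) := rfl

theorem eval_isZero (i : Fin n) : (isZero (m := m) i).eval ρ = !ρ (.alpha i) := rfl

theorem eval_trueLit (l : Lit (Fin n)) :
    (trueLit (m := m) l).eval ρ = l.eval (fun i => ρ (.alpha i)) := by cases l <;> rfl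

theorem Lit.eq_of_eval {V : Type} {ρ : V → Bool} {l l' : Lit V} (h : l.var = l'.var)
    (h1 : l.eval ρ = true) (h2 : l'.eval ρ = true) : l = l' := by
  cases l <;> cases l' <;> simp_all [Lit.var, Lit.eval]

theorem RVar.lp_inj {V I : Type} {B B' : Fin s} {C : Fin B} {C' : Fin B'} :
    (RVar.lp B C : RVar V I s) = .lp B' C' ↔ B.val = B'.val ∧ C.val = C'.val := by
  constructor
  · intro h
    cases h
    exact ⟨rfl, rfl⟩
  · obtain ⟨B, hB⟩ := B
    obtain ⟨B', hB'⟩ := B'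
    rintro ⟨h, h'⟩
    subst h
    rw [Fin.ext h']

theorem RVar.rp_inj {V I : Type} {B B' : Fin s} {C : Fin B} {C' : Fin B'} :
    (RVar.rp B C : RVar V I s) = .rp B' C' ↔ B.val = B'.val ∧ C.val = C'.val := by
  constructor
  · intro h
    cases h
    exact ⟨rfl, rfl⟩
  · obtain ⟨B, hB⟩ := B
    obtain ⟨B', hB'⟩ := B'
    rintro ⟨h, h'⟩
    subst h
    rw [Fin.ext h']

/-- A block contains at most one true literal on each variable. -/
theorem lit_inj_of_eval {ρ : Fin n → Bool} {B B' : Fin s} {l l' : Lit (Fin n)}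
    (h1 : l.eval ρ = true) (h2 : l'.eval ρ = true) :
    (B = B' ∧ l = l') ↔ B.val = B'.val ∧ l.var.val = l'.var.val := by
  refine ⟨?_, fun h => ⟨Fin.ext h.1, Lit.eq_of_eval (Fin.ext h.2) h1 h2⟩⟩
  rintro ⟨rfl, rfl⟩
  exact ⟨rfl, rfl⟩

/-- A line contains the literals of its first premise that do not get resolved. -/
theorem Line.lit_of_leftFrom {L K : Line n} (h : L.leftFrom m K = true) {v : InVar n m s}
    (hv : (L.res v).Holds ρ) {z : Lit (InVar n m s)} (hz : (K.lit z).Holds ρ) (hne : z ≠ .pos v) :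
    (L.lit z).Holds ρ := by
  unfold Line.leftFrom at h
  split at h <;> simp only [decide_eq_true_eq, Bool.false_eq_true] at h
  all_goals
    cases v <;> simp only [Line.res, Gate.holds_const, Gate.holds_when, Gate.holds_lit,
      decide_eq_true_eq, Bool.false_eq_true, eval_isOne, eval_isZero, eval_trueLit] at hv
  all_goals
    rcases z with z | z <;> cases z <;>
    simp only [Line.lit, Gate.holds_const, Gate.holds_when, Gate.holds_lit, eval_isOne,
      eval_isZero, eval_trueLit, decide_eq_true_eq, Bool.false_eq_true, ne_eq, Lit.pos.injEq,
      RVar.en.injEq, RVar.der.injEq, RVar.weak.injEq, RVar.lit.injEq, RVar.res.injEq,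
      RVar.lp_inj, RVar.rp_inj] at hz hne ⊢
  all_goals try omega
  all_goals try simp only [lit_inj_of_eval hz.2 hv.2] at hne
  all_goals try simp only [Fin.lt_def, Fin.le_def, Fin.ext_iff] at *
  all_goals try exact ⟨by omega, hz.2⟩
  all_goals grind

/-- A line contains the literals of its second premise that do not get resolved. -/
theorem Line.lit_of_rightFrom {L K : Line n} (h : L.rightFrom s K = true) {v : InVar n m s}
    (hv : (L.res v).Holds ρ) {z : Lit (InVar n m s)} (hz : (K.lit z).Holds ρ) (hne : z ≠ .neg v) :
    (L.lit z).Holds ρ := by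
  unfold Line.rightFrom at h
  split at h <;> simp only [decide_eq_true_eq, Bool.false_eq_true] at h
  all_goals
    cases v <;> simp only [Line.res, Gate.holds_const, Gate.holds_when, Gate.holds_lit,
      decide_eq_true_eq, Bool.false_eq_true, eval_isOne, eval_isZero, eval_trueLit] at hv
  all_goals
    rcases z with z | z <;> cases z <;>
    simp only [Line.lit, Gate.holds_const, Gate.holds_when, Gate.holds_lit, eval_isOne,
      eval_isZero, eval_trueLit, decide_eq_true_eq, Bool.false_eq_true, ne_eq, Lit.neg.injEq,
      RVar.en.injEq, RVar.der.injEq, RVar.weak.injEq, RVar.lit.injEq, RVar.res.injEq,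
      RVar.lp_inj, RVar.rp_inj] at hz hne ⊢
  all_goals try omega
  all_goals try simp only [lit_inj_of_eval hz.2 hv.2] at hne
  all_goals try simp only [Fin.lt_def, Fin.le_def, Fin.ext_iff] at *
  all_goals try exact ⟨by omega, hz.2⟩
  all_goals try omega
  all_goals grind

theorem Lit.exists_eval {V : Type} (ρ : V → Bool) (v : V) :
    ∃ l : Lit V, l.var = v ∧ l.eval ρ = true := by
  cases h : ρ v
  · exact ⟨.neg v, rfl, by simp [Lit.eval, h]⟩
  · exact ⟨.pos v, rfl, by simp [Lit.eval, h]⟩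

/-- A line contains the axiom it is a weakening of. -/
theorem Line.lit_of_weak {L : Line n} {a : InIdx n m s} (h : (L.weak a.1).Holds ρ)
    {z : Lit (InVar n m s)} (hz : z.map Sum.inl ∈ refCNF (phi n m) s a) : (L.lit z).Holds ρ := by
  obtain ⟨a, ha⟩ := a
  simp only [refCNF] at hz h
  clear ha
  unfold Line.weak at h
  split at h <;> simp only [Gate.holds_const, Gate.holds_when, Gate.holds_lit, Gate.holds_and,
    decide_eq_true_eq, Bool.false_eq_true, eval_isOne, eval_isZero, eval_trueLit] at h
  all_goals
    rcases z with z | z <;> cases z <;>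
    simp [refClause, Lit.map, phi, earlier, RVar.lp_inj, RVar.rp_inj, -RVar.lp.injEq,
      -RVar.rp.injEq] at hz
  all_goals
    simp only [Line.lit, Gate.holds_const, Gate.holds_when, Gate.holds_lit, eval_isOne,
      eval_isZero, eval_trueLit, decide_eq_true_eq]
  all_goals try simp only [Fin.ext_iff] at *
  all_goals try omega
  all_goals grind

/-- The clause of `φ` weakened by a line contains the literal it should. -/
theorem Line.guard_of_weak {L : Line n} {a : InIdx n m s} (h : (L.weak a.1).Holds ρ)
    {g : Lit (SVar n m)} (hg : g.compl.map Sum.inr ∈ refCNF (phi n m) s a) : g.eval ρ = true := by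
  obtain ⟨a, ha⟩ := a
  simp only [refCNF] at hg h
  clear ha
  unfold Line.weak at h
  split at h <;> simp only [Gate.holds_const, Gate.holds_when, Gate.holds_lit, Gate.holds_and,
    decide_eq_true_eq, Bool.false_eq_true, eval_isOne, eval_isZero, eval_trueLit] at h
  all_goals
    rcases g with g | g <;> simp [refClause, Lit.map, Lit.compl, phi] at hg
  all_goals grind [Lit.eval]

/-- A derived line is resolved over some variable, and the value of a gate saying so depends on
the branching variables only. -/
theorem Line.exists_res {L : Line n} (hL : L.InRange m s) (hs : 1 ≤ s) (hd : L.derived = true) :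
    ∃ v : InVar n m s, (L.res v).Holds ρ ∧ ∀ x ∈ (L.res v).vars, x ∈ L.branchVars (m := m) := by
  unfold Line.derived at hd
  split at hd <;> simp only [Line.InRange] at hL
  case h_1 B k => exact ⟨.weak ⟨B, by omega⟩ ⟨k, by omega⟩, by simp [Line.res, Gate.vars]⟩
  case h_2 B C i j =>
    obtain ⟨l, hl, h⟩ := Lit.exists_eval (fun i => ρ (.alpha i)) j
    exact ⟨.lit ⟨C, by omega⟩ l, by simp [Line.res, hl, h, eval_trueLit], by
      cases l <;> simp_all [Line.res, Line.branchVars, Gate.vars, Gate.when, trueLit, Lit.var]⟩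
  case h_3 B C i => exact ⟨.en ⟨C, by omega⟩, by simp [Line.res, Gate.vars]⟩
  case h_4 B i c =>
    cases h : ρ (.alpha i)
    · exact ⟨.lp ⟨B, by omega⟩ ⟨c, by show c < B; omega⟩, by
        simp [Line.res, Gate.vars, Gate.when, Line.branchVars, isZero, Lit.eval, Lit.var, h]⟩
    · exact ⟨.rp ⟨B, by omega⟩ ⟨c, by show c < B; omega⟩, by
        simp [Line.res, Gate.vars, Gate.when, Line.branchVars, isOne, Lit.eval, Lit.var, h]⟩
  case h_5 B i => exact ⟨.res ⟨B, by omega⟩ ⟨i, by omega⟩, by simp [Line.res, Gate.vars]⟩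
  case h_6 B => exact ⟨.der ⟨B, by omega⟩, by simp [Line.res, Gate.vars]⟩
  case h_7 j =>
    rcases j with _ | j
    · exact ⟨.en ⟨s - 1, by omega⟩, by simp [Line.res, Gate.vars]; omega⟩
    · obtain ⟨l, hl, h⟩ := Lit.exists_eval (fun i => ρ (.alpha i)) ⟨j, hL⟩
      refine ⟨.lit ⟨s - 1, by omega⟩ l, by simp [Line.res, hl, h, eval_trueLit]; omega, ?_⟩
      have hs1 : s - 1 + 1 = s := by omega
      have hj : j < n := hL
      cases l <;> simp_all [Line.res, Line.branchVars, Gate.vars, Gate.when, trueLit, Lit.var]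
  all_goals simp at hd

/-- A line that is not derived, other than `l1`, is a weakening of some axiom, and the value of a
gate saying so depends on the branching variables only. -/
theorem Line.exists_weak {L : Line n} (hL : L.InRange m s) (hs : 1 ≤ s) (hd : L.derived = false)
    (h1 : L.l1Clause = none) :
    ∃ a : InIdx n m s, (L.weak a.1).Holds ρ ∧
      ∀ x ∈ (L.weak a.1).vars, x ∈ L.branchVars (m := m) := by
  rcases L with ⟨B, k⟩ | ⟨B, _ | k⟩ | ⟨B, C, i, j⟩ | ⟨B, C, i, j⟩ | ⟨B, C, i⟩ | ⟨B, C, i⟩ |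
    ⟨B, i, _ | c⟩ | ⟨B, _ | i⟩ | B | _ | j | j
  · simp [Line.l1Clause] at h1
  · exact ⟨⟨.mustWeak ⟨B, hL.1⟩, rfl⟩, by simp [Line.weak, Gate.vars]⟩
  · simp [Line.derived] at hd
  · obtain ⟨l, hl, h⟩ := Lit.exists_eval (fun i => ρ (.alpha i)) j
    obtain ⟨hB, hC⟩ : B < s ∧ C < B := hL
    cases hi : ρ (.alpha i)
    · refine ⟨⟨.left ⟨B, hB⟩ ⟨C, hC⟩ i l, ?_⟩, ?_, ?_⟩
      · simp only [refOk, decide_eq_true_eq]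
        rintro rfl
        simp [Lit.eval, hi] at h
      · simp [Line.weak, hl, h, hi, eval_isZero, eval_trueLit]
      · subst hl
        cases l <;> simp [Line.weak, Line.branchVars, Gate.vars, Gate.when, trueLit, Lit.var,
          isZero]
    · refine ⟨⟨.right ⟨B, hB⟩ ⟨C, hC⟩ i l, ?_⟩, ?_, ?_⟩
      · simp only [refOk, decide_eq_true_eq]
        rintro rfl
        simp [Lit.eval, hi] at h
      · simp [Line.weak, hl, h, hi, eval_isOne, eval_trueLit]
      · subst hl
        cases l <;> simp [Line.weak, Line.branchVars, Gate.vars, Gate.when, trueLit, Lit.var,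
          isOne]
  · simp [Line.derived] at hd
  · obtain ⟨hB, hC⟩ : B < s ∧ C < B := hL
    cases hi : ρ (.alpha i)
    · exact ⟨⟨.enLeft ⟨B, hB⟩ ⟨C, hC⟩, rfl⟩, by
        simp [Line.weak, Gate.vars, Gate.when, Line.branchVars, isZero, Lit.eval, Lit.var, hi]⟩
    · exact ⟨⟨.enRight ⟨B, hB⟩ ⟨C, hC⟩, rfl⟩, by
        simp [Line.weak, Gate.vars, Gate.when, Line.branchVars, isOne, Lit.eval, Lit.var, hi]⟩
  · simp [Line.derived] at hd
  · cases hi : ρ (.alpha i)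
    · exact ⟨⟨.mustLeft ⟨B, hL.1⟩, rfl⟩, by
        simp [Line.weak, Gate.vars, Gate.when, Line.branchVars, isZero, Lit.eval, Lit.var, hi]⟩
    · exact ⟨⟨.mustRight ⟨B, hL.1⟩, rfl⟩, by
        simp [Line.weak, Gate.vars, Gate.when, Line.branchVars, isOne, Lit.eval, Lit.var, hi]⟩
  · simp [Line.derived] at hd
  · exact ⟨⟨.mustRes ⟨B, hL.1⟩, rfl⟩, by simp [Line.weak, Gate.vars]⟩
  · simp [Line.derived] at hd
  · simp [Line.derived] at hd
  · exact ⟨⟨.rootEn ⟨s - 1, by omega⟩, by simp [refOk]; omega⟩, by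
      simp [Line.weak, Gate.vars]; omega⟩
  · obtain ⟨l, hl, h⟩ := Lit.exists_eval (fun i => ρ (.alpha i)) j
    have hs1 : s - 1 + 1 = s := by omega
    refine ⟨⟨.rootEmpty ⟨s - 1, by omega⟩ l, by simp [refOk, hs1]⟩, ?_, ?_⟩
    · simp [Line.weak, hl, h, eval_trueLit, hs1]
    · cases l <;> simp_all [Line.weak, Line.branchVars, Gate.vars, Gate.when, trueLit, Lit.var]
  · simp [Line.derived] at hd

end Lines

/-! ### A true literal in every clause -/

section TrueLit

variable {n m s t : ℕ}

/-- The values of the variables of `Ref_t(Ref_s(φ), π)` for `π = P(φ, α, s)`, given those of the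
variables of `Sat(φ, α)`. -/
def outEval (ρ : SVar n m → Bool) (w : OutVar n m s t ⊕ SVar n m) : Bool :=
  (outGate w).toCircuit.eval ρ

variable {ρ : SVar n m → Bool}

theorem eval_outEval_pos (w : OutVar n m s t ⊕ SVar n m) :
    (Lit.pos w).eval (outEval ρ) = true ↔ (outGate w).Holds ρ := Iff.rfl

theorem eval_outEval_neg (w : OutVar n m s t ⊕ SVar n m) :
    (Lit.neg w).eval (outEval ρ) = true ↔ ¬(outGate w).Holds ρ := by
  simp [Lit.eval, outEval, Gate.Holds]

theorem lineAt_last {b : ℕ} (h : b + 1 = t) : lineAt n m s t b = some (.fin n) := if_pos h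

/-- Every clause other than those labelled `mustRes` and `mustWeak` contains a true literal. This
is the soundness of the lines, read off for the block the clause is about. -/
theorem exists_true_lit_of_longBlock (hs : 1 ≤ s) (ht : tau n m s ≤ t) (c : OutIdx n m s t)
    (hc : c.1.longBlock = none) : ∃ l ∈ refRef n m s t c, l.eval (outEval ρ) = true := by
  obtain ⟨a, ha⟩ := c
  simp only [refRef, refCNF]
  simp only at hc
  -- the clauses that contain the negation of `en b` are satisfied if the block is disabled
  have hen : ∀ b : Fin t, Lit.neg (Sum.inl (RVar.en b)) ∈ refClause (refPhi n m s) t a →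
      (∀ L, lineAt n m s t b = some L →
        ∃ l ∈ refClause (refPhi n m s) t a, l.eval (outEval ρ) = true) →
      ∃ l ∈ refClause (refPhi n m s) t a, l.eval (outEval ρ) = true := by
    intro b hb h
    cases hL : lineAt n m s t b with
    | none => exact ⟨_, hb, by simp [eval_outEval_neg, outGate, pudlak, hL]⟩
    | some L => exact h L hL
  cases a with
  | left b c v l =>
    refine hen b (by simp [refClause]) fun L hL => ?_
    by_contra! hcon
    have h1 := hcon (.neg (.inl (.res b v))) (by simp [refClause])
    have h2 := hcon (.neg (.inl (.lp b c))) (by simp [refClause])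
    have h3 := hcon (.neg (.inl (.lit (earlier b c) l))) (by simp [refClause])
    have h4 := hcon (.pos (.inl (.lit b l))) (by simp [refClause])
    rw [ne_eq, eval_outEval_neg, not_not] at h1 h2 h3
    rw [ne_eq, eval_outEval_pos] at h4
    simp only [outGate, pudlak, hL, earlier] at h1 h2 h3 h4
    cases hK : lineAt n m s t c with
    | none => simp [hK] at h2
    | some K =>
      simp only [hK, Gate.holds_const] at h2 h3
      exact h4 (Line.lit_of_leftFrom h2 h1 h3 (by simpa [refOk] using ha))
  | right b c v l =>
    refine hen b (by simp [refClause]) fun L hL => ?_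
    by_contra! hcon
    have h1 := hcon (.neg (.inl (.res b v))) (by simp [refClause])
    have h2 := hcon (.neg (.inl (.rp b c))) (by simp [refClause])
    have h3 := hcon (.neg (.inl (.lit (earlier b c) l))) (by simp [refClause])
    have h4 := hcon (.pos (.inl (.lit b l))) (by simp [refClause])
    rw [ne_eq, eval_outEval_neg, not_not] at h1 h2 h3
    rw [ne_eq, eval_outEval_pos] at h4
    simp only [outGate, pudlak, hL, earlier] at h1 h2 h3 h4
    cases hK : lineAt n m s t c with
    | none => simp [hK] at h2
    | some K =>
      simp only [hK, Gate.holds_const] at h2 h3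
      exact h4 (Line.lit_of_rightFrom h2 h1 h3 (by simpa [refOk] using ha))
  | weak b A l =>
    refine hen b (by simp [refClause]) fun L hL => ?_
    have hA : l.map Sum.inl ∈ refCNF (phi n m) s A := by
      rw [refOk_refPhi_weak] at ha
      exact (mem_inClause _ _).1 (by simpa using ha)
    by_cases hw : (L.weak A.1).Holds ρ
    · exact ⟨.pos (.inl (.lit b l)), by simp [refClause], by
        simpa [eval_outEval_pos, outGate, pudlak, hL] using Line.lit_of_weak hw hA⟩
    · exact ⟨.neg (.inl (.weak b A)), by simp [refClause], by
        simpa [eval_outEval_neg, outGate, pudlak, hL] using hw⟩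
  | mustRes b => simp [RAx.longBlock] at hc
  | mustWeak b => simp [RAx.longBlock] at hc
  | mustLeft b =>
    refine hen b (by simp [refClause]) fun L hL => ?_
    by_cases hd : L.derived = true
    · obtain ⟨⟨K, ⟨c, hc, hK⟩, h⟩, -⟩ := lineAt_premises hs ht hL hd
      exact ⟨.pos (.inl (.lp b ⟨c, hc⟩)), by simp [refClause], by
        simpa [eval_outEval_pos, outGate, pudlak, hL, hK] using h⟩
    · exact ⟨.neg (.inl (.der b)), by simp [refClause], by
        simpa [eval_outEval_neg, outGate, pudlak, hL] using hd⟩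
  | mustRight b =>
    refine hen b (by simp [refClause]) fun L hL => ?_
    by_cases hd : L.derived = true
    · obtain ⟨-, ⟨K, ⟨c, hc, hK⟩, h⟩⟩ := lineAt_premises hs ht hL hd
      exact ⟨.pos (.inl (.rp b ⟨c, hc⟩)), by simp [refClause], by
        simpa [eval_outEval_pos, outGate, pudlak, hL, hK] using h⟩
    · exact ⟨.neg (.inl (.der b)), by simp [refClause], by
        simpa [eval_outEval_neg, outGate, pudlak, hL] using hd⟩
  | enLeft b c =>
    refine hen b (by simp [refClause]) fun L hL => ?_
    cases hK : lineAt n m s t c with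
    | none => exact ⟨.neg (.inl (.lp b c)), by simp [refClause], by
        simp [eval_outEval_neg, outGate, pudlak, hL, hK]⟩
    | some K => exact ⟨.pos (.inl (.en (earlier b c))), by simp [refClause], by
        simp [eval_outEval_pos, outGate, pudlak, earlier, hK]⟩
  | enRight b c =>
    refine hen b (by simp [refClause]) fun L hL => ?_
    cases hK : lineAt n m s t c with
    | none => exact ⟨.neg (.inl (.rp b c)), by simp [refClause], by
        simp [eval_outEval_neg, outGate, pudlak, hL, hK]⟩
    | some K => exact ⟨.pos (.inl (.en (earlier b c))), by simp [refClause], by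
        simp [eval_outEval_pos, outGate, pudlak, earlier, hK]⟩
  | rootEmpty b l =>
    have hb := lineAt_last (n := n) (m := m) (s := s) (show b.val + 1 = t by simpa [refOk] using ha)
    refine ⟨_, Finset.mem_singleton_self _, ?_⟩
    rcases l with z | z <;> cases z <;>
      simp [eval_outEval_neg, outGate, pudlak, hb, Line.lit]
  | rootEn b =>
    have hb := lineAt_last (n := n) (m := m) (s := s) (show b.val + 1 = t by simpa [refOk] using ha)
    exact ⟨_, Finset.mem_singleton_self _, by simp [eval_outEval_pos, outGate, pudlak, hb]⟩
  | guard b A g =>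
    refine hen b (by simp [refClause]) fun L hL => ?_
    by_cases hw : (L.weak A.1).Holds ρ
    · have hg : g.compl.map Sum.inr ∈ refCNF (phi n m) s A := by
        rw [← mem_inClause, ← mem_refPhi_guard]; simpa [refOk] using ha
      refine ⟨g.map .inr, by simp [refClause], ?_⟩
      have := Line.guard_of_weak hw hg
      rcases g with g | g <;> exact this
    · exact ⟨.neg (.inl (.weak b A)), by simp [refClause], by
        simpa [eval_outEval_neg, outGate, pudlak, hL] using hw⟩

/-- Every clause of `Ref_t(Ref_s(φ), π)` that does not need a true literal of a clause of `φ`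
contains a literal that is true because of the values of the branching variables. -/
theorem exists_true_lit (hs : 1 ≤ s) (ht : tau n m s ≤ t) (c : OutIdx n m s t)
    (hc : satClause c = none) : ∃ l ∈ refRef n m s t c, l.eval (outEval ρ) = true ∧
      ∀ x ∈ (outGate l.var).vars, x ∈ branchVars c := by
  cases hb : c.1.longBlock with
  | none =>
    obtain ⟨l, hl, h⟩ := exists_true_lit_of_longBlock (ρ := ρ) hs ht c hb
    refine ⟨l, hl, h, fun x hx => ?_⟩
    simp only [branchVars, hb, Option.elim_none, List.mem_flatMap]
    exact ⟨l, (mem_outClause c l).2 hl, hx⟩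
  | some b =>
    have hbv : branchVars c = (lineAt n m s t b).elim [] Line.branchVars := by
      simp [branchVars, hb]
    rw [hbv]
    simp only [refRef, refCNF]
    obtain ⟨a, ha⟩ := c
    cases a <;> simp only [RAx.longBlock, Option.some.injEq, reduceCtorEq] at hb
    · subst hb
      rename_i b
      cases hL : lineAt n m s t b with
      | none => exact ⟨.neg (.inl (.en b)), by simp [refClause], by
          simp [eval_outEval_neg, outGate, pudlak, hL], by
          simp [Lit.var, outGate, pudlak, Gate.vars]⟩
      | some L =>
        by_cases hd : L.derived = true
        · obtain ⟨v, h1, h2⟩ := Line.exists_res (ρ := ρ) (lineAt_inRange hL) hs hd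
          exact ⟨.pos (.inl (.res b v)), by simp [refClause], by
            simpa [eval_outEval_pos, outGate, pudlak, hL] using h1, by
            simpa [Lit.var, outGate, pudlak, hL] using h2⟩
        · exact ⟨.neg (.inl (.der b)), by simp [refClause], by
            simpa [eval_outEval_neg, outGate, pudlak, hL] using hd, by
            simp [Lit.var, outGate, pudlak, hL, Gate.vars]⟩
    · subst hb
      rename_i b
      cases hL : lineAt n m s t b with
      | none => exact ⟨.neg (.inl (.en b)), by simp [refClause], by
          simp [eval_outEval_neg, outGate, pudlak, hL], by
          simp [Lit.var, outGate, pudlak, Gate.vars]⟩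
      | some L =>
        have hr := lineAt_inRange hL
        have h1 : L.l1Clause = none := by
          rcases L <;> simp only [Line.l1Clause]
          simp [satClause, RAx.weakBlock, hL, Line.l1Clause] at hc
          exact absurd hr.2 (by omega)
        cases hd : L.derived with
        | false =>
          obtain ⟨A, h1, h2⟩ := Line.exists_weak (ρ := ρ) hr hs hd h1
          exact ⟨.pos (.inl (.weak b A)), by simp [refClause], by
            simpa [eval_outEval_pos, outGate, pudlak, hL] using h1, by
            simpa [Lit.var, outGate, pudlak, hL] using h2⟩
        | true => exact ⟨.pos (.inl (.der b)), by simp [refClause], by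
            simpa [eval_outEval_pos, outGate, pudlak, hL] using hd, by
            simp [Lit.var, outGate, pudlak, hL, Gate.vars]⟩

/-- The other clauses contain a literal saying that a line is a weakening, because of `l`, of a
clause of `Ref_s(φ)`, for each literal `l`. -/
theorem exists_satClause_lit {c : OutIdx n m s t} {A : Fin m} (hc : satClause c = some A)
    (l : Lit (Fin n)) : ∃ z : OutVar n m s t, Lit.pos (Sum.inl z) ∈ refRef n m s t c ∧
      pudlak n m s t z = .and (.pos (.alit A l)) (trueLit l) := by
  obtain ⟨a, ha⟩ := c
  cases a <;> simp only [satClause, RAx.weakBlock, Option.elim_none, Option.elim_some,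
    reduceCtorEq] at hc
  rename_i b
  cases hL : lineAt n m s t b with
  | none => simp [hL] at hc
  | some L =>
    have hr := lineAt_inRange hL
    rcases L <;> simp only [hL, Option.elim_some, Line.l1Clause, Option.elim_none,
      reduceCtorEq] at hc
    rename_i B k
    obtain ⟨hB, hk⟩ := hr
    obtain rfl : ⟨k, hk⟩ = A := by simpa [hk] using hc
    refine ⟨.weak b ⟨.weak ⟨B, hB⟩ ⟨k, hk⟩ l, rfl⟩, ?_, ?_⟩
    · simp [refRef, refCNF, refClause]
    · simp [pudlak, hL, Line.weak, Gate.when]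

end TrueLit

/-! ### The construction gives a refutation -/

section Correctness

variable {n m s t : ℕ}

theorem pudlakOutput_eq_outEval (φ : Fin m → Clause (Fin n)) (α : Fin n → Bool) :
    pudlakOutput s t φ α = outEval (describe φ α) := by
  funext w
  rcases w with z | x <;> rfl

/-- The assumption that `α` satisfies `φ` is used only for the clauses `mustWeak` about a line
`l1`, which name the literals of a clause of `φ`. -/
theorem sat_refRef (hs : 1 ≤ s) (ht : tau n m s ≤ t) {φ : Fin m → Clause (Fin n)}
    {α : Fin n → Bool} (hφ : ∀ A, (φ A).Sat α) (c : OutIdx n m s t) :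
    (refRef n m s t c).Sat (pudlakOutput s t φ α) := by
  rw [pudlakOutput_eq_outEval]
  cases hc : satClause c with
  | none =>
    obtain ⟨l, hl, h, -⟩ := exists_true_lit (ρ := describe φ α) hs ht c hc
    exact ⟨l, hl, h⟩
  | some A =>
    obtain ⟨l, hl, h⟩ := hφ A
    obtain ⟨z, hz, hg⟩ := exists_satClause_lit hc l
    refine ⟨_, hz, ?_⟩
    rw [eval_outEval_pos, outGate, hg, Gate.holds_and, eval_trueLit]
    exact ⟨by simpa [Lit.eval, describe] using hl, h⟩

theorem card_enabled (ht : tau n m s ≤ t) (φ : Fin m → Clause (Fin n)) (α : Fin n → Bool) :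
    (Finset.univ.filter (fun b : Fin t =>
      pudlakOutput s t φ α (.inl (.en b)) = true)).card = tau n m s :=
  card_lineAt ht

end Correctness

/-! ### Resolution on clauses given by lists -/

/-- The clause `D` follows in one Resolution step over the clauses `F` and the clauses in `S`. -/
def ResFrom {V : Type} [DecidableEq V] (F : Set (Clause V)) (S : Set (List (Lit V)))
    (D : List (Lit V)) : Prop :=
  D.toFinset ∈ F ∨ (∃ C ∈ S, C ⊆ D) ∨
    ∃ C ∈ S, ∃ C' ∈ S, ∃ x : V, Lit.pos x ∈ C ∧ Lit.neg x ∈ C' ∧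
      D.toFinset = C.toFinset.erase (Lit.pos x) ∪ C'.toFinset.erase (Lit.neg x)

section Resolution

variable {V : Type}

theorem mem_chainLines (A l : List (Lit V)) : A ∈ chainLines A l := by
  simp only [chainLines, List.mem_map, List.mem_range]
  exact ⟨l.length, by omega, by simp⟩

variable {X : Type} {e : X → V}

@[simp] theorem negs_cons (o : Option (Lit X)) (r : List (Option (Lit X))) :
    negs e (o :: r) = o.toList.map (fun l => (l.map e).compl) ++ negs e r := rfl

@[simp] theorem negs_nil : negs e ([] : List (Option (Lit X))) = [] := rfl

theorem mem_negs {r : List (Option (Lit X))} {l : Lit X} (h : some l ∈ r) :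
    (l.map e).compl ∈ negs e r := by
  simp only [negs, List.mem_flatMap, List.mem_map]
  exact ⟨_, h, l, by simp, rfl⟩

theorem mem_branch (v : Option X) (A : List (Lit V)) (f : Option (Lit X) → List (List (Lit V))) :
    A ∈ branch v A f := by simp [branch]

variable [DecidableEq V] {F : Set (Clause V)} {S : Set (List (Lit V))}

theorem ResFrom.mono (A B : Set (List (Lit V))) (D : List (Lit V)) (h : A ⊆ B)
    (hD : ResFrom F A D) : ResFrom F B D := by
  rcases hD with hD | ⟨C, hC, hD⟩ | ⟨C, hC, C', hC', hD⟩
  · exact .inl hD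
  · exact .inr (.inl ⟨C, h hC, hD⟩)
  · exact .inr (.inr ⟨C, h hC, C', h hC', hD⟩)

theorem ResFrom.weaken {C D : List (Lit V)} (hC : C ∈ S) (h : C ⊆ D) : ResFrom F S D :=
  .inr (.inl ⟨C, hC, h⟩)

/-- Resolution over a literal of either sign. -/
theorem ResFrom.resolve {C C' D : List (Lit V)} (a : Lit V) (hC : C ∈ S) (hC' : C' ∈ S)
    (ha : a ∈ C) (ha' : a.compl ∈ C')
    (h : ∀ l, l ∈ D ↔ (l ∈ C ∧ l ≠ a) ∨ (l ∈ C' ∧ l ≠ a.compl)) : ResFrom F S D := by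
  refine .inr (.inr ?_)
  cases a with
  | pos x =>
    refine ⟨C, hC, C', hC', x, ha, ha', ?_⟩
    ext l
    simp only [List.mem_toFinset, h, Finset.mem_union, Finset.mem_erase, Lit.compl]
    tauto
  | neg x =>
    refine ⟨C', hC', C, hC, x, ha', ha, ?_⟩
    ext l
    simp only [List.mem_toFinset, h, Finset.mem_union, Finset.mem_erase, Lit.compl]
    tauto

theorem isRefutation_of_derives {Q : List (List (Lit V))} (h : Derives (ResFrom F) ∅ Q)
    (hQ : Q.getLast? = some []) : IsRefutation F (Q.map List.toFinset) := by
  refine ⟨fun k hk => ?_, by simp [List.getLast?_map, hQ]⟩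
  have hk' : k < Q.length := by simpa using hk
  have hmem : ∀ C ∈ ((∅ : Set (List (Lit V))) ∪ {x | x ∈ Q.take k}),
      C.toFinset ∈ (Q.map List.toFinset).take k := by
    rintro C (hC | hC)
    · exact hC.elim
    · rw [← List.map_take]
      exact List.mem_map_of_mem hC
  rw [List.getElem_map]
  rcases h.getElem k hk' with hD | ⟨C, hC, hD⟩ | ⟨C, hC, C', hC', x, h1, h2, h3⟩
  · exact .inl hD
  · exact .inr (.inl ⟨_, hmem C hC, fun l hl => by
      simp only [List.mem_toFinset] at hl ⊢; exact hD hl⟩)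
  · exact .inr (.inr ⟨_, hmem C hC, _, hmem C' hC', x, by simpa using h1, by simpa using h2, h3⟩)

/-- The literals of `l` are resolved away one by one. -/
theorem derives_chainLines {A l : List (Lit V)} (h0 : ∃ C ∈ S, C ⊆ A ++ l)
    (hl : ∀ a ∈ l, ∃ C ∈ S, a.compl ∈ C ∧ C ⊆ a.compl :: A) :
    Derives (ResFrom F) S (chainLines A l) := by
  refine .map_range fun j hj => ?_
  rcases j with _ | j
  · obtain ⟨C, hC, h⟩ := h0
    exact .weaken (.inl hC) (by simpa using h)
  · have hj' : j < l.length := by omega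
    obtain ⟨C, hC, h1, h2⟩ := hl l[j] (List.getElem_mem _)
    have hd : l.drop j = l[j] :: l.drop (j + 1) := List.drop_eq_getElem_cons hj'
    have hp : A ++ l.drop j ∈ S ∪ {x | ∃ i < j + 1, x = A ++ l.drop i} := .inr ⟨j, by omega, rfl⟩
    by_cases hm : l[j] ∈ A ++ l.drop (j + 1)
    · refine .weaken hp fun a ha => ?_
      rw [hd] at ha
      simp only [List.mem_append, List.mem_cons] at ha hm ⊢
      rcases ha with ha | rfl | ha <;> tauto
    · refine .resolve l[j] hp (.inl hC)
        (by rw [hd]; simp only [List.mem_append, List.mem_cons, true_or, or_true]) h1 fun a => ?_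
      rw [hd]
      simp only [List.mem_append, List.mem_cons] at hm ⊢
      constructor
      · intro ha
        left
        refine ⟨by tauto, ?_⟩
        rintro rfl
        exact hm ha
      · rintro (⟨ha, hne⟩ | ⟨ha, hne⟩)
        · tauto
        · have := h2 ha
          simp only [List.mem_cons] at this
          tauto

/-- The clauses for both values of the branching variable are resolved with each other. -/
theorem derives_branch {v : Option X} {A : List (Lit V)} {f : Option (Lit X) → List (List (Lit V))}
    (h : ∀ r ∈ choices v, Derives (ResFrom F) S (f r) ∧ A ++ negs e [r] ∈ f r) :
    Derives (ResFrom F) S (branch v A f) := by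
  refine .append (.flatMap_of_forall ResFrom.mono fun r hr => (h r hr).1) ⟨?_, trivial⟩
  have hmem : ∀ r ∈ choices v, A ++ negs e [r] ∈ S ∪ {x | x ∈ (choices v).flatMap f} :=
    fun r hr => .inr (List.mem_flatMap.2 ⟨r, hr, (h r hr).2⟩)
  rcases v with _ | x
  · exact .weaken (hmem none (by simp [choices])) (by simp)
  · refine .resolve (.pos (e x)) (hmem (some (.neg x)) (by simp [choices]))
      (hmem (some (.pos x)) (by simp [choices])) (by simp [Lit.map, Lit.compl])
      (by simp [Lit.map, Lit.compl]) fun l => ?_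
    simp only [negs_cons, negs_nil, Option.toList_some, List.map_cons, List.map_nil,
      List.append_nil, List.mem_append, List.mem_singleton, Lit.map, Lit.compl]
    constructor
    · intro hl
      by_cases h1 : l = .pos (e x)
      · subst h1
        exact .inr ⟨.inl hl, by simp⟩
      · exact .inl ⟨.inl hl, h1⟩
    · tauto

end Resolution

/-! ### The refutation is correct -/

section Refutation

variable {n m s t : ℕ}

theorem Lit.map_pos {V W : Type} (f : V → W) (v : V) : (Lit.pos v).map f = .pos (f v) := rfl

theorem Lit.map_neg {V W : Type} (f : V → W) (v : V) : (Lit.neg v).map f = .neg (f v) := rfl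

theorem Lit.var_pos {V : Type} (v : V) : (Lit.pos v).var = v := rfl

theorem Lit.var_neg {V : Type} (v : V) : (Lit.neg v).var = v := rfl

theorem outGate_inl (z : OutVar n m s t) : outGate (.inl z) = pudlak n m s t z := rfl

theorem toFinset_map_image {V W : Type} [DecidableEq V] [DecidableEq W] (f : V → W)
    (D : List (Lit V)) : (D.map (Lit.map f)).toFinset = Clause.rename f D.toFinset := by
  ext l
  simp [Clause.rename]

theorem mem_axiomLines_sat (A : Fin m) (l : Lit (Fin n)) :
    [Lit.neg (mainSVar (SVar.sat A l)), .pos (mainSVar (.alit A l))] ∈ axiomLines n m s t ∧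
      [Lit.neg (mainSVar (SVar.sat A l)), (trueLit l).map mainSVar] ∈ axiomLines n m s t := by
  have hl : l ∈ allLit (List.finRange n) := (mem_allLit l).2 (by simp)
  simp only [axiomLines, List.mem_append, List.mem_flatMap]
  exact ⟨.inl (.inl (.inl ⟨A, by simp, .inl ⟨l, hl, by simp⟩⟩)),
    .inl (.inl (.inl ⟨A, by simp, .inl ⟨l, hl, by simp⟩⟩))⟩

theorem mem_axiomLines_satClause (A : Fin m) :
    (allLit (List.finRange n)).map (fun l => Lit.pos (mainSVar (SVar.sat A l))) ∈
      axiomLines n m s t := by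
  simp only [axiomLines, List.mem_append, List.mem_flatMap]
  exact .inl (.inl (.inl ⟨A, by simp, .inr (by simp)⟩))

theorem mem_axiomLines_pneg :
    (outIdxs n m s t).map (fun c => Lit.pos (Sum.inr c)) ∈ axiomLines n m s t := by
  simp [axiomLines]

theorem mem_axiomLines_notMu {c : OutIdx n m s t} {l} (hl : l ∈ refRef n m s t c) :
    [notMu c, (l.map Sum.inl).compl] ∈ axiomLines n m s t := by
  simp only [axiomLines, List.mem_append, List.mem_flatMap]
  exact .inl (.inr ⟨c, mem_outIdxs c, List.mem_map.2 ⟨l, (mem_outClause c l).2 hl, rfl⟩⟩)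

theorem mem_axiomLines_gate {z : OutVar n m s t} {D} (hD : D ∈ gateLines z (pudlak n m s t z)) :
    D ∈ axiomLines n m s t := by
  simp only [axiomLines, List.mem_append, List.mem_flatMap]
  exact .inr ⟨z, mem_outVars z, hD⟩

theorem toFinset_mem_clauses {X Y : Type} [DecidableEq X] [DecidableEq Y] {z : Y} {g : Gate X}
    {D} (hD : D ∈ g.clauseList z) : D.toFinset ∈ g.clauses z := by
  cases g with
  | const b => cases b <;> simp_all [Gate.clauseList, Gate.clauses]
  | lit l =>
    simp only [Gate.clauseList, List.mem_cons, List.not_mem_nil, or_false] at hD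
    rcases hD with rfl | rfl <;> simp [Gate.clauses]
  | and l l' =>
    simp only [Gate.clauseList, List.mem_cons, List.not_mem_nil, or_false] at hD
    rcases hD with rfl | rfl | rfl <;> simp [Gate.clauses]

theorem axiomLines_subset {D} (hD : D ∈ axiomLines n m s t) : D.toFinset ∈ mainCNF n m s t := by
  simp only [axiomLines, List.mem_append, List.mem_flatMap] at hD
  rcases hD with ((⟨A, -, hD⟩ | hD) | ⟨c, -, hD⟩) | ⟨z, -, hD⟩
  · refine .inl (.inl ?_)
    rcases hD with ⟨l, -, hD⟩ | hD
    · simp only [List.mem_cons, List.not_mem_nil, or_false] at hD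
      rcases hD with rfl | rfl
      · exact ⟨_, .inl (.inl (.inl ⟨A, l, rfl⟩)), by simp [Clause.rename, Lit.map]⟩
      · rcases l with i | i
        · exact ⟨_, .inl (.inl (.inr ⟨A, i, rfl⟩)), by simp [Clause.rename, Lit.map, trueLit]⟩
        · exact ⟨_, .inl (.inr ⟨A, i, rfl⟩), by simp [Clause.rename, Lit.map, trueLit]⟩
    · refine ⟨_, .inr ⟨A, rfl⟩, ?_⟩
      simp only [List.mem_singleton] at hD
      subst hD
      ext l
      simp [Clause.rename, Lit.map, mem_allLit]
  · refine .inl (.inr (.inl ?_))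
    simp only [List.mem_singleton] at hD
    subst hD
    simp only [Set.mem_singleton_iff]
    ext l
    simp [mem_outIdxs]
  · refine .inl (.inr (.inr ?_))
    obtain ⟨l, hl, rfl⟩ := List.mem_map.1 hD
    exact ⟨c, l, (mem_outClause c l).1 hl, by simp⟩
  · refine .inr ?_
    simp only [gateLines, List.mem_map] at hD
    obtain ⟨D, hD, rfl⟩ := hD
    refine ⟨D.toFinset, Set.mem_iUnion.2 ⟨z, toFinset_mem_clauses hD⟩, ?_⟩
    exact (toFinset_map_image _ D).symm

/-- If the literals in `r` determine the value of a variable of `π`, its value follows from them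
by a clause of `π = P(φ, α, s)`. -/
theorem exists_gateLine {r : List (Option (Lit (SVar n m)))} {l : Lit (OutVar n m s t ⊕ SVar n m)}
    {z : OutVar n m s t} (hz : l.var = .inl z) (h : forces r l = true) :
    ∃ D ∈ gateLines z (pudlak n m s t z),
      D ⊆ (l.map Sum.inl : Lit (MainVar n m s t)) :: negs mainSVar r := by
  have hmem : ∀ l' : Lit (SVar n m), some l' ∈ r →
      (((l'.map Sum.inr : Lit (OutVar n m s t ⊕ SVar n m)).compl).map Sum.inl :
        Lit (MainVar n m s t)) ∈ negs mainSVar r := by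
    intro l' hl'
    have := mem_negs (e := mainSVar (s := s) (t := t)) hl'
    rcases l' with x | x <;> exact this
  have hmem' : ∀ l' : Lit (SVar n m), some l'.compl ∈ r →
      ((l'.map Sum.inr : Lit (OutVar n m s t ⊕ SVar n m)).map Sum.inl :
        Lit (MainVar n m s t)) ∈ negs mainSVar r := by
    intro l' hl'
    have := mem_negs (e := mainSVar (s := s) (t := t)) hl'
    rcases l' with x | x <;> exact this
  rcases l with w | w <;> simp only [Lit.var] at hz <;> subst hz <;>
    simp only [forces, outGate] at h <;> generalize pudlak n m s t z = g at h ⊢ <;> cases g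
  · simp only [Gate.forcesTrue] at h
    exact ⟨[.pos (.inl (.inl z))], by simp [gateLines, Gate.clauseList, h, Lit.map],
      by simp [Lit.map]⟩
  · simp only [Gate.forcesTrue, decide_eq_true_eq] at h
    refine ⟨_, List.mem_map_of_mem (List.mem_cons_of_mem _ (List.mem_cons_self ..)), ?_⟩
    simp [Lit.map_pos, hmem _ h]
  · simp only [Gate.forcesTrue, decide_eq_true_eq] at h
    refine ⟨_, List.mem_map_of_mem (List.mem_cons_of_mem _ (List.mem_cons_of_mem _
      (List.mem_cons_self ..))), ?_⟩
    simp [Lit.map_pos, hmem _ h.1, hmem _ h.2]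
  · simp only [Gate.forcesFalse, decide_eq_true_eq] at h
    exact ⟨[.neg (.inl (.inl z))], by simp [gateLines, Gate.clauseList, h, Lit.map],
      by simp [Lit.map]⟩
  · simp only [Gate.forcesFalse, decide_eq_true_eq] at h
    refine ⟨_, List.mem_map_of_mem (List.mem_cons_self ..), ?_⟩
    simp [Lit.map_neg, hmem' _ h]
  · simp only [Gate.forcesFalse, decide_eq_true_eq] at h
    rcases h with h | h
    · refine ⟨_, List.mem_map_of_mem (List.mem_cons_self ..), ?_⟩
      simp [Lit.map_neg, hmem' _ h]
    · refine ⟨_, List.mem_map_of_mem (List.mem_cons_of_mem _ (List.mem_cons_self ..)), ?_⟩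
      simp [Lit.map_neg, hmem' _ h]

variable {S : Set (List (Lit (MainVar n m s t)))}

/-- The literals in `r` are about `φ` and `α`, not about `π`. -/
theorem inl_ne_negs {z : OutVar n m s t} {l : Lit (MainVar n m s t)} (hl : l.var = .inl (.inl z))
    (r : List (Option (Lit (SVar n m)))) : l ∉ negs mainSVar r := by
  intro h
  simp only [negs, List.mem_flatMap, List.mem_map] at h
  obtain ⟨o, -, l', -, rfl⟩ := h
  rcases l' with x | x <;> simp [Lit.map, Lit.compl, Lit.var] at hl

/-- For every literal that is true because of `r`, its truth follows from a clause of `π = P(φ, α,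
s)` and is resolved with the clause of the pseudo-negation saying that it is false. -/
theorem derives_leafLines (hS : ∀ D ∈ axiomLines n m s t, D ∈ S) (c : OutIdx n m s t)
    (r : List (Option (Lit (SVar n m)))) :
    Derives (ResFrom (mainCNF n m s t)) S (leafLines c r) := by
  refine .flatMap_of_forall ResFrom.mono fun l hl => ?_
  split_ifs with hf
  swap
  · trivial
  have hax : [notMu c, (l.map Sum.inl).compl] ∈ S :=
    hS _ (mem_axiomLines_notMu ((mem_outClause c l).1 hl))
  cases hw : l.var with
  | inl z =>
    obtain ⟨D, hD, hsub⟩ := exists_gateLine hw hf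
    refine ⟨.weaken (hS _ (mem_axiomLines_gate hD)) hsub, ?_, trivial⟩
    have hv : (l.map Sum.inl : Lit (MainVar n m s t)).var = .inl (.inl z) := by
      rcases l with w | w <;> simp_all [Lit.map, Lit.var]
    refine .resolve (l.map .inl) (Set.mem_insert _ _) (Set.mem_insert_of_mem _ hax)
      (List.mem_cons_self ..) (by simp) fun a => ?_
    have h1 := inl_ne_negs hv r
    have h2 : notMu c ≠ (l.map Sum.inl).compl := by
      rcases l with w | w <;> simp [Lit.map, Lit.compl]
    simp only [List.mem_cons, List.not_mem_nil, or_false]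
    constructor
    · rintro (rfl | ha)
      · exact .inr ⟨.inl rfl, h2⟩
      · exact .inl ⟨.inr ha, fun h => h1 (h ▸ ha)⟩
    · tauto
  | inr x =>
    refine ⟨.weaken hax ?_, trivial⟩
    have : (l.map Sum.inl : Lit (MainVar n m s t)).compl ∈ negs mainSVar r := by
      rcases l with w | w <;> simp only [Lit.var] at hw <;> subst hw <;>
        simp only [forces, outGate, Gate.forcesTrue, Gate.forcesFalse, decide_eq_true_eq] at hf
      · exact mem_negs (e := mainSVar (s := s) (t := t)) hf
      · exact mem_negs (e := mainSVar (s := s) (t := t)) hf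
    simp [this]

theorem mem_leafLines {c : OutIdx n m s t} {r : List (Option (Lit (SVar n m)))} {l}
    (hl : l ∈ refRef n m s t c) (hf : forces r l = true) :
    notMu c :: negs mainSVar r ∈ leafLines c r := by
  simp only [leafLines, List.mem_flatMap]
  refine ⟨l, (mem_outClause c l).2 hl, ?_⟩
  rw [if_pos hf]
  simp

theorem Gate.length_vars_when {X : Type} (p : Prop) [Decidable p] (l : Lit X) :
    (Gate.when p (.lit l)).vars.length ≤ 1 := by
  unfold Gate.when
  split_ifs <;> simp [Gate.vars]

theorem Line.length_vars_lit (L : Line n) (z : Lit (InVar n m s)) : (L.lit z).vars.length ≤ 1 := by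
  cases L <;> rcases z with z | z <;> cases z <;>
    first
      | exact Nat.zero_le _
      | exact Gate.length_vars_when _ _

theorem Line.length_vars_res (L : Line n) (v : InVar n m s) : (L.res v).vars.length ≤ 1 := by
  unfold Line.res
  split <;>
    first
      | exact Nat.zero_le _
      | exact Gate.length_vars_when _ _

theorem Gate.length_vars {X : Type} (g : Gate X) : g.vars.length ≤ 2 := by
  cases g <;> simp [Gate.vars]

/-- A clause other than `mustRes` and `mustWeak` contains a bounded number of literals whose gates
are not constant, and these gates have at most three inputs together. -/
theorem length_branchVars (c : OutIdx n m s t) : (branchVars c).length ≤ 3 := by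
  have hlit : ∀ (b : Fin t) z, (pudlak n m s t (.lit b z)).vars.length ≤ 1 := by
    intro b z
    simp only [pudlak]
    split
    · exact Line.length_vars_lit _ _
    · simp [Gate.vars]
  have hres : ∀ (b : Fin t) z, (pudlak n m s t (.res b z)).vars.length ≤ 1 := by
    intro b z
    simp only [pudlak]
    split
    · exact Line.length_vars_res _ _
    · simp [Gate.vars]
  have hconst : ∀ b : Bool, (Gate.const (X := SVar n m) b).vars = [] := fun _ => rfl
  have hder : ∀ b : Fin t, (pudlak n m s t (.der b)).vars = [] := by
    intro b; simp only [pudlak]; split <;> rfl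
  have hlp : ∀ (b : Fin t) c, (pudlak n m s t (.lp b c)).vars = [] := by
    intro b c; simp only [pudlak]; split <;> rfl
  have hrp : ∀ (b : Fin t) c, (pudlak n m s t (.rp b c)).vars = [] := by
    intro b c; simp only [pudlak]; split <;> rfl
  have hen : ∀ b : Fin t, (pudlak n m s t (.en b)).vars = [] := fun b => rfl
  have hw := fun (b : Fin t) A => Gate.length_vars (pudlak n m s t (.weak b A))
  unfold branchVars
  cases hb : c.1.longBlock with
  | some b =>
    simp only [Option.elim_some]
    cases lineAt n m s t b with
    | none => simp
    | some L =>
      cases L <;> simp [Line.branchVars]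
      rename_i j
      cases (List.finRange n)[j - 1]? <;> simp
  | none =>
    obtain ⟨a, ha⟩ := c
    simp only [Option.elim_none, outClause]
    cases a <;> simp only [RAx.longBlock, reduceCtorEq] at hb <;>
      simp [refClauseList, Lit.var_pos, Lit.var_neg, outGate_inl, hen, hlp, hrp, hder,
        List.flatMap_map, negLits_refPhi_mem]
    case left B C x l =>
      have h1 := hres B x
      have h2 := hlit (earlier B C) l
      have h3 := hlit B l
      omega
    case right B C x l =>
      have h1 := hres B x
      have h2 := hlit (earlier B C) l
      have h3 := hlit B l
      omega
    case weak B A l =>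
      have h1 := hw B A
      have h2 := hlit B l
      omega
    case rootEmpty B l => exact (hlit B l).trans (by norm_num)
    case guard B A g =>
      have h1 := hw B A
      have h2 :
          (outGate (g.map Sum.inr : Lit (OutVar n m s t ⊕ SVar n m)).var).vars.length = 1 := by
        cases g <;> rfl
      omega

/-- `¬μ_c` is derived by branching, since the values of the branching variables determine a true
literal of the clause `c`. -/
theorem derives_branchLines (hs : 1 ≤ s) (ht : tau n m s ≤ t)
    (hS : ∀ D ∈ axiomLines n m s t, D ∈ S) (c : OutIdx n m s t) (hc : satClause c = none) :
    Derives (ResFrom (mainCNF n m s t)) S (branchLines c) := by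
  refine derives_branch (e := mainSVar) fun r1 h1 => ⟨derives_branch (e := mainSVar) fun r2 h2 =>
    ⟨derives_branch (e := mainSVar) fun r3 h3 => ⟨derives_leafLines hS c _, ?_⟩, ?_⟩, ?_⟩
  · suffices h : notMu c :: negs mainSVar [r1, r2, r3] ∈ leafLines c [r1, r2, r3] by
      simpa only [negs_cons, negs_nil, List.append_nil, List.cons_append,
        List.append_assoc] using h
    obtain ⟨l, hl, he, hv⟩ := exists_true_lit
      (ρ := fun x => decide (some (Lit.pos x) ∈ [r1, r2, r3])) hs ht c hc
    have key : ∀ a : Lit (SVar n m), a.var ∈ branchVars c →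
        a.eval (fun x => decide (some (Lit.pos x) ∈ [r1, r2, r3])) = true →
        some a ∈ [r1, r2, r3] := by
      intro a ha he
      have hmem : ∃ r ∈ [r1, r2, r3], r ∈ choices (some a.var) := by
        obtain ⟨i, hi, h⟩ := List.getElem_of_mem ha
        have hlen := length_branchVars c
        have hb : branchVar i c = some a.var := by simp [branchVar, hi, h]
        obtain rfl | rfl | rfl : i = 0 ∨ i = 1 ∨ i = 2 := by omega
        · exact ⟨r1, by simp, hb ▸ h1⟩
        · exact ⟨r2, by simp, hb ▸ h2⟩
        · exact ⟨r3, by simp, hb ▸ h3⟩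
      obtain ⟨r, hr, hr'⟩ := hmem
      rcases a with x | x
      · simpa only [Lit.eval, decide_eq_true_eq] using he
      · simp only [choices, Lit.var, List.mem_cons, List.not_mem_nil, or_false] at hr'
        rcases hr' with rfl | rfl
        · simp only [Lit.eval, hr, decide_true, Bool.not_true, Bool.false_eq_true] at he
        · exact hr
    have hcompl : ∀ a : Lit (SVar n m), a.var ∈ branchVars c →
        ¬a.eval (fun x => decide (some (Lit.pos x) ∈ [r1, r2, r3])) = true →
        some a.compl ∈ [r1, r2, r3] := by
      intro a ha he
      refine key _ (by rcases a with x | x <;> exact ha) ?_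
      rcases a with x | x <;> simpa only [Lit.compl, Lit.eval, Bool.not_eq_true, Bool.not_eq_false',
        Bool.not_eq_true', Bool.not_eq_false] using he
    refine mem_leafLines hl ?_
    rcases l with w | w
    · rw [eval_outEval_pos] at he
      simp only [Lit.var, forces] at hv ⊢
      cases hg : outGate w with
      | const b => simpa [hg, Gate.forcesTrue] using he
      | lit l =>
        rw [hg, Gate.holds_lit] at he
        exact decide_eq_true (key l (hv _ (by simp [hg, Gate.vars])) he)
      | and l l' =>
        rw [hg, Gate.holds_and] at he
        exact decide_eq_true ⟨key l (hv _ (by simp [hg, Gate.vars])) he.1,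
          key l' (hv _ (by simp [hg, Gate.vars])) he.2⟩
    · rw [eval_outEval_neg] at he
      simp only [Lit.var, forces] at hv ⊢
      cases hg : outGate w with
      | const b => simpa [hg, Gate.forcesFalse] using he
      | lit l =>
        rw [hg, Gate.holds_lit] at he
        exact decide_eq_true (hcompl l (hv _ (by simp [hg, Gate.vars])) he)
      | and l l' =>
        rw [hg, Gate.holds_and, not_and_or] at he
        exact decide_eq_true (he.imp (hcompl l (hv _ (by simp [hg, Gate.vars])))
          (hcompl l' (hv _ (by simp [hg, Gate.vars]))))
  · have h := mem_branch (branchVar 2 c) (notMu c :: negs mainSVar [r1, r2])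
      (fun r3 => leafLines c [r1, r2, r3])
    simpa only [negs_cons, negs_nil, List.append_nil, List.cons_append, List.append_assoc] using h
  · exact mem_branch _ (notMu c :: negs mainSVar [r1]) _

/-- `¬μ_c` is derived from the fact that the clause `A` of `φ` is satisfied. -/
theorem derives_satLines (hS : ∀ D ∈ axiomLines n m s t, D ∈ S) (c : OutIdx n m s t) {A : Fin m}
    (hc : satClause c = some A) : Derives (ResFrom (mainCNF n m s t)) S (satLines c A) := by
  refine .append (.flatMap_of_forall ResFrom.mono fun l _ => ?_) (derives_chainLines ?_ ?_)
  · obtain ⟨z, hz, hg⟩ := exists_satClause_lit hc l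
    obtain ⟨a1, a2⟩ := mem_axiomLines_sat (s := s) (t := t) A l
    have a3 := mem_axiomLines_notMu hz
    have a4 : [.pos (.inl (.inl z)), .neg (mainSVar (.alit A l)),
        ((trueLit l).map mainSVar).compl] ∈ axiomLines n m s t := by
      refine mem_axiomLines_gate (z := z) ?_
      rw [hg]
      rcases l with i | i <;> simp [gateLines, Gate.clauseList, trueLit, Lit.map, Lit.compl]
    refine ⟨?_, ?_, ?_, trivial⟩
    · refine .resolve (.pos (.inl (.inl z))) (hS _ a4) (hS _ a3) (by simp)
        (by simp [Lit.map, Lit.compl]) fun a => ?_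
      rcases l with i | i <;> simp [trueLit, Lit.map, Lit.compl] <;> grind
    · refine .resolve (.pos (mainSVar (.alit A l))) (.inr (hS _ a1)) (.inl rfl) (by simp)
        (by simp [Lit.compl]) fun a => ?_
      rcases l with i | i <;> simp [trueLit, Lit.map, Lit.compl] <;> grind
    · refine .resolve ((trueLit l).map mainSVar) (.inr (.inr (hS _ a2))) (.inl rfl) (by simp)
        (by simp) fun a => ?_
      rcases l with i | i <;> simp [trueLit, Lit.map, Lit.compl] <;> grind
  · exact ⟨_, .inl (hS _ (mem_axiomLines_satClause A)), by simp⟩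
  · intro a ha
    obtain ⟨l, hl, rfl⟩ := List.mem_map.1 ha
    refine ⟨[notMu c, .neg (mainSVar (.sat A l))], .inr ?_, by simp [Lit.compl], by
      simp [Lit.compl]⟩
    simp only [Set.mem_ofPred_eq, List.mem_flatMap]
    exact ⟨l, hl, by simp⟩

theorem derives_clauseLines (hs : 1 ≤ s) (ht : tau n m s ≤ t)
    (hS : ∀ D ∈ axiomLines n m s t, D ∈ S) (c : OutIdx n m s t) :
    Derives (ResFrom (mainCNF n m s t)) S (clauseLines c) := by
  unfold clauseLines
  cases hc : satClause c with
  | none => exact derives_branchLines hs ht hS c hc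
  | some A => exact derives_satLines hS c hc

theorem notMu_mem_clauseLines (c : OutIdx n m s t) : [notMu c] ∈ clauseLines c := by
  unfold clauseLines
  cases satClause c with
  | none => exact mem_branch _ [notMu c] _
  | some A => exact List.mem_append_right _ (mem_chainLines _ _)

theorem isRefutation_mainRefutation (hs : 1 ≤ s) (ht : tau n m s ≤ t) :
    IsRefutation (mainCNF n m s t) ((mainRefutation n m s t).map List.toFinset) := by
  refine isRefutation_of_derives (.append (.append ?_ ?_) (derives_chainLines ?_ ?_)) ?_
  · exact .of_forall ResFrom.mono fun D hD => .inl (axiomLines_subset hD)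
  · exact .flatMap_of_forall ResFrom.mono fun c _ =>
      derives_clauseLines hs ht (fun D hD => .inr hD) c
  · exact ⟨_, .inr (List.mem_append_left _ mem_axiomLines_pneg), by simp⟩
  · intro a ha
    obtain ⟨c, hc, rfl⟩ := List.mem_map.1 ha
    refine ⟨[notMu c], .inr (List.mem_append_right _ (List.mem_flatMap.2
      ⟨c, hc, notMu_mem_clauseLines c⟩)), by simp [Lit.compl], by simp [Lit.compl]⟩
  · simp only [mainRefutation, chainLines, List.range_succ, List.map_append, List.map_cons,
      List.map_nil, ← List.append_assoc, List.getLast?_append, List.getLast?_singleton]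
    simp

end Refutation

/-! ### Uniform polynomial-size refutations -/

/-- Every literal and every clause contributes at least one number to the code. -/
theorem clausesSize_le {V : Type} (e : V → List ℕ) (Q : List (List (Lit V))) :
    clausesSize Q ≤ (codeClauses e Q).length := by
  have hC : ∀ C : List (Lit V), C.length ≤ (C.flatMap (Lit.code e)).length := by
    intro C
    induction C with
    | nil => simp
    | cons l C ih =>
      rw [List.flatMap_cons, List.length_append, List.length_cons]
      have : 1 ≤ (l.code e).length := by cases l <;> simp [Lit.code]
      omega
  induction Q with
  | nil => simp [clausesSize]
  | cons C Q ih =>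
    have := hC C
    simp only [clausesSize, codeClauses, List.map_cons, List.sum_cons, List.flatMap_cons,
      List.length_append, List.length_singleton] at ih ⊢
    omega

theorem mainTheorem5 :
    -- the size of the refutations is `Θ(s(m + sn²))`
    (∃ c C : ℕ, 0 < c ∧ ∀ n m s : ℕ,
      (1 ≤ s → 1 ≤ n + m → tau n m s ≤ C * (s * (m + s * n ^ 2))) ∧
      (2 ≤ s → s * (m + s * n ^ 2) ≤ c * tau n m s)) ∧
    -- `P` is a polynomial-size circuit of depth 2 and fan-in 2
    (∀ n m s t : ℕ, ∀ z : OutVar n m s t, (pudlak n m s t z).toCircuit.depth ≤ 2) ∧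
    (∃ p : Polynomial ℕ, ∀ n m s t : ℕ,
      ∑ z : OutVar n m s t, (pudlak n m s t z).toCircuit.size ≤ p.eval (n + m + s + t)) ∧
    -- from a satisfying assignment it constructs a refutation of `Ref_s(φ)` with `τ` clauses
    (∀ n m s t : ℕ, 1 ≤ s → tau n m s ≤ t →
      ∀ (φ : Fin m → Clause (Fin n)) (α : Fin n → Bool), (∀ A, (φ A).Sat α) →
        (∀ c : OutIdx n m s t, (refRef n m s t c).Sat (pudlakOutput s t φ α)) ∧
        (Finset.univ.filter
          (fun b : Fin t => pudlakOutput s t φ α (.inl (.en b)) = true)).card = tau n m s) ∧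
    -- and Resolution proves this, uniformly and in polynomial size
    (∃ (p : Polynomial ℕ) (M : Prog), ∀ n m s t : ℕ, 1 ≤ s → tau n m s ≤ t →
      ∃ Q : List (List (Lit (MainVar n m s t))),
        IsRefutation (mainCNF n m s t) (Q.map List.toFinset) ∧
        clausesSize Q ≤ p.eval (n + m + s + t) ∧
        ∃ k ≤ p.eval (n + m + s + t), M.Computes n m s t (codeClauses mainCode Q) k) := by
  refine ⟨⟨2, 14, by norm_num, fun n m s => ⟨tau_le, le_tau⟩⟩, fun n m s t z => Gate.depth_le _,
    exists_size_pudlak_le, fun n m s t hs ht φ α hφ =>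
      ⟨sat_refRef hs ht hφ, card_enabled ht φ α⟩, ?_⟩
  obtain ⟨P, M, h⟩ := polyList_mainRefutation.exists_prog
  exact ⟨P, M, fun n m s t hs ht => ⟨mainRefutation n m s t, isRefutation_mainRefutation hs ht,
    (clausesSize_le mainCode _).trans (h n m s t).1, (h n m s t).2⟩⟩
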